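/- All graphs are finite and simple. A graph $G$ is *chordal* if it has no induced cycle of length at least $4$. It is a *path graph* if there are a tree $T$, a collection $\mathcal P$ of paths of $T$ and a bijection $\phi:V(G)\to\mathcal P$ such that two distinct vertices $u,v$ are adjacent if and only if the vertex sets of $\phi(u)$ and $\phi(v)$ intersect. *Attachedness graphs.* A *clique separator* of $G$ is an inclusion-wise maximal clique $Q$ of $G$ such that $G-Q$ has at least two connected components. For a clique $Q$ of $G$ let $V_1,\dots,V_s$ be the vertex sets of the components of $G-Q$, let $\gamma_i=G[V_i\cup Q]$ and $\Gamma_Q=\{\gamma_1,\dots,\gamma_s\}$. A *relevant clique* of $\gamma\in\Gamma_Q$ is a maximal clique $K$ of $\gamma$ with $K\cap Q\ne\emptyset$ and $K\neq Q$; $\gamma$ is a *neighboring subgraph* of a vertex $v$ if $v$ lies in a relevant clique of $\gamma$. For $\gamma,\gamma'\in\Gamma_Q$ write - $\gamma\Join\gamma'$ (*attached*) if $K\cap K'\cap Q\neq\emptyset$ for some relevant cliques $K$ of $\gamma$ and $K'$ of $\gamma'$; - $\gamma\le\gamma'$ (*dominance*) if $\gamma\Join\gamma'$ and for each relevant clique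 $K'$ of $\gamma'$ either $K\cap Q\subseteq K'\cap Q$ for every relevant clique $K$ of $\gamma$, or $K\cap K'\cap Q=\emptyset$ for every relevant clique $K$ of $\gamma$; - $\gamma\leftrightarrow\gamma'$ (*antipodality*) if $\gamma\Join\gamma'$, $\gamma\not\le\gamma'$ and $\gamma'\not\le\gamma$. The *$Q$-attachedness graph* of $G$ has vertex set $\Gamma_Q$; distinct $\gamma,\gamma'$ are joined if $\gamma\Join\gamma'$, by an *antipodal* edge if $\gamma\leftrightarrow\gamma'$ and by a *dominance* edge otherwise. A *full antipodal triangle* consists of three distinct, pairwise antipodal members of $\Gamma_Q$ that are neighboring subgraphs of a common vertex of $Q$. *Forbidden graphs.* For $k\ge1$, $W^{(0)}_{2k+1}$ is the wheel whose rim is a cycle on $2k+1$ vertices, with all rim edges antipodal and all spokes dominance edges; $W^{(1)}_{2k+1}$ is obtained from it by making exactly one spoke antipodal. For $n\ge2$, $F_{2n+1}$ has vertices $0,1,\dots,2n$, the edges of the cycle $0,1,\dots,2n,0$ as antipodal edges, and the edges $0j$, $2\le j\le 2n-1$, as dominance edges; $\widetilde F_{2n+1}$ is $F_{2n+1}$ with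 the additional antipodal edge joining $1$ and $2n$; $DF_{2n+1}$ is $F_{2n+1}$ with the additional dominance edges $1j$, $3\le j\le 2n$. Let $$\mathcal F_0=\{W^{(0)}_{2k+1},W^{(1)}_{2k+1},F_{2n+1}\mid k\ge1,n\ge2\},\qquad \mathcal F=\mathcal F_0\cup\{\widetilde F_{2n+1},DF_{2n+1}\mid n\ge2\}.$$ Isomorphisms of 2-edge-colored graphs preserve edge colors. Finally, $G^+$ is obtained from $G$ by adding, for each $v\in V(G)$, a new vertex $v^+$ adjacent only to $v$. **Theorem.** Let $G$ be a chordal graph. The following are equivalent: (a) $G$ is a path graph; (b) for every clique separator $Q$ of $G$, the $Q$-attachedness graph of $G$ has no full antipodal triangle and no subgraph isomorphic to a graph in $\mathcal F_0$; (c) for every clique separator $Q$ of $G$, the $Q$-attachedness graph of $G^+$ has no subgraph isomorphic to a graph in $\mathcal F_0$; (d) for every clique separator $Q$ of $G$, the $Q$-attachedness graph of $G$ has no full antipodal triangle and no induced subgraph isomorphic to a graph in $\mathcal F$; (e) for every clique separator $Q$ of $G$, the $Q$-attachedness graph of $G^+$ has no induced subgraph isomorphic to a graph in $\mathcal F$.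 -/

import Mathlib

universe u

namespace PathGraphs

/-! ### Chordal graphs and path graphs -/

/-- A graph is chordal if it has no induced cycle of length at least four. -/
def IsChordal {V : Type u} (G : SimpleGraph V) : Prop :=
  ∀ n : ℕ, 4 ≤ n → IsEmpty (SimpleGraph.cycleGraph n ↪g G)

/-- `S` is the vertex set of a path of `T` (a single vertex is a path). -/
def IsPathSet {W : Type u} (T : SimpleGraph W) (S : Set W) : Prop :=
  ∃ (a b : W) (p : T.Walk a b), p.IsPath ∧ S = {x | x ∈ p.support}

/-- `G` is a path graph: there are a finite tree `T` and a bijection `φ` from the vertices of `G`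
to a collection of paths of `T` (the range of `φ`) such that two distinct vertices are adjacent
if and only if the vertex sets of their paths intersect. A path of a tree is determined by its
vertex set. -/
def IsPathGraph {V : Type u} (G : SimpleGraph V) : Prop :=
  ∃ (W : Type u) (_ : Finite W) (T : SimpleGraph W) (φ : V → Set W),
    T.IsTree ∧ (∀ v, IsPathSet T (φ v)) ∧ Function.Injective φ ∧
      ∀ v w, v ≠ w → (G.Adj v w ↔ (φ v ∩ φ w).Nonempty)

/-! ### Clique separators and the members of `Γ_Q` -/

/-- `K` is an inclusion-wise maximal clique of the subgraph of `G` induced by `S`. -/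
def IsMaxCliqueIn {V : Type u} (G : SimpleGraph V) (S K : Set V) : Prop :=
  Maximal (fun L : Set V => G.IsClique L ∧ L ⊆ S) K

/-- The connected components of `G - Q`. They index `Γ_Q`: the component `c` with vertex set `V_c`
stands for the member `γ_c = G[V_c ∪ Q]`, and distinct components give distinct members. -/
abbrev Comp {V : Type u} (G : SimpleGraph V) (Q : Set V) : Type u :=
  (G.induce Qᶜ).ConnectedComponent

/-- The vertex set `V_c ∪ Q` of `γ_c`. -/
def piece {V : Type u} (G : SimpleGraph V) (Q : Set V) (c : Comp G Q) : Set V :=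
  (Subtype.val '' c.supp) ∪ Q

/-- `Q` is a clique separator: a maximal clique of `G` such that `G - Q` has at least two connected
components. -/
def IsCliqueSeparator {V : Type u} (G : SimpleGraph V) (Q : Set V) : Prop :=
  IsMaxCliqueIn G Set.univ Q ∧ Nontrivial (Comp G Q)

/-- `K` is a relevant clique of `γ_c`: a maximal clique of `γ_c` that meets `Q` and is not `Q`. -/
def IsRelevant {V : Type u} (G : SimpleGraph V) (Q : Set V) (c : Comp G Q) (K : Set V) : Prop :=
  IsMaxCliqueIn G (piece G Q c) K ∧ (K ∩ Q).Nonempty ∧ K ≠ Q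

/-- `γ_c` is a neighboring subgraph of the vertex `v`. -/
def IsNeighboring {V : Type u} (G : SimpleGraph V) (Q : Set V) (c : Comp G Q) (v : V) : Prop :=
  ∃ K, IsRelevant G Q c K ∧ v ∈ K

/-- Attachedness. -/
def Attached {V : Type u} (G : SimpleGraph V) (Q : Set V) (c d : Comp G Q) : Prop :=
  ∃ K L, IsRelevant G Q c K ∧ IsRelevant G Q d L ∧ (K ∩ L ∩ Q).Nonempty

/-- Dominance: `γ_c ≤ γ_d`. -/
def Dominated {V : Type u} (G : SimpleGraph V) (Q : Set V) (c d : Comp G Q) : Prop :=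
  Attached G Q c d ∧ ∀ L, IsRelevant G Q d L →
    (∀ K, IsRelevant G Q c K → K ∩ Q ⊆ L ∩ Q) ∨ (∀ K, IsRelevant G Q c K → K ∩ L ∩ Q = ∅)

/-- Antipodality: `γ_c` and `γ_d` are attached and neither dominates the other, so that antipodal
and comparable pairs partition the attached pairs of distinct members. -/
def Antipodal {V : Type u} (G : SimpleGraph V) (Q : Set V) (c d : Comp G Q) : Prop :=
  Attached G Q c d ∧ ¬ Dominated G Q c d ∧ ¬ Dominated G Q d c

theorem Attached.symm {V : Type u} {G : SimpleGraph V} {Q : Set V} {c d : Comp G Q}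
    (h : Attached G Q c d) : Attached G Q d c := by
  obtain ⟨K, L, hK, hL, x, ⟨hx, hx'⟩, hxQ⟩ := h
  exact ⟨L, K, hL, hK, x, ⟨hx', hx⟩, hxQ⟩

/-! ### Two-edge-colored graphs -/

/-- A 2-edge-colored graph. The two colors are called antipodal (drawn solid) and dominance
(drawn dotted). -/
structure TwoColoredGraph (U : Type u) where
  antip : SimpleGraph U
  dom : SimpleGraph U
  disj : ∀ i j, antip.Adj i j → ¬ dom.Adj i j

/-- `M` has a (not necessarily induced) subgraph isomorphic to `S` as 2-edge-colored graph. -/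
def HasCopy {U : Type*} {W : Type*} (S : TwoColoredGraph U) (M : TwoColoredGraph W) : Prop :=
  ∃ f : U → W, Function.Injective f ∧
    (∀ i j, S.antip.Adj i j → M.antip.Adj (f i) (f j)) ∧
    (∀ i j, S.dom.Adj i j → M.dom.Adj (f i) (f j))

/-- `M` has an induced subgraph isomorphic to `S` as 2-edge-colored graph. -/
def HasInducedCopy {U : Type*} {W : Type*} (S : TwoColoredGraph U) (M : TwoColoredGraph W) :
    Prop :=
  ∃ f : U → W, Function.Injective f ∧
    (∀ i j, S.antip.Adj i j ↔ M.antip.Adj (f i) (f j)) ∧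
    (∀ i j, S.dom.Adj i j ↔ M.dom.Adj (f i) (f j))

/-- The `Q`-attachedness graph of `G`, 2-edge-colored by antipodality and dominance edges. -/
def attachednessGraph {V : Type u} (G : SimpleGraph V) (Q : Set V) :
    TwoColoredGraph (Comp G Q) where
  antip :=
    { Adj := fun c d => c ≠ d ∧ Antipodal G Q c d
      symm := ⟨fun _ _ h => ⟨h.1.symm, h.2.1.symm, h.2.2.2, h.2.2.1⟩⟩
      loopless := ⟨fun _ h => h.1 rfl⟩ }
  dom :=
    { Adj := fun c d => c ≠ d ∧ (Dominated G Q c d ∨ Dominated G Q d c)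
      symm := ⟨fun _ _ h => ⟨h.1.symm, h.2.symm⟩⟩
      loopless := ⟨fun _ h => h.1 rfl⟩ }
  disj := fun _ _ h h' => h'.2.elim h.2.2.1 h.2.2.2

/-- The `Q`-attachedness graph of `G` has a full antipodal triangle: three pairwise antipodal
members of `Γ_Q` that are neighboring subgraphs of a common vertex of `Q`. -/
def HasFullAntipodalTriangle {V : Type u} (G : SimpleGraph V) (Q : Set V) : Prop :=
  ∃ c₁ c₂ c₃ : Comp G Q,
    (attachednessGraph G Q).antip.Adj c₁ c₂ ∧
    (attachednessGraph G Q).antip.Adj c₂ c₃ ∧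
    (attachednessGraph G Q).antip.Adj c₁ c₃ ∧
    ∃ v ∈ Q, IsNeighboring G Q c₁ v ∧ IsNeighboring G Q c₂ v ∧ IsNeighboring G Q c₃ v

/-! ### The forbidden 2-edge-colored graphs -/

/-- The antipodal edges are those of `H`; the dominance edges are all other pairs of distinct
vertices with at least one end in `hubs`. -/
def withHubs {U : Type u} (H : SimpleGraph U) (hubs : Set U) : TwoColoredGraph U where
  antip := H
  dom :=
    { Adj := fun i j => i ≠ j ∧ (i ∈ hubs ∨ j ∈ hubs) ∧ ¬ H.Adj i j
      symm := ⟨fun _ _ h => ⟨h.1.symm, h.2.1.symm, fun h' => h.2.2 h'.symm⟩⟩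
      loopless := ⟨fun _ h => h.1 rfl⟩ }
  disj := fun _ _ h h' => h'.2.2 h

/-- The cycle on the `m` vertices `some i`, together with the isolated vertex `none`. -/
def rim (m : ℕ) : SimpleGraph (Option (Fin m)) :=
  (SimpleGraph.cycleGraph m).map Function.Embedding.some

/-- `W^(0)_{2k+1}`: the `(2k+1)`-wheel with antipodal rim and dominance spokes. -/
def wheelZero (k : ℕ) : TwoColoredGraph (Option (Fin (2 * k + 1))) :=
  withHubs (rim (2 * k + 1)) {none}

/-- `W^(1)_{2k+1}`: the `(2k+1)`-wheel with antipodal rim, exactly one antipodal spoke and all other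
spokes dominance edges. -/
def wheelOne (k : ℕ) : TwoColoredGraph (Option (Fin (2 * k + 1))) :=
  withHubs (rim (2 * k + 1) ⊔ SimpleGraph.edge none (some 0)) {none}

/-- `F_{2n+1}`: the `(2n+1)`-fan with center `0` and path `1, …, 2n`. The edges of the path and
those from the center to the two ends of the path are antipodal (together they form the cycle
`0, 1, …, 2n`), the other edges at the center are dominance edges. -/
def fan (n : ℕ) : TwoColoredGraph (Fin (2 * n + 1)) :=
  withHubs (SimpleGraph.cycleGraph (2 * n + 1)) {0}

/-- `F̃_{2n+1}`: the fan `F_{2n+1}` with an additional antipodal edge between the ends `1` and `2n`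
of the path. -/
def chordedFan (n : ℕ) : TwoColoredGraph (Fin (2 * n + 1)) :=
  withHubs (SimpleGraph.cycleGraph (2 * n + 1) ⊔ SimpleGraph.edge 1 (Fin.last (2 * n))) {0}

/-- `DF_{2n+1}`: the `(2n+1)`-double fan; the edges of the cycle `0, 1, …, 2n` are antipodal and all
other edges, from the consecutive vertices `0` and `1`, are dominance edges. -/
def doubleFan (n : ℕ) : TwoColoredGraph (Fin (2 * n + 1)) :=
  withHubs (SimpleGraph.cycleGraph (2 * n + 1)) {0, 1}

/-- The collection `𝓕₀`. -/
def familyZero : Set (Σ U : Type, TwoColoredGraph U) :=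
  {S | (∃ k : ℕ, 1 ≤ k ∧ (S = ⟨_, wheelZero k⟩ ∨ S = ⟨_, wheelOne k⟩)) ∨
    (∃ n : ℕ, 2 ≤ n ∧ S = ⟨_, fan n⟩)}

/-- The collection `𝓕`. -/
def family : Set (Σ U : Type, TwoColoredGraph U) :=
  familyZero ∪ {S | ∃ n : ℕ, 2 ≤ n ∧ (S = ⟨_, chordedFan n⟩ ∨ S = ⟨_, doubleFan n⟩)}

/-! ### The graph `G⁺` -/

/-- `G⁺`: a pendant vertex `v⁺ = inr v` is attached to every vertex `v = inl v` of `G`. -/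
def plus {V : Type u} (G : SimpleGraph V) : SimpleGraph (V ⊕ V) where
  Adj
    | Sum.inl v, Sum.inl w => G.Adj v w
    | Sum.inl v, Sum.inr w => v = w
    | Sum.inr v, Sum.inl w => v = w
    | Sum.inr _, Sum.inr _ => False
  symm := ⟨by
    rintro (v | v) (w | w) h
    · exact SimpleGraph.Adj.symm (G := G) h
    · exact Eq.symm h
    · exact Eq.symm h
    · exact h⟩
  loopless := ⟨by
    rintro (v | v) h
    · exact G.irrefl h
    · exact h⟩

end PathGraphs

/-!
All conditions are compared with the following one: for every clique separator `Q`, the members of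
`Γ_Q` can be colored so that antipodal members get distinct colors and every vertex of `Q` sees
members of at most two colors.

If `G` is represented by paths of a tree, a maximal clique `Q` is the set of vertices whose paths
contain some node `q`; every component of `G - Q` uses nodes on one side of `q`, and coloring the
members of `Γ_Q` by these sides works. Such a coloring excludes the forbidden configurations:
dominance by a hub confines a whole antipodal odd cycle to two colors. Conversely, if all induced
forbidden graphs are absent, then below any member of `Γ_Q` the antipodality graph is bipartite, and
these bipartitions, taken below the maximal members, assemble to a coloring. Finally, given a
coloring, path representations of the smaller graphs `γ_c` exist by induction; they are glued along
`Q` in the order of decreasing dominance, every color forming one arm at the node of `Q`. A chordal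
graph without clique separator has at most two maximal cliques.

In `G⁺` the pendant vertex at `x ∈ Q` is one more member of `Γ_Q`. It is dominated by every member
that has `x` as a neighbor, so it turns a full antipodal triangle at `x` into the wheel `W^{(0)}_3`.
-/

universe v

namespace PathGraphs

/-! ### Cycles as sequences -/

/-- Adjacency in the cycle `0, 1, …, m - 1`. Cycles, wheels and fans are handled as sequences
indexed by `ℕ`, so that questions about indices are linear arithmetic. -/
def CycAdj (m i j : ℕ) : Prop :=
  j = i + 1 ∨ i = j + 1 ∨ (i = 0 ∧ j + 1 = m) ∨ (j = 0 ∧ i + 1 = m)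

lemma CycAdj.symm {m i j : ℕ} (h : CycAdj m i j) : CycAdj m j i := by
  unfold CycAdj at *; omega

lemma val_sub_eq_one_iff {m : ℕ} (hm : 2 ≤ m) (a b : Fin m) :
    (a - b).val = 1 ↔ a.val = b.val + 1 ∨ (a.val = 0 ∧ b.val + 1 = m) := by
  rcases le_or_gt b a with h | h
  · rw [Fin.sub_val_of_le h]
    omega
  · rw [Fin.coe_sub_iff_lt.2 h]
    omega

lemma cycleGraph_adj_iff_cycAdj {m : ℕ} (hm : 2 ≤ m) (u v : Fin m) :
    (SimpleGraph.cycleGraph m).Adj u v ↔ CycAdj m u v := by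
  rw [SimpleGraph.cycleGraph_adj', val_sub_eq_one_iff hm, val_sub_eq_one_iff hm, CycAdj]
  omega

/-- The index `s + t` modulo `m`, for `s, t < m`: it rotates a cycle of length `m` by `s`. -/
def rotIndex (m s t : ℕ) : ℕ := if s + t < m then s + t else s + t - m

section rotIndex

variable {m s i j : ℕ}

lemma rotIndex_lt (hs : s < m) (hi : i < m) : rotIndex m s i < m := by
  unfold rotIndex; split_ifs <;> omega

lemma rotIndex_inj (hi : i < m) (hj : j < m) (h : rotIndex m s i = rotIndex m s j) : i = j := by
  unfold rotIndex at h; split_ifs at h <;> omega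

lemma rotIndex_zero (hs : s < m) : rotIndex m s 0 = s := by
  unfold rotIndex; split_ifs <;> omega

lemma exists_rotIndex_eq (hs : s < m) (hi : i < m) : ∃ t < m, rotIndex m s t = i := by
  by_cases h : s ≤ i
  · exact ⟨i - s, by omega, by unfold rotIndex; split_ifs <;> omega⟩
  · exact ⟨i + m - s, by omega, by unfold rotIndex; split_ifs <;> omega⟩

lemma cycAdj_rotIndex_iff (hm : 3 ≤ m) (hs : s < m) (hi : i < m) (hj : j < m) :
    CycAdj m (rotIndex m s i) (rotIndex m s j) ↔ CycAdj m i j := by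
  unfold CycAdj rotIndex; split_ifs <;> omega

end rotIndex

/-- The vertices `g 0, …, g (m - 1)`, in this order, form a cycle of `H`. -/
structure IsCycleIn {Γ : Type u} (H : SimpleGraph Γ) (m : ℕ) (g : ℕ → Γ) : Prop where
  inj : ∀ i < m, ∀ j < m, g i = g j → i = j
  adj_succ : ∀ i, i + 1 < m → H.Adj (g i) (g (i + 1))
  adj_last : ∀ i, i + 1 = m → H.Adj (g i) (g 0)

namespace IsCycleIn

variable {Γ : Type u} {H : SimpleGraph Γ} {m : ℕ} {g : ℕ → Γ}

lemma congr (h : IsCycleIn H m g) {g' : ℕ → Γ} (hgg' : ∀ i < m, g i = g' i) :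
    IsCycleIn H m g' where
  inj i hi j hj := by
    rw [← hgg' i hi, ← hgg' j hj]
    exact h.inj i hi j hj
  adj_succ i hi := by
    rw [← hgg' i (by omega), ← hgg' (i + 1) hi]
    exact h.adj_succ i hi
  adj_last i hi := by
    rw [← hgg' i (by omega), ← hgg' 0 (by omega)]
    exact h.adj_last i hi

lemma adj_of_cycAdj (h : IsCycleIn H m g) {i j : ℕ} (hi : i < m) (hj : j < m)
    (hij : CycAdj m i j) : H.Adj (g i) (g j) := by
  rcases hij with rfl | rfl | ⟨rfl, hjm⟩ | ⟨rfl, him⟩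
  · exact h.adj_succ _ hj
  · exact (h.adj_succ _ hi).symm
  · exact (h.adj_last _ hjm).symm
  · exact h.adj_last _ him

lemma rotate (h : IsCycleIn H m g) (hm : 3 ≤ m) {s : ℕ} (hs : s < m) :
    IsCycleIn H m (fun t => g (rotIndex m s t)) where
  inj i hi j hj hij :=
    rotIndex_inj hi hj (h.inj _ (rotIndex_lt hs hi) _ (rotIndex_lt hs hj) hij)
  adj_succ i hi := h.adj_of_cycAdj (rotIndex_lt hs (by omega)) (rotIndex_lt hs hi)
    ((cycAdj_rotIndex_iff hm hs (by omega) hi).2 (Or.inl rfl))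
  adj_last i hi := h.adj_of_cycAdj (rotIndex_lt hs (by omega)) (rotIndex_lt hs (by omega))
    ((cycAdj_rotIndex_iff hm hs (by omega) (by omega)).2 (Or.inr (Or.inr (Or.inr ⟨rfl, hi⟩))))

lemma inner (h : IsCycleIn H m g) {i j : ℕ} (hij : i < j) (hj : j < m) (hc : H.Adj (g i) (g j)) :
    IsCycleIn H (j - i + 1) (fun t => g (i + t)) where
  inj a ha b hb hab := by
    have := h.inj _ (by omega) _ (by omega) hab
    omega
  adj_succ a ha := h.adj_succ (i + a) (by omega)
  adj_last a ha := by
    obtain rfl : j = i + a := by omega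
    exact hc.symm

lemma outer (h : IsCycleIn H m g) {i j : ℕ} (hij : i < j) (hj : j < m) (hc : H.Adj (g i) (g j)) :
    IsCycleIn H (m - (j - i - 1)) (fun t => g (if t ≤ i then t else t + (j - i - 1))) where
  inj a ha b hb hab := by
    have := h.inj _ (by split_ifs <;> omega) _ (by split_ifs <;> omega) hab
    split_ifs at this <;> omega
  adj_succ a ha := by
    rcases lt_trichotomy a i with hai | rfl | hia
    · rw [if_pos hai.le, if_pos (by omega)]
      exact h.adj_succ a (by omega)
    · rw [if_pos le_rfl, if_neg (by omega), show a + 1 + (j - a - 1) = j by omega]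
      exact hc
    · rw [if_neg (by omega), if_neg (by omega), Nat.add_right_comm]
      exact h.adj_succ _ (by omega)
  adj_last a ha := by
    rw [if_neg (by omega), if_pos (Nat.zero_le i)]
    exact h.adj_last _ (by omega)

end IsCycleIn

/-! ### Chordless antipodal cycles -/

/-- A strict order whose comparable pairs are the dominance edges and which interacts with the
antipodal edges as in an attachedness graph: this is all that is needed of dominance to find the
forbidden graphs. -/
structure DominanceOrder {Γ : Type u} (M : TwoColoredGraph Γ) where
  lt : Γ → Γ → Prop
  irrefl : ∀ i, ¬ lt i i
  trans : ∀ {i j k}, lt i j → lt j k → lt i k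
  dom_iff : ∀ i j, M.dom.Adj i j ↔ lt i j ∨ lt j i
  antip_or_lt : ∀ {i j k}, lt i j → M.antip.Adj i k → M.antip.Adj k j ∨ lt k j

/-- A cycle of antipodal edges without antipodal chords. -/
structure IsChordlessCycle {Γ : Type u} (M : TwoColoredGraph Γ) (m : ℕ) (g : ℕ → Γ) : Prop
    extends IsCycleIn M.antip m g where
  chordless : ∀ i < m, ∀ j < m, M.antip.Adj (g i) (g j) → CycAdj m i j

section ChordlessCycle

variable {Γ : Type u} {M : TwoColoredGraph Γ} {m : ℕ} {g : ℕ → Γ}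

lemma IsCycleIn.isChordlessCycle (h : IsCycleIn M.antip m g)
    (hch : ∀ i j, i < j → j < m → M.antip.Adj (g i) (g j) → CycAdj m i j) :
    IsChordlessCycle M m g where
  toIsCycleIn := h
  chordless i hi j hj hadj := by
    rcases lt_trichotomy i j with hij | rfl | hji
    · exact hch i j hij hj hadj
    · exact absurd hadj M.antip.irrefl
    · exact (hch j i hji hi hadj.symm).symm

lemma IsChordlessCycle.antip_iff (h : IsChordlessCycle M m g) {i j : ℕ} (hi : i < m) (hj : j < m) :
    M.antip.Adj (g i) (g j) ↔ CycAdj m i j :=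
  ⟨h.chordless i hi j hj, h.adj_of_cycAdj hi hj⟩

lemma IsChordlessCycle.rotate (h : IsChordlessCycle M m g) (hm : 3 ≤ m) {s : ℕ} (hs : s < m) :
    IsChordlessCycle M m (fun t => g (rotIndex m s t)) where
  toIsCycleIn := h.toIsCycleIn.rotate hm hs
  chordless _ hi _ hj hadj := (cycAdj_rotIndex_iff hm hs hi hj).1
    (h.chordless _ (rotIndex_lt hs hi) _ (rotIndex_lt hs hj) hadj)

lemma hasInducedCopy_withHubs {U : Type v} {H : SimpleGraph U} {hubs : Set U} (f : U → Γ)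
    (hf : Function.Injective f) (hant : ∀ x y, H.Adj x y ↔ M.antip.Adj (f x) (f y))
    (hdom : ∀ x y, x ≠ y → ¬ H.Adj x y → ((x ∈ hubs ∨ y ∈ hubs) ↔ M.dom.Adj (f x) (f y))) :
    HasInducedCopy (withHubs H hubs) M := by
  refine ⟨f, hf, hant, fun x y => ⟨fun ⟨hne, hhub, hna⟩ => (hdom x y hne hna).1 hhub,
    fun hd => ?_⟩⟩
  have hne : x ≠ y := fun he => hd.ne (congrArg f he)
  have hna : ¬ H.Adj x y := fun ha => M.disj _ _ ((hant x y).1 ha) hd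
  exact ⟨hne, (hdom x y hne hna).2 hd, hna⟩

variable (D : DominanceOrder M)

lemma DominanceOrder.dom_of_lt {i j : Γ} (h : D.lt i j) : M.dom.Adj i j :=
  (D.dom_iff _ _).2 (Or.inl h)

lemma DominanceOrder.not_antip_of_lt {i j : Γ} (h : D.lt i j) : ¬ M.antip.Adj i j :=
  fun h' => M.disj _ _ h' (D.dom_of_lt h)

-- `antip_or_lt` carries dominance by `g 0` along the path `g 2, …, g (m - 2)` in both directions.
lemma IsChordlessCycle.lt_zero_of_lt_zero (h : IsChordlessCycle M m g) {i : ℕ} (hi : i < m)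
    (hlt : D.lt (g i) (g 0)) {t : ℕ} (ht : 2 ≤ t) (htm : t + 2 ≤ m) : D.lt (g t) (g 0) := by
  have spread : ∀ a < m, ∀ b, 2 ≤ b → b + 2 ≤ m → CycAdj m a b → D.lt (g a) (g 0) →
      D.lt (g b) (g 0) := by
    intro a ha b hb hbm hab hlt
    refine (D.antip_or_lt hlt ((h.antip_iff ha (by omega)).2 hab)).resolve_left fun hb0 => ?_
    have := (h.antip_iff (by omega) (by omega)).1 hb0
    unfold CycAdj at this
    omega
  have hi0 : i ≠ 0 := by rintro rfl; exact D.irrefl _ hlt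
  have hna : ¬ CycAdj m i 0 := fun hc =>
    D.not_antip_of_lt hlt ((h.antip_iff hi (by omega)).2 hc)
  have hi2 : 2 ≤ i ∧ i + 2 ≤ m := by unfold CycAdj at hna; omega
  rcases le_total i t with hit | hti
  · induction t, hit using Nat.le_induction with
    | base => exact hlt
    | succ s his ih =>
      exact spread s (by omega) _ ht htm (Or.inl rfl) (ih (by omega) (by omega))
  · refine Nat.decreasingInduction' (fun s hsi hts ih => ?_) hti hlt
    exact spread (s + 1) (by omega) _ (by omega) (by omega) (Or.inr (Or.inl rfl)) ih

lemma IsChordlessCycle.lt_of_lt (h : IsChordlessCycle M m g) (hm : 3 ≤ m) {i j t : ℕ} (hi : i < m)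
    (hj : j < m) (ht : t < m) (hlt : D.lt (g i) (g j)) (htj : t ≠ j) (hnc : ¬ CycAdj m t j) :
    D.lt (g t) (g j) := by
  obtain ⟨i', hi', rfl⟩ := exists_rotIndex_eq hj hi
  obtain ⟨t', ht', rfl⟩ := exists_rotIndex_eq hj ht
  have hj0 := rotIndex_zero hj
  have ht0 : t' ≠ 0 := by rintro rfl; exact htj hj0
  have hnc' : ¬ CycAdj m t' 0 := by
    rwa [← cycAdj_rotIndex_iff hm hj ht' (by omega), hj0]
  unfold CycAdj at hnc'
  simpa only [hj0] using (h.rotate hm hj).lt_zero_of_lt_zero D hi' (by simpa only [hj0] using hlt)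
    (t := t') (by omega) (by omega)

lemma IsChordlessCycle.cycAdj_of_lt_of_lt (h : IsChordlessCycle M m g) (hm : 3 ≤ m)
    {i j i' j' : ℕ} (hi : i < m) (hj : j < m) (hi' : i' < m) (hj' : j' < m) (hne : j ≠ j')
    (hlt : D.lt (g i) (g j)) (hlt' : D.lt (g i') (g j')) : CycAdj m j j' := by
  by_contra hc
  exact D.irrefl _ (D.trans (h.lt_of_lt D hm hi hj hj' hlt hne.symm fun h => hc h.symm)
    (h.lt_of_lt D hm hi' hj' hj hlt' hne hc))

lemma IsChordlessCycle.hasInducedCopy (h : IsChordlessCycle M m g) (hm : 3 ≤ m)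
    (hubs : Set (Fin m)) (hlt : ∀ p ∈ hubs, ∃ i < m, D.lt (g i) (g p.val))
    (honly : ∀ p q : Fin m, D.lt (g p.val) (g q.val) → q ∈ hubs) :
    HasInducedCopy (withHubs (SimpleGraph.cycleGraph m) hubs) M := by
  have hub : ∀ p ∈ hubs, ∀ t : Fin m, t ≠ p → ¬ CycAdj m t p → D.lt (g t.val) (g p.val) := by
    intro p hp t htp htc
    obtain ⟨i, hi, hip⟩ := hlt p hp
    exact h.lt_of_lt D hm hi p.2 t.2 hip (fun he => htp (Fin.ext he)) htc
  refine hasInducedCopy_withHubs (fun x => g x.val)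
    (fun x y hxy => Fin.ext (h.inj _ x.2 _ y.2 hxy)) (fun x y => ?_) fun x y hne hna => ?_
  · rw [h.antip_iff x.2 y.2, cycleGraph_adj_iff_cycAdj (by omega)]
  · rw [cycleGraph_adj_iff_cycAdj (by omega)] at hna
    rw [D.dom_iff]
    constructor
    · rintro (hx | hy)
      · exact Or.inr (hub x hx y hne.symm fun h => hna h.symm)
      · exact Or.inl (hub y hy x hne hna)
    · exact fun hcomp => (hcomp.imp (honly _ _) (honly _ _)).symm

lemma IsChordlessCycle.hasInducedCopy_doubleFan {n : ℕ} (hn : 2 ≤ n)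
    (h : IsChordlessCycle M (2 * n + 1) g) {a b : ℕ} (ha : a < 2 * n + 1) (hb : b < 2 * n + 1)
    (hla : D.lt (g a) (g 0)) (hlb : D.lt (g b) (g 1)) : HasInducedCopy (doubleFan n) M := by
  have hm : 3 ≤ 2 * n + 1 := by omega
  have hone : (1 : Fin (2 * n + 1)).val = 1 :=
    (Fin.val_one' _).trans (Nat.mod_eq_of_lt (by omega))
  refine h.hasInducedCopy D hm _ ?_ fun p q hpq => ?_
  · rintro p (rfl | rfl)
    · exact ⟨a, ha, hla⟩
    · exact ⟨b, hb, hone.symm ▸ hlb⟩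
  · by_contra hcon
    have hq0 : q.val ≠ 0 := fun he => hcon (Or.inl (Fin.ext he))
    have hq1 : q.val ≠ 1 := fun he => hcon (Or.inr (Fin.ext (he.trans hone.symm)))
    have hadj0 := h.cycAdj_of_lt_of_lt D hm ha (by omega) p.2 q.2 (Ne.symm hq0) hla hpq
    have hadj1 := h.cycAdj_of_lt_of_lt D hm hb (by omega) p.2 q.2 (Ne.symm hq1) hlb hpq
    unfold CycAdj at hadj0 hadj1
    omega

-- Vertices of the cycle that dominate another one are pairwise adjacent, so there are at most two;
-- rotate the cycle so that they are `0`, or `0` and `1`.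
lemma IsChordlessCycle.hasInducedCopy_fan_or_doubleFan {n : ℕ} (hn : 2 ≤ n)
    (h : IsChordlessCycle M (2 * n + 1) g) {i j : ℕ} (hi : i < 2 * n + 1) (hj : j < 2 * n + 1)
    (hlt : D.lt (g i) (g j)) :
    HasInducedCopy (fan n) M ∨ HasInducedCopy (doubleFan n) M := by
  have hm : 3 ≤ 2 * n + 1 := by omega
  by_contra! hcon
  obtain ⟨hfan, hdouble⟩ := hcon
  have h' := h.rotate hm hj
  obtain ⟨i', hi', rfl⟩ := exists_rotIndex_eq hj hi
  obtain ⟨g', hg'⟩ : ∃ g' : ℕ → Γ, g' = fun t => g (rotIndex (2 * n + 1) j t) := ⟨_, rfl⟩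
  rw [← hg'] at h'
  have hl0 : D.lt (g' i') (g' 0) := by simpa only [hg', rotIndex_zero hj] using hlt
  refine hfan (h'.hasInducedCopy D hm _ (by rintro p rfl; exact ⟨i', hi', hl0⟩) fun p q hpq => ?_)
  by_contra hq
  have hq0 : (0 : ℕ) ≠ q.val := fun he => hq (Fin.ext he.symm)
  have hadj := h'.cycAdj_of_lt_of_lt D hm hi' (by omega) p.2 q.2 hq0 hl0 hpq
  by_cases hq1 : q.val = 1
  · exact hdouble (h'.hasInducedCopy_doubleFan D hn hi' p.2 hl0 (by rwa [hq1] at hpq))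
  · obtain ⟨p', hp', hpp⟩ := exists_rotIndex_eq q.2 p.2
    obtain ⟨a, ha, hai⟩ := exists_rotIndex_eq q.2 hi'
    have hnext : rotIndex (2 * n + 1) q 1 = 0 := by
      unfold CycAdj at hadj; unfold rotIndex; split_ifs <;> omega
    exact hdouble ((h'.rotate hm q.2).hasInducedCopy_doubleFan D hn hp' ha
      (by simpa only [rotIndex_zero q.2, hpp] using hpq) (by simpa only [hai, hnext] using hl0))

end ChordlessCycle

/-! ### Wheels and fans -/

/-- A wheel with hub `h` and rim `g 0, …, g (m - 1)` whose rim edges are antipodal and whose spokes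
are dominance edges with at most one exception, which is antipodal. -/
structure IsWheel {Γ : Type u} (M : TwoColoredGraph Γ) (h : Γ) (m : ℕ) (g : ℕ → Γ) : Prop
    extends IsCycleIn M.antip m g where
  spoke : ∀ i < m, M.dom.Adj h (g i) ∨ M.antip.Adj h (g i)
  antip_unique : ∀ i < m, ∀ j < m, M.antip.Adj h (g i) → M.antip.Adj h (g j) → i = j

/-- A fan with center `c 0` and path `c 1, …, c (m - 1)`: the edges of the cycle
`c 0, …, c (m - 1)` are antipodal, the other edges at the center are dominance edges. -/
structure IsFan {Γ : Type u} (M : TwoColoredGraph Γ) (m : ℕ) (c : ℕ → Γ) : Prop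
    extends IsCycleIn M.antip m c where
  spoke : ∀ i, 2 ≤ i → i + 2 ≤ m → M.dom.Adj (c 0) (c i)

section WheelsAndFans

variable {Γ : Type u} {M : TwoColoredGraph Γ} {h : Γ} {m n k : ℕ} {g c : ℕ → Γ}

lemma IsCycleIn.isWheel (hg : IsCycleIn M.antip m g)
    (hspoke : ∀ i, 0 < i → i < m → M.dom.Adj h (g i))
    (hzero : M.dom.Adj h (g 0) ∨ M.antip.Adj h (g 0)) : IsWheel M h m g where
  toIsCycleIn := hg
  spoke i hi := by
    rcases i.eq_zero_or_pos with rfl | hpos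
    · exact hzero
    · exact Or.inl (hspoke i hpos hi)
  antip_unique i hi j hj hai haj := by
    have eq_zero : ∀ t < m, M.antip.Adj h (g t) → t = 0 := fun t ht hat =>
      t.eq_zero_or_pos.resolve_right fun hpos => M.disj _ _ hat (hspoke t hpos ht)
    rw [eq_zero i hi hai, eq_zero j hj haj]

lemma isWheel_three {a b d : Γ} (hab : M.antip.Adj a b) (hbd : M.antip.Adj b d)
    (hda : M.antip.Adj d a) (ha : M.dom.Adj h a ∨ M.antip.Adj h a) (hb : M.dom.Adj h b)
    (hd : M.dom.Adj h d) :
    IsWheel M h 3 (fun t => if t = 0 then a else if t = 1 then b else d) := by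
  refine IsCycleIn.isWheel ⟨fun i hi j hj hij => ?_, fun i hi => ?_, fun i hi => ?_⟩
    (fun i hpos hi => ?_) ha
  · have := hab.ne
    have := hbd.ne
    have := hda.ne
    interval_cases i <;> interval_cases j <;> simp_all
  · obtain rfl | rfl : i = 0 ∨ i = 1 := by omega
    exacts [hab, hbd]
  · obtain rfl : i = 2 := by omega
    exact hda
  · obtain rfl | rfl : i = 1 ∨ i = 2 := by omega
    exacts [hb, hd]

lemma IsWheel.rotate (w : IsWheel M h m g) (hm : 3 ≤ m) {s : ℕ} (hs : s < m) :
    IsWheel M h m (fun t => g (rotIndex m s t)) where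
  toIsCycleIn := w.toIsCycleIn.rotate hm hs
  spoke _ hi := w.spoke _ (rotIndex_lt hs hi)
  antip_unique _ hi _ hj hai haj :=
    rotIndex_inj hi hj (w.antip_unique _ (rotIndex_lt hs hi) _ (rotIndex_lt hs hj) hai haj)

lemma IsWheel.inner (w : IsWheel M h m g) {i j : ℕ} (hij : i < j) (hj : j < m)
    (hc : M.antip.Adj (g i) (g j)) : IsWheel M h (j - i + 1) (fun t => g (i + t)) where
  toIsCycleIn := w.toIsCycleIn.inner hij hj hc
  spoke a ha := w.spoke _ (by omega)
  antip_unique a ha b hb haa hab := by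
    have := w.antip_unique _ (by omega) _ (by omega) haa hab
    omega

lemma IsWheel.outer (w : IsWheel M h m g) {i j : ℕ} (hij : i < j) (hj : j < m)
    (hc : M.antip.Adj (g i) (g j)) :
    IsWheel M h (m - (j - i - 1)) (fun t => g (if t ≤ i then t else t + (j - i - 1))) where
  toIsCycleIn := w.toIsCycleIn.outer hij hj hc
  spoke a ha := w.spoke _ (by split_ifs <;> omega)
  antip_unique a ha b hb haa hab := by
    have := w.antip_unique _ (by split_ifs <;> omega) _ (by split_ifs <;> omega) haa hab
    split_ifs at this <;> omega

lemma IsFan.not_antip (w : IsFan M m c) {i : ℕ} (hi : 2 ≤ i) (him : i + 2 ≤ m) :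
    ¬ M.antip.Adj (c 0) (c i) :=
  fun ha => M.disj _ _ ha (w.spoke i hi him)

lemma IsFan.inner (w : IsFan M m c) {i j : ℕ} (hi : 0 < i) (hij : i < j) (hj : j < m)
    (hne : ¬ (i = 1 ∧ j + 1 = m)) (hc : M.antip.Adj (c i) (c j)) :
    IsWheel M (c 0) (j - i + 1) (fun t => c (i + t)) where
  toIsCycleIn := w.toIsCycleIn.inner hij hj hc
  spoke a ha := by
    by_cases hend : i + a = 1 ∨ i + a + 1 = m
    · refine Or.inr (w.adj_of_cycAdj (by omega) (by omega) ?_)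
      unfold CycAdj
      omega
    · exact Or.inl (w.spoke _ (by omega) (by omega))
  antip_unique a ha b hb haa hab := by
    have ends : ∀ t, i + t < m → M.antip.Adj (c 0) (c (i + t)) → i + t = 1 ∨ i + t + 1 = m := by
      intro t ht hat
      by_contra hcon
      exact w.not_antip (by omega) (by omega) hat
    have := ends a (by omega) haa
    have := ends b (by omega) hab
    omega

lemma IsFan.outer (w : IsFan M m c) {i j : ℕ} (hij : i < j) (hj : j < m)
    (hc : M.antip.Adj (c i) (c j)) :
    IsFan M (m - (j - i - 1)) (fun t => c (if t ≤ i then t else t + (j - i - 1))) where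
  toIsCycleIn := w.toIsCycleIn.outer hij hj hc
  spoke a ha ham := by
    rw [if_pos (Nat.zero_le i)]
    exact w.spoke _ (by split_ifs <;> omega) (by split_ifs <;> omega)

end WheelsAndFans

section MemFamily

variable {k n : ℕ}

lemma wheelZero_mem_familyZero (hk : 1 ≤ k) :
    (⟨_, wheelZero k⟩ : Σ U : Type, TwoColoredGraph U) ∈ familyZero :=
  Or.inl ⟨k, hk, Or.inl rfl⟩

lemma wheelOne_mem_familyZero (hk : 1 ≤ k) :
    (⟨_, wheelOne k⟩ : Σ U : Type, TwoColoredGraph U) ∈ familyZero :=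
  Or.inl ⟨k, hk, Or.inr rfl⟩

lemma fan_mem_familyZero (hn : 2 ≤ n) :
    (⟨_, fan n⟩ : Σ U : Type, TwoColoredGraph U) ∈ familyZero :=
  Or.inr ⟨n, hn, rfl⟩

lemma familyZero_subset_family : familyZero ⊆ family :=
  Set.subset_union_left

lemma doubleFan_mem_family (hn : 2 ≤ n) :
    (⟨_, doubleFan n⟩ : Σ U : Type, TwoColoredGraph U) ∈ family :=
  Or.inr ⟨n, hn, Or.inr rfl⟩

lemma chordedFan_mem_family (hn : 2 ≤ n) :
    (⟨_, chordedFan n⟩ : Σ U : Type, TwoColoredGraph U) ∈ family :=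
  Or.inr ⟨n, hn, Or.inl rfl⟩

end MemFamily

/-! ### Excluding wheels and fans by induced subgraphs -/

section Excluding

variable {Γ : Type u} {M : TwoColoredGraph Γ} {h : Γ} {m n k : ℕ} {g c : ℕ → Γ}

lemma rim_adj_some (hm : 2 ≤ m) {x y : Fin m} : (rim m).Adj (some x) (some y) ↔ CycAdj m x y :=
  SimpleGraph.map_adj_apply.trans (cycleGraph_adj_iff_cycAdj hm x y)

lemma not_rim_adj_none {x : Option (Fin m)} : ¬ (rim m).Adj none x := by
  rintro ⟨-, a, b, -, ha, -⟩
  exact absurd ha (Option.some_ne_none a)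

lemma IsChordlessCycle.hasInducedCopy_wheel (hg : IsChordlessCycle M m g) (w : IsWheel M h m g)
    (hdom : ∀ i < m, ∀ j < m, ¬ M.dom.Adj (g i) (g j)) {H : SimpleGraph (Option (Fin m))}
    (hrim : ∀ x y : Fin m, H.Adj (some x) (some y) ↔ CycAdj m x y)
    (hhub : ∀ x : Fin m, H.Adj none (some x) ↔ M.antip.Adj h (g x)) :
    HasInducedCopy (withHubs H {none}) M := by
  have hne : ∀ x : Fin m, h ≠ g x := fun x =>
    (w.spoke x x.2).elim SimpleGraph.Adj.ne SimpleGraph.Adj.ne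
  refine hasInducedCopy_withHubs (fun o => o.elim h fun x => g x.val) ?_ ?_ ?_
  · rintro (_ | x) (_ | y) hxy
    · rfl
    · exact absurd hxy (hne y)
    · exact absurd hxy.symm (hne x)
    · exact congrArg some (Fin.ext (hg.inj _ x.2 _ y.2 hxy))
  · rintro (_ | x) (_ | y)
    · exact iff_of_false H.irrefl M.antip.irrefl
    · exact hhub y
    · rw [H.adj_comm, M.antip.adj_comm]
      exact hhub x
    · exact (hrim x y).trans (hg.antip_iff x.2 y.2).symm
  · rintro (_ | x) (_ | y) hxy hna
    · exact absurd rfl hxy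
    · exact iff_of_true (Or.inl rfl) ((w.spoke y y.2).resolve_right fun ha => hna ((hhub y).2 ha))
    · exact iff_of_true (Or.inr rfl)
        ((w.spoke x x.2).resolve_right fun ha => hna ((hhub x).2 ha).symm).symm
    · exact iff_of_false (by simp) (hdom _ x.2 _ y.2)

lemma IsFan.isChordlessCycle_of_antip (w : IsFan M (2 * n + 1) c)
    (hends : M.antip.Adj (c 1) (c (2 * n)))
    (hch : ∀ i j, 0 < i → i < j → j < 2 * n + 1 → M.antip.Adj (c i) (c j) →
      j = i + 1 ∨ i = 1 ∧ j = 2 * n) :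
    IsChordlessCycle M (2 * n) fun t => c (t + 1) := by
  refine IsCycleIn.isChordlessCycle ⟨fun i hi j hj hij => ?_, fun i hi => ?_, fun i hi => ?_⟩
    fun i j hij hj hadj => ?_
  · have := w.inj _ (by omega) _ (by omega) hij
    omega
  · exact w.adj_succ _ (by omega)
  · rw [hi]
    exact hends.symm
  · have := hch _ _ (by omega) (by omega) (by omega) hadj
    unfold CycAdj
    omega

lemma IsFan.antip_iff_of_isChordlessCycle (w : IsFan M (2 * n + 1) c)
    (hpath : IsChordlessCycle M (2 * n) fun t => c (t + 1)) {i j : ℕ} (hi : i < 2 * n + 1)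
    (hj : j < 2 * n + 1) :
    M.antip.Adj (c i) (c j) ↔
      CycAdj (2 * n + 1) i j ∨ (i = 1 ∧ j = 2 * n) ∨ (i = 2 * n ∧ j = 1) := by
  have hcenter : ∀ t < 2 * n + 1, M.antip.Adj (c 0) (c t) ↔ CycAdj (2 * n + 1) 0 t := by
    refine fun t ht => ⟨fun ha => ?_, w.adj_of_cycAdj (by omega) ht⟩
    by_contra hnc
    unfold CycAdj at hnc
    have ht0 : t ≠ 0 := by rintro rfl; exact M.antip.irrefl ha
    exact w.not_antip (by omega) (by omega) ha
  rcases i.eq_zero_or_pos with rfl | hi0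
  · rw [hcenter j hj]
    unfold CycAdj
    omega
  rcases j.eq_zero_or_pos with rfl | hj0
  · rw [M.antip.adj_comm, hcenter i hi]
    unfold CycAdj
    omega
  have := hpath.antip_iff (i := i - 1) (j := j - 1) (by omega) (by omega)
  rw [Nat.sub_add_cancel hi0, Nat.sub_add_cancel hj0] at this
  rw [this]
  unfold CycAdj
  omega

lemma IsFan.hasInducedCopy_chordedFan (hn : 2 ≤ n) (w : IsFan M (2 * n + 1) c)
    (hpath : IsChordlessCycle M (2 * n) fun t => c (t + 1))
    (hdom : ∀ i < 2 * n, ∀ j < 2 * n, ¬ M.dom.Adj (c (i + 1)) (c (j + 1))) :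
    HasInducedCopy (chordedFan n) M := by
  have hadj : ∀ x y : Fin (2 * n + 1), (SimpleGraph.cycleGraph (2 * n + 1) ⊔
      SimpleGraph.edge 1 (Fin.last (2 * n))).Adj x y ↔ M.antip.Adj (c x) (c y) := by
    intro x y
    have hone : (1 : Fin (2 * n + 1)).val = 1 :=
      (Fin.val_one' _).trans (Nat.mod_eq_of_lt (by omega))
    rw [w.antip_iff_of_isChordlessCycle hpath x.2 y.2, SimpleGraph.sup_adj,
      cycleGraph_adj_iff_cycAdj (by omega), SimpleGraph.edge_adj]
    simp only [Fin.ext_iff, hone, Fin.val_last, ne_eq]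
    refine or_congr_right ?_
    omega
  refine hasInducedCopy_withHubs (fun x => c x)
    (fun x y hxy => Fin.ext (w.inj _ x.2 _ y.2 hxy)) hadj fun x y hne hna => ?_
  rw [hadj] at hna
  have hcenter : ∀ z : Fin (2 * n + 1), z ≠ 0 → ¬ M.antip.Adj (c 0) (c z) →
      M.dom.Adj (c 0) (c z) := by
    intro z hz hnz
    rw [w.antip_iff_of_isChordlessCycle hpath (by omega) z.2] at hnz
    have hz0 : z.val ≠ 0 := fun h => hz (Fin.ext h)
    unfold CycAdj at hnz
    exact w.spoke z (by omega) (by omega)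
  constructor
  · rintro (rfl | rfl)
    · exact hcenter y hne.symm hna
    · exact (hcenter x hne fun ha => hna ha.symm).symm
  · intro hd
    by_contra! hhub
    have hx0 : x.val ≠ 0 := fun h => hhub.1 (Fin.ext h)
    have hy0 : y.val ≠ 0 := fun h => hhub.2 (Fin.ext h)
    have := hdom (x - 1) (by omega) (y - 1) (by omega)
    rw [Nat.sub_add_cancel (by omega), Nat.sub_add_cancel (by omega)] at this
    exact this hd

-- The path of the fan is closed to a chordless cycle by the edge between its ends, which form an
-- antipodal triangle with the center; a suitable vertex of the path is the hub of a wheel over it.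
lemma IsFan.exists_isWheel_of_lt (D : DominanceOrder M) (hn : 2 ≤ n)
    (w : IsFan M (2 * n + 1) c) (hpath : IsChordlessCycle M (2 * n) fun t => c (t + 1)) {i j : ℕ}
    (hi : i < 2 * n) (hj : j < 2 * n) (hd : D.lt (c (i + 1)) (c (j + 1))) :
    ∃ h g, IsWheel M h 3 g := by
  have h01 : M.antip.Adj (c 0) (c 1) := w.adj_succ 0 (by omega)
  have h0l : M.antip.Adj (c (2 * n)) (c 0) := w.adj_last _ rfl
  have hl1 : M.antip.Adj (c (2 * n)) (c 1) := by
    have := hpath.adj_last (2 * n - 1) (by omega)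
    rwa [Nat.sub_add_cancel (by omega)] at this
  have hub_two (hd2 : M.dom.Adj (c 2) (c (2 * n))) : ∃ h g, IsWheel M h 3 g :=
    ⟨c 2, _, isWheel_three h01.symm h0l.symm hl1 (Or.inr (w.adj_succ 1 (by omega)).symm)
      (w.spoke 2 le_rfl (by omega)).symm hd2⟩
  have hub_penultimate (hd1 : M.dom.Adj (c (2 * n - 1)) (c 1)) : ∃ h g, IsWheel M h 3 g := by
    have hadj := w.adj_succ (2 * n - 1) (by omega)
    rw [Nat.sub_add_cancel (by omega)] at hadj
    exact ⟨c (2 * n - 1), _, isWheel_three h0l h01 hl1.symm (Or.inr hadj)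
      (w.spoke _ (by omega) (by omega)).symm hd1⟩
  have dominates : ∀ t, 0 < t → t ≤ 2 * n → t ≠ j + 1 → ¬ CycAdj (2 * n) (t - 1) j →
      M.dom.Adj (c (j + 1)) (c t) := by
    intro t ht htn htj hnc
    have := (D.dom_of_lt
      (hpath.lt_of_lt D (by omega) hi hj (t := t - 1) (by omega) hd (by omega) hnc)).symm
    rwa [Nat.sub_add_cancel ht] at this
  unfold CycAdj at dominates
  rcases (by omega : j = 0 ∨ j = 1 ∨ j + 2 = 2 * n ∨ j + 1 = 2 * n ∨ 2 ≤ j ∧ j + 2 < 2 * n) with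
    rfl | rfl | hjn | hjn | hmid
  · exact hub_penultimate (dominates (2 * n - 1) (by omega) (by omega) (by omega) (by omega)).symm
  · exact hub_two (dominates (2 * n) (by omega) le_rfl (by omega) (by omega))
  · obtain rfl : j = 2 * n - 1 - 1 := by omega
    have := dominates 1 (by omega) (by omega) (by omega) (by omega)
    rw [Nat.sub_add_cancel (by omega)] at this
    exact hub_penultimate this
  · have := dominates 2 (by omega) (by omega) (by omega) (by omega)
    rw [hjn] at this
    exact hub_two this.symm
  · exact ⟨c (j + 1), _, isWheel_three h01.symm h0l.symm hl1
      (Or.inl (dominates 1 (by omega) (by omega) (by omega) (by omega)))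
      (w.spoke _ (by omega) (by omega)).symm
      (dominates (2 * n) (by omega) le_rfl (by omega) (by omega))⟩

variable (D : DominanceOrder M) (hfam : ∀ S ∈ family, ¬ HasInducedCopy S.2 M)
include D hfam

lemma IsChordlessCycle.not_dom (hg : IsChordlessCycle M (2 * k + 1) g) (hk : 1 ≤ k) :
    ∀ i < 2 * k + 1, ∀ j < 2 * k + 1, ¬ M.dom.Adj (g i) (g j) := by
  have not_lt : ∀ i < 2 * k + 1, ∀ j < 2 * k + 1, ¬ D.lt (g i) (g j) := by
    intro i hi j hj hlt
    by_cases hk2 : 2 ≤ k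
    · rcases hg.hasInducedCopy_fan_or_doubleFan D hk2 hi hj hlt with hcopy | hcopy
      · exact hfam _ (familyZero_subset_family (fan_mem_familyZero hk2)) hcopy
      · exact hfam _ (doubleFan_mem_family hk2) hcopy
    · have hne : i ≠ j := by rintro rfl; exact D.irrefl _ hlt
      refine D.not_antip_of_lt hlt (hg.adj_of_cycAdj hi hj ?_)
      unfold CycAdj
      omega
  intro i hi j hj hd
  exact ((D.dom_iff _ _).1 hd).elim (not_lt i hi j hj) (not_lt j hj i hi)

lemma IsChordlessCycle.not_isWheel (hg : IsChordlessCycle M (2 * k + 1) g) (hk : 1 ≤ k)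
    (w : IsWheel M h (2 * k + 1) g) : False := by
  have hm : 3 ≤ 2 * k + 1 := by omega
  by_cases hanti : ∃ s < 2 * k + 1, M.antip.Adj h (g s)
  · obtain ⟨s, hs, has⟩ := hanti
    have hg' := hg.rotate hm hs
    have w' := w.rotate hm hs
    refine hfam _ (familyZero_subset_family (wheelOne_mem_familyZero hk))
      (hg'.hasInducedCopy_wheel w' (hg'.not_dom D hfam hk) (fun x y => ?_) fun x => ?_)
    · simp [SimpleGraph.edge_adj, rim_adj_some (show 2 ≤ 2 * k + 1 by omega)]
    · have hiff : M.antip.Adj h (g (rotIndex (2 * k + 1) s x)) ↔ x = 0 := by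
        refine ⟨fun ha => Fin.ext (w'.antip_unique _ x.2 0 (by omega) ha ?_), ?_⟩
        · rwa [rotIndex_zero hs]
        · rintro rfl
          rwa [Fin.val_zero, rotIndex_zero hs]
      simp [SimpleGraph.edge_adj, not_rim_adj_none, hiff]
  · refine hfam _ (familyZero_subset_family (wheelZero_mem_familyZero hk))
      (hg.hasInducedCopy_wheel w (hg.not_dom D hfam hk)
        (fun x y => rim_adj_some (by omega)) fun x => ?_)
    exact iff_of_false not_rim_adj_none fun ha => hanti ⟨x, x.2, ha⟩

lemma not_isWheel : ∀ k, 1 ≤ k → ∀ h g, ¬ IsWheel M h (2 * k + 1) g := by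
  intro k
  induction k using Nat.strong_induction_on with
  | _ k ih =>
  intro hk h g w
  refine (w.isChordlessCycle fun i j hij hj hc => ?_).not_isWheel D hfam hk w
  by_contra hnc
  unfold CycAdj at hnc
  rcases Nat.even_or_odd' (j - i) with ⟨l, hl | hl⟩
  · exact ih l (by omega) (by omega) _ _ (hl ▸ w.inner hij hj hc)
  · have hlen : 2 * k + 1 - (j - i - 1) = 2 * (k - l) + 1 := by omega
    exact ih (k - l) (by omega) (by omega) _ _ (hlen ▸ w.outer hij hj hc)

lemma not_isFan_of_antip (hn : 2 ≤ n) (w : IsFan M (2 * n + 1) c)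
    (hpath : IsChordlessCycle M (2 * n) fun t => c (t + 1)) : False := by
  refine hfam _ (chordedFan_mem_family hn) (w.hasInducedCopy_chordedFan hn hpath ?_)
  have not_lt : ∀ i < 2 * n, ∀ j < 2 * n, ¬ D.lt (c (i + 1)) (c (j + 1)) := by
    intro i hi j hj hlt
    obtain ⟨h, g, hw⟩ := w.exists_isWheel_of_lt D hn hpath hi hj hlt
    exact not_isWheel D hfam 1 le_rfl h g hw
  intro i hi j hj hd
  exact ((D.dom_iff _ _).1 hd).elim (not_lt i hi j hj) (not_lt j hj i hi)

lemma not_isFan : ∀ n, 2 ≤ n → ∀ c, ¬ IsFan M (2 * n + 1) c := by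
  intro n
  induction n using Nat.strong_induction_on with
  | _ n ih =>
  intro hn c w
  have hch : ∀ i j, 0 < i → i < j → j < 2 * n + 1 → M.antip.Adj (c i) (c j) →
      j = i + 1 ∨ i = 1 ∧ j = 2 * n := by
    intro i j hi hij hj hc
    by_contra hcon
    rcases Nat.even_or_odd' (j - i) with ⟨l, hl | hl⟩
    · exact not_isWheel D hfam l (by omega) _ _ (hl ▸ w.inner hi hij hj (by omega) hc)
    · have hlen : 2 * n + 1 - (j - i - 1) = 2 * (n - l) + 1 := by omega
      exact ih (n - l) (by omega) (by omega) _ (hlen ▸ w.outer hij hj hc)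
  by_cases hends : M.antip.Adj (c 1) (c (2 * n))
  · exact not_isFan_of_antip D hfam hn w (w.isChordlessCycle_of_antip hends hch)
  · have hcyc : IsChordlessCycle M (2 * n + 1) c := by
      refine w.isChordlessCycle fun i j hij hj hc => ?_
      unfold CycAdj
      rcases i.eq_zero_or_pos with rfl | hi
      · by_contra hnc
        exact w.not_antip (by omega) (by omega) hc
      · rcases hch i j hi hij hj hc with rfl | ⟨rfl, rfl⟩
        · exact Or.inl rfl
        · exact absurd hc hends
    exact hcyc.not_dom D hfam (by omega) 0 (by omega) 2 (by omega) (w.spoke 2 le_rfl (by omega))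

end Excluding

/-! ### Odd cycles -/

/-- `g 0, …, g m` is a closed walk of `H`. -/
structure IsClosedWalkIn {X : Type u} (H : SimpleGraph X) (m : ℕ) (g : ℕ → X) : Prop where
  adj : ∀ i < m, H.Adj (g i) (g (i + 1))
  closed : g m = g 0

section OddCycle

variable {X : Type u} {H : SimpleGraph X} {m : ℕ} {g : ℕ → X}

lemma IsClosedWalkIn.segment (h : IsClosedWalkIn H m g) {i j : ℕ} (hij : i ≤ j) (hj : j ≤ m)
    (he : g i = g j) : IsClosedWalkIn H (j - i) (fun t => g (i + t)) where
  adj t ht := h.adj (i + t) (by omega)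
  closed := by rw [Nat.add_sub_cancel' hij, Nat.add_zero, he]

lemma IsClosedWalkIn.excise (h : IsClosedWalkIn H m g) {i j : ℕ} (hij : i < j) (hj : j < m)
    (he : g i = g j) :
    IsClosedWalkIn H (m - (j - i)) (fun t => g (if t ≤ i then t else t + (j - i))) where
  adj t ht := by
    rcases lt_trichotomy t i with hti | rfl | hit
    · rw [if_pos hti.le, if_pos (by omega)]
      exact h.adj t (by omega)
    · rw [if_pos le_rfl, if_neg (by omega), he, show t + 1 + (j - t) = j + 1 by omega]
      exact h.adj j hj
    · rw [if_neg (by omega), if_neg (by omega), Nat.add_right_comm]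
      exact h.adj _ (by omega)
  closed := by
    rw [if_neg (by omega), if_pos (Nat.zero_le i), Nat.sub_add_cancel (by omega), h.closed]

lemma IsClosedWalkIn.isCycleIn (h : IsClosedWalkIn H m g)
    (hinj : ∀ i j, i < j → j < m → g i ≠ g j) : IsCycleIn H m g where
  inj i hi j hj he := by
    rcases lt_trichotomy i j with hij | hij | hij
    · exact absurd he (hinj i j hij hj)
    · exact hij
    · exact absurd he.symm (hinj j i hij hi)
  adj_succ i hi := h.adj i (by omega)
  adj_last i hi := by
    have := h.adj i (by omega)
    rwa [hi, h.closed] at this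

-- A shortest odd closed walk is a cycle: if it visits a vertex twice, it splits into two shorter
-- closed walks, one of which is odd.
lemma exists_odd_isCycleIn (hH : ¬ H.Colorable 2) :
    ∃ k, 1 ≤ k ∧ ∃ g : ℕ → X, IsCycleIn H (2 * k + 1) g := by
  classical
  have hex : ∃ m, Odd m ∧ ∃ g, IsClosedWalkIn H m g := by
    rw [SimpleGraph.two_colorable_iff_forall_loop_even] at hH
    push Not at hH
    obtain ⟨x, p, hp⟩ := hH
    exact ⟨p.length, Nat.not_even_iff_odd.1 hp, p.getVert, fun i hi => p.adj_getVert_succ hi,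
      by simp⟩
  obtain ⟨hodd, g, hg⟩ := Nat.find_spec hex
  have hmin := fun {m} => Nat.find_min hex (m := m)
  set m := Nat.find hex
  have hcycle : IsCycleIn H m g := by
    refine hg.isCycleIn fun i j hij hj he => ?_
    rcases Nat.even_or_odd (j - i) with heven | hodd'
    · exact hmin (m := m - (j - i)) (by omega)
        ⟨Nat.Odd.sub_even (by omega) hodd heven, _, hg.excise hij hj he⟩
    · exact hmin (m := j - i) (by omega) ⟨hodd', _, hg.segment hij.le hj.le he⟩
  obtain ⟨k, hk⟩ := hodd
  rw [hk] at hcycle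
  refine ⟨k, Nat.one_le_iff_ne_zero.2 ?_, g, hcycle⟩
  rintro rfl
  exact H.irrefl (hcycle.adj_last 0 rfl)

end OddCycle

/-! ### Bipartitions below a vertex -/

namespace DominanceOrder

variable {Γ : Type u} {M : TwoColoredGraph Γ} (D : DominanceOrder M) {u : Γ}

/-- `t` splits the elements below `u` into two classes without antipodal edges, so that the
elements antipodal to something antipodal to `u` all satisfy `t`. -/
structure IsBipartition (u : Γ) (t : Γ → Prop) : Prop where
  iff_not : ∀ {a b}, D.lt a u → D.lt b u → M.antip.Adj a b → (t a ↔ ¬ t b)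
  of_antip : ∀ {a d}, D.lt a u → M.antip.Adj d u → M.antip.Adj a d → t a

/-- The graph whose 2-colorings are the bipartitions below `u`: the elements that are to lie in a
common class are joined to an additional vertex `none`. -/
def constraintGraph (u : Γ) : SimpleGraph (Option Γ) where
  Adj
    | none, none => False
    | none, some a => D.lt a u ∧ ∃ d, M.antip.Adj d u ∧ M.antip.Adj a d
    | some a, none => D.lt a u ∧ ∃ d, M.antip.Adj d u ∧ M.antip.Adj a d
    | some a, some b => D.lt a u ∧ D.lt b u ∧ M.antip.Adj a b
  symm := ⟨by
    rintro (_ | a) (_ | b) h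
    · exact h
    · exact h
    · exact h
    · exact ⟨h.2.1, h.1, h.2.2.symm⟩⟩
  loopless := ⟨by
    rintro (_ | a) h
    · exact h
    · exact M.antip.irrefl h.2.2⟩

lemma exists_isBipartition_of_colorable (hcol : (D.constraintGraph u).Colorable 2) :
    ∃ t, D.IsBipartition u t := by
  obtain ⟨f⟩ := hcol
  refine ⟨fun a => f (some a) ≠ f none, fun {a b} ha hb hab => ?_, fun {a d} ha hd had => ?_⟩
  · have hne : f (some a) ≠ f (some b) :=
      f.valid (show (D.constraintGraph u).Adj (some a) (some b) from ⟨ha, hb, hab⟩)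
    omega
  · exact f.valid (show (D.constraintGraph u).Adj (some a) none from ⟨ha, d, hd, had⟩)

/-- `p 1, …, p l` is a path of antipodal edges below `u`. -/
structure IsPathBelow (u : Γ) (l : ℕ) (p : ℕ → Γ) : Prop where
  inj : ∀ i, 0 < i → i ≤ l → ∀ j, 0 < j → j ≤ l → p i = p j → i = j
  lt : ∀ i, 0 < i → i ≤ l → D.lt (p i) u
  antip : ∀ i, 0 < i → i < l → M.antip.Adj (p i) (p (i + 1))

variable {D} {k l m : ℕ} {p : ℕ → Γ} {g : ℕ → Option Γ} {d d' : Γ}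

lemma IsPathBelow.ne_of_antip (hp : D.IsPathBelow u l p) (hd : M.antip.Adj d u) {i : ℕ}
    (hi : 0 < i) (hil : i ≤ l) : d ≠ p i := by
  rintro rfl
  exact D.not_antip_of_lt (hp.lt i hi hil) hd

lemma IsPathBelow.isWheel (hp : D.IsPathBelow u l p) (hl : 0 < l) (hdu : M.antip.Adj d u)
    (hd₁ : M.antip.Adj d (p 1)) (hdl : M.antip.Adj (p l) d) :
    IsWheel M u (l + 1) (fun i => if i = 0 then d else p i) := by
  refine IsCycleIn.isWheel ⟨fun i hi j hj hij => ?_, fun i hi => ?_, fun i hi => ?_⟩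
    (fun i hpos hi => ?_) (Or.inr hdu.symm)
  · split_ifs at hij with hi0 hj0 hj0
    · omega
    · exact absurd hij (hp.ne_of_antip hdu (by omega) (by omega))
    · exact absurd hij.symm (hp.ne_of_antip hdu (by omega) (by omega))
    · exact hp.inj i (by omega) (by omega) j (by omega) (by omega) hij
  · rcases i.eq_zero_or_pos with rfl | hpos
    · exact hd₁
    · rw [if_neg hpos.ne', if_neg i.succ_ne_zero]
      exact hp.antip i hpos (by omega)
  · obtain rfl : i = l := by omega
    rw [if_neg hl.ne', if_pos rfl]
    exact hdl
  · rw [if_neg hpos.ne']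
    exact (D.dom_of_lt (hp.lt i hpos (by omega))).symm

lemma IsPathBelow.isFan (hp : D.IsPathBelow u l p) (hl : 0 < l) (hdu : M.antip.Adj d u)
    (hd₁ : M.antip.Adj d (p 1)) (hdu' : M.antip.Adj d' u) (hdl : M.antip.Adj (p l) d')
    (hne : d ≠ d') :
    IsFan M (l + 3)
      (fun i => if i = 0 then u else if i = 1 then d else if i = l + 2 then d' else p (i - 1)) where
  inj i hi j hj hij := by
    have hpu : ∀ i, 0 < i → i ≤ l → u ≠ p i := by
      rintro i hpos hi he
      exact D.irrefl u (by simpa only [← he] using hp.lt i hpos hi)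
    have hpd := fun i => hp.ne_of_antip hdu (i := i)
    have hpd' := fun i => hp.ne_of_antip hdu' (i := i)
    have hinj := hp.inj (i - 1)
    have := hdu.ne
    have := hdu'.ne
    grind
  adj_succ i hi := by
    rcases (by omega : i = 0 ∨ i = 1 ∨ i = l + 1 ∨ 2 ≤ i ∧ i ≤ l) with rfl | rfl | rfl | ⟨h2, hil⟩
    · exact hdu.symm
    · simpa [hl.ne'] using hd₁
    · simpa [hl.ne'] using hdl
    · have := hp.antip (i - 1) (by omega) (by omega)
      rw [Nat.sub_add_cancel (by omega)] at this
      rwa [if_neg (by omega), if_neg (by omega), if_neg (by omega), if_neg (by omega),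
        if_neg (by omega), if_neg (by omega)]
  adj_last i hi := by
    obtain rfl : i = l + 2 := by omega
    simpa using hdu'
  spoke i hi hil := by
    rw [if_pos rfl, if_neg (by omega), if_neg (by omega), if_neg (by omega)]
    exact (D.dom_of_lt (hp.lt (i - 1) (by omega) (by omega))).symm

lemma isWheel_of_constraintGraph (hm : 2 ≤ m)
    (hg : IsCycleIn (D.constraintGraph u) m fun i => some (p i)) : IsWheel M u m p := by
  have lt : ∀ i < m, D.lt (p i) u := by
    intro i hi
    by_cases hi' : i + 1 < m
    · exact (hg.adj_succ i hi').1
    · exact (hg.adj_last i (by omega)).1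
  exact IsCycleIn.isWheel ⟨fun i hi j hj hij => hg.inj i hi j hj (congrArg some hij),
    fun i hi => (hg.adj_succ i hi).2.2, fun i hi => (hg.adj_last i hi).2.2⟩
    (fun i _ hi => (D.dom_of_lt (lt i hi)).symm) (Or.inl (D.dom_of_lt (lt 0 (by omega))).symm)

lemma isPathBelow_of_constraintGraph (hl : 0 < l)
    (hg : IsCycleIn (D.constraintGraph u) (l + 1) fun i => if i = 0 then none else some (p i)) :
    D.IsPathBelow u l p := by
  have adj : ∀ i, 0 < i → i < l → D.lt (p i) u ∧ D.lt (p (i + 1)) u ∧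
      M.antip.Adj (p i) (p (i + 1)) := by
    intro i hi hil
    have := hg.adj_succ i (by omega)
    simp only [if_neg hi.ne', if_neg i.succ_ne_zero] at this
    exact this
  refine ⟨fun i hi hil j hj hjl hij => hg.inj i (by omega) j (by omega) ?_, fun i hi hil => ?_,
    fun i hi hil => (adj i hi hil).2.2⟩
  · simp only [if_neg hi.ne', if_neg hj.ne', hij]
  · obtain hil | rfl := hil.lt_or_eq
    · exact (adj i hi hil).1
    · have := hg.adj_last i rfl
      simp only [if_neg hi.ne', if_true] at this
      exact this.1

lemma exists_isWheel_or_isFan_of_constraintGraph (hl : 0 < l)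
    (hg : IsCycleIn (D.constraintGraph u) (l + 1) g) (h0 : g 0 = none) :
    (∃ q, IsWheel M u (l + 1) q) ∨ ∃ c, IsFan M (l + 3) c := by
  obtain ⟨p, hpg⟩ : ∃ p : ℕ → Γ, ∀ i < l + 1, g i = if i = 0 then none else some (p i) := by
    have : Nonempty Γ := ⟨u⟩
    choose! p hp using fun i (hi : i < l + 1 ∧ i ≠ 0) => Option.ne_none_iff_exists'.1
      fun hgi => hi.2 (hg.inj i hi.1 0 (by omega) (hgi.trans h0.symm))
    refine ⟨p, fun i hi => ?_⟩
    split_ifs with hi0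
    · rw [hi0, h0]
    · exact hp i ⟨hi, hi0⟩
  have hcycle := hg.congr hpg
  have hp := isPathBelow_of_constraintGraph hl hcycle
  obtain ⟨-, d, hdu, hd⟩ := hcycle.adj_succ 0 (by omega)
  obtain ⟨-, d', hdu', hd'⟩ : D.lt (p l) u ∧ ∃ d, M.antip.Adj d u ∧ M.antip.Adj (p l) d := by
    have := hcycle.adj_last l rfl
    simp only [if_neg hl.ne', if_true] at this
    exact this
  by_cases hdd : d = d'
  · subst hdd
    exact Or.inl ⟨_, hp.isWheel hl hdu hd.symm hd'⟩
  · exact Or.inr ⟨_, hp.isFan hl hdu hd.symm hdu' hd' hdd⟩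

variable (D) in
lemma exists_isBipartition (hw : ∀ k, 1 ≤ k → ∀ q, ¬ IsWheel M u (2 * k + 1) q)
    (hf : ∀ n, 2 ≤ n → ∀ c, ¬ IsFan M (2 * n + 1) c) : ∃ t, D.IsBipartition u t := by
  by_contra hno
  obtain ⟨k, hk, g, hg⟩ := exists_odd_isCycleIn (mt D.exists_isBipartition_of_colorable hno)
  by_cases hnone : ∃ s < 2 * k + 1, g s = none
  · obtain ⟨s, hs, hgs⟩ := hnone
    rcases exists_isWheel_or_isFan_of_constraintGraph (by omega) (hg.rotate (by omega) hs)
      (by rw [rotIndex_zero hs, hgs]) with ⟨q, hq⟩ | ⟨c, hc⟩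
    · exact hw k hk q hq
    · exact hf (k + 1) (by omega) c hc
  · push Not at hnone
    have : Nonempty Γ := ⟨u⟩
    choose! p hp using fun i hi => Option.ne_none_iff_exists'.1 (hnone i hi)
    exact hw k hk p (isWheel_of_constraintGraph (by omega) (hg.congr hp))

end DominanceOrder

/-! ### Good colorings -/

/-- An order on the vertices of a two-edge-colored graph together with the sets of vertices of the
separator seen from them. -/
structure AttachmentSystem {Γ : Type u} (M : TwoColoredGraph Γ) (V : Type v) extends
    DominanceOrder M where
  nbr : Γ → Set V
  mono : ∀ {i j}, lt i j → nbr i ⊆ nbr j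
  attached_iff : ∀ {i j}, i ≠ j → ((nbr i ∩ nbr j).Nonempty ↔ M.antip.Adj i j ∨ M.dom.Adj i j)

/-- Antipodal vertices get distinct colors, and every vertex of the separator sees at most two
colors. -/
structure IsGoodColoring {Γ : Type u} (M : TwoColoredGraph Γ) {V : Type v} (nbr : Γ → Set V)
    {C : Type*} (f : Γ → C) : Prop where
  ne_of_antip : ∀ {a b}, M.antip.Adj a b → f a ≠ f b
  two_colors : ∀ {x a b c}, x ∈ nbr a → x ∈ nbr b → x ∈ nbr c →
    f a = f b ∨ f b = f c ∨ f a = f c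

namespace AttachmentSystem

variable {Γ : Type u} {M : TwoColoredGraph Γ} {V : Type v} {A : AttachmentSystem M V}
variable {a b c i j u w w' : Γ} {x : V} {t : Γ → Γ → Prop}

/-- No vertex of the separator is seen from three pairwise antipodal vertices. -/
def NoFullTriangle (A : AttachmentSystem M V) : Prop :=
  ∀ ⦃a b c⦄, M.antip.Adj a b → M.antip.Adj b c → M.antip.Adj a c →
    ∀ ⦃x⦄, x ∈ A.nbr a → x ∈ A.nbr b → x ∉ A.nbr c

/-- The maximal elements above `i`. -/
def tops (A : AttachmentSystem M V) (i : Γ) : Set Γ :=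
  {u | (i = u ∨ A.lt i u) ∧ ∀ d, ¬ A.lt u d}

lemma tops_nonempty [Finite Γ] (A : AttachmentSystem M V) (i : Γ) : (A.tops i).Nonempty := by
  have hwf : WellFounded (fun a b => A.lt b a) := by
    have : IsTrans Γ (fun a b => A.lt b a) := ⟨fun _ _ _ h h' => A.trans h' h⟩
    have : Std.Irrefl (fun a b => A.lt b a) := ⟨A.irrefl⟩
    exact Finite.wellFounded_of_trans_of_irrefl _
  induction i using hwf.induction with
  | _ a ih =>
    by_cases ha : ∀ d, ¬ A.lt a d
    · exact ⟨a, Or.inl rfl, ha⟩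
    · push Not at ha
      obtain ⟨d, hd⟩ := ha
      obtain ⟨u, rfl | hdu, hu⟩ := ih d hd
      · exact ⟨d, Or.inr hd, hu⟩
      · exact ⟨u, Or.inr (A.trans hd hdu), hu⟩

lemma mem_nbr_of_mem_tops (hu : u ∈ A.tops i) (hx : x ∈ A.nbr i) : x ∈ A.nbr u := by
  obtain ⟨rfl | hlt, -⟩ := hu
  · exact hx
  · exact A.mono hlt hx

lemma lt_of_mem_tops (hu : u ∈ A.tops i) (hw : w ∈ A.tops i) (hne : u ≠ w) : A.lt i u := by
  refine hu.1.resolve_left ?_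
  rintro rfl
  exact hu.2 w (hw.1.resolve_left hne)

lemma notMem_tops_of_antip (h : M.antip.Adj i j) : i ∉ A.tops j := by
  rintro ⟨rfl | hlt, -⟩
  · exact M.antip.irrefl h
  · exact A.not_antip_of_lt hlt h.symm

lemma antip_of_notMem_tops (hu : u ∈ A.tops j) (hui : u ∉ A.tops i) (hxi : x ∈ A.nbr i)
    (hxu : x ∈ A.nbr u) : M.antip.Adj i u := by
  have hne : i ≠ u := fun h => hui ⟨Or.inl h, hu.2⟩
  rcases (A.attached_iff hne).1 ⟨x, hxi, hxu⟩ with h | h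
  · exact h
  · rcases (A.dom_iff _ _).1 h with hlt | hlt
    · exact absurd ⟨Or.inr hlt, hu.2⟩ hui
    · exact absurd hlt (hu.2 _)

lemma antip_of_mem_tops (ha : a ∈ A.tops i) (hb : b ∈ A.tops j) (hne : a ≠ b)
    (hxa : x ∈ A.nbr a) (hxb : x ∈ A.nbr b) : M.antip.Adj a b := by
  refine antip_of_notMem_tops hb ?_ hxa hxb
  rintro ⟨h | h, -⟩
  · exact hne h
  · exact ha.2 _ h

lemma NoFullTriangle.eq_of_mem_tops (htri : A.NoFullTriangle) {i' j' k' : Γ}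
    (ha : a ∈ A.tops i') (hb : b ∈ A.tops j') (hc : c ∈ A.tops k')
    (hxa : x ∈ A.nbr a) (hxb : x ∈ A.nbr b) (hxc : x ∈ A.nbr c) : a = b ∨ b = c ∨ a = c := by
  by_contra hne
  push Not at hne
  exact htri (antip_of_mem_tops ha hb hne.1 hxa hxb) (antip_of_mem_tops hb hc hne.2.1 hxb hxc)
    (antip_of_mem_tops ha hc hne.2.2 hxa hxc) hxa hxb hxc

variable [Finite Γ]

/-- A maximal element above `i`, which depends only on the set `A.tops i`. -/
noncomputable def chosenTop (A : AttachmentSystem M V) (i : Γ) : Γ :=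
  (A.tops_nonempty i).some

lemma chosenTop_mem_tops : A.chosenTop i ∈ A.tops i :=
  (A.tops_nonempty i).some_mem

lemma chosenTop_eq_of_tops_eq (h : A.tops i = A.tops j) : A.chosenTop i = A.chosenTop j := by
  simp only [chosenTop, h]

open Classical in
/-- The coloring by maximal elements: each `i` is colored by the maximal element chosen for it if
it lies in the first class of the bipartition `t` below that element, and otherwise by some other
maximal element above `i`; if there is none, it gets the second color of the chosen element. -/
noncomputable def coloring (A : AttachmentSystem M V) (t : Γ → Γ → Prop) (i : Γ) : Γ × Bool :=
  if i = A.chosenTop i ∨ t (A.chosenTop i) i then (A.chosenTop i, false)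
  else if h : ∃ w ∈ A.tops i, w ≠ A.chosenTop i then (h.choose, false)
  else (A.chosenTop i, true)

lemma coloring_mem_tops (t : Γ → Γ → Prop) (i : Γ) : (A.coloring t i).1 ∈ A.tops i := by
  unfold coloring
  split_ifs with _ h
  · exact chosenTop_mem_tops
  · exact h.choose_spec.1
  · exact chosenTop_mem_tops

lemma coloring_eq_false_iff (hi : A.coloring t i = (w, false)) (hlt : A.lt i (A.chosenTop i)) :
    t (A.chosenTop i) i ↔ w = A.chosenTop i := by
  have hne : i ≠ A.chosenTop i := fun h => A.irrefl i (by rwa [← h] at hlt)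
  unfold coloring at hi
  split_ifs at hi with ht h
  · exact iff_of_true (ht.resolve_left hne) (congrArg Prod.fst hi).symm
  · have hw : h.choose = w := congrArg Prod.fst hi
    exact iff_of_false (fun h' => ht (Or.inr h')) (hw ▸ h.choose_spec.2)
  · exact absurd (congrArg Prod.snd hi) (by simp)

lemma of_coloring_eq_true (hi : A.coloring t i = (w, true)) :
    A.lt i w ∧ ¬ t w i ∧ ∀ u ∈ A.tops i, u = w := by
  unfold coloring at hi
  split_ifs at hi with ht h
  · exact absurd (congrArg Prod.snd hi) (by simp)
  · exact absurd (congrArg Prod.snd hi) (by simp)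
  · obtain rfl : A.chosenTop i = w := congrArg Prod.fst hi
    push Not at ht h
    exact ⟨chosenTop_mem_tops.1.resolve_left ht.1, ht.2, h⟩

-- Some maximal element `w'` is antipodal to `i`, so `i` has just one maximal element above it and
-- lies in the first class of its bipartition.
lemma coloring_eq_of_notMem_tops (htri : A.NoFullTriangle) (ht : ∀ u, A.IsBipartition u (t u))
    (hw : w ∈ A.tops i) (hw' : w' ∈ A.tops j) (hnot : w' ∉ A.tops i) (hxi : x ∈ A.nbr i)
    (hxw' : x ∈ A.nbr w') : A.coloring t i = (w, false) ∧ (i = w ∨ t w i) := by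
  have htop : A.chosenTop i = w := by
    rcases htri.eq_of_mem_tops chosenTop_mem_tops hw hw'
      (mem_nbr_of_mem_tops chosenTop_mem_tops hxi) (mem_nbr_of_mem_tops hw hxi) hxw' with h | h | h
    · exact h
    · exact absurd (h ▸ hw) hnot
    · exact absurd (h ▸ chosenTop_mem_tops) hnot
  have hclass : i = w ∨ t w i := hw.1.imp_right fun hlt =>
    (ht w).of_antip hlt (antip_of_mem_tops hw' hw (fun h => hnot (h ▸ hw)) hxw'
      (mem_nbr_of_mem_tops hw hxi)) (antip_of_notMem_tops hw' hnot hxi hxw')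
  refine ⟨?_, hclass⟩
  rw [coloring, htop, if_pos hclass]

lemma tops_subset_of_coloring_eq (htri : A.NoFullTriangle) (ht : ∀ u, A.IsBipartition u (t u))
    (hij : M.antip.Adj i j) (hi : A.coloring t i = (w, false)) (hj : A.coloring t j = (w, false)) :
    A.tops i ⊆ A.tops j := by
  intro w' hw'i
  by_contra hw'j
  have hwi : w ∈ A.tops i := by simpa only [hi] using A.coloring_mem_tops t i
  have hwj : w ∈ A.tops j := by simpa only [hj] using A.coloring_mem_tops t j
  obtain ⟨x, hxi, hxj⟩ := (A.attached_iff hij.ne).2 (Or.inl hij)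
  have hxw' : x ∈ A.nbr w' := mem_nbr_of_mem_tops hw'i hxi
  have hww' : w' ≠ w := fun h => hw'j (h ▸ hwj)
  have hiw : A.lt i w := lt_of_mem_tops hwi hw'i hww'.symm
  have hiw' : A.lt i w' := lt_of_mem_tops hw'i hwi hww'
  have hjw' : M.antip.Adj j w' := antip_of_notMem_tops hw'i hw'j hxj hxw'
  have hjw : A.lt j w := hwj.1.resolve_left fun h => A.not_antip_of_lt hiw (h ▸ hij)
  have htop : A.chosenTop i = w ∨ A.chosenTop i = w' := by
    have := htri.eq_of_mem_tops chosenTop_mem_tops hwi hw'i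
      (mem_nbr_of_mem_tops chosenTop_mem_tops hxi) (mem_nbr_of_mem_tops hwi hxi) hxw'
    tauto
  rcases htop with htop | htop
  · have htj : t w j := (coloring_eq_of_notMem_tops htri ht hwj hw'i hw'j hxj hxw').2.resolve_left
      fun h => A.irrefl j (by rwa [← h] at hjw)
    have hti : t w i := by simpa only [htop, iff_true] using coloring_eq_false_iff hi (htop ▸ hiw)
    exact ((ht w).iff_not hiw hjw hij).1 hti htj
  · have hti : t w' i := (ht w').of_antip hiw' hjw' hij
    have := coloring_eq_false_iff hi (htop ▸ hiw')
    rw [htop] at this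
    exact hww' (this.1 hti).symm

lemma coloring_ne_of_antip (htri : A.NoFullTriangle) (ht : ∀ u, A.IsBipartition u (t u))
    (hij : M.antip.Adj i j) : A.coloring t i ≠ A.coloring t j := by
  intro he
  obtain ⟨w, _ | _, hj⟩ : ∃ w e, A.coloring t j = (w, e) := ⟨_, _, rfl⟩
  · have hi := he.trans hj
    have htops : A.tops i = A.tops j := (tops_subset_of_coloring_eq htri ht hij hi hj).antisymm
      (tops_subset_of_coloring_eq htri ht hij.symm hj hi)
    have htop : A.chosenTop i = A.chosenTop j := chosenTop_eq_of_tops_eq htops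
    have hmem : A.chosenTop i ∈ A.tops i := chosenTop_mem_tops
    have hlti : A.lt i (A.chosenTop i) := hmem.1.resolve_left fun h =>
      notMem_tops_of_antip (A := A) hij (by rwa [htops, ← h] at hmem)
    have hltj : A.lt j (A.chosenTop j) := chosenTop_mem_tops.1.resolve_left fun h =>
      notMem_tops_of_antip (A := A) hij.symm (by rwa [htop, ← h] at hmem)
    have hne := (ht _).iff_not hlti (htop ▸ hltj) hij
    rw [coloring_eq_false_iff hi hlti, htop, coloring_eq_false_iff hj hltj] at hne
    tauto
  · obtain ⟨hlti, hti, -⟩ := of_coloring_eq_true (he.trans hj)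
    obtain ⟨hltj, htj, -⟩ := of_coloring_eq_true hj
    exact hti (((ht w).iff_not hlti hltj hij).2 htj)

lemma coloring_fst_eq_of_true (htri : A.NoFullTriangle) (ht : ∀ u, A.IsBipartition u (t u))
    (hi : A.coloring t i = (w, true)) (hxi : x ∈ A.nbr i) (hxj : x ∈ A.nbr j) :
    (A.coloring t j).1 = w := by
  by_contra hne
  have hnot : (A.coloring t j).1 ∉ A.tops i := fun h => hne ((of_coloring_eq_true hi).2.2 _ h)
  have := (coloring_eq_of_notMem_tops htri ht (coloring_mem_tops t i) (coloring_mem_tops t j) hnot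
    hxi (mem_nbr_of_mem_tops (coloring_mem_tops t j) hxj)).1
  rw [this] at hi
  exact absurd (congrArg Prod.snd hi) (by simp)

lemma isGoodColoring_coloring (htri : A.NoFullTriangle) (ht : ∀ u, A.IsBipartition u (t u)) :
    IsGoodColoring M A.nbr (A.coloring t) where
  ne_of_antip := coloring_ne_of_antip htri ht
  two_colors {x a b c} ha hb hc := by
    by_cases hall : ∃ i w, A.coloring t i = (w, true) ∧ x ∈ A.nbr i
    · obtain ⟨i, w, hi, hxi⟩ := hall
      simp only [Prod.ext_iff, coloring_fst_eq_of_true htri ht hi hxi ha,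
        coloring_fst_eq_of_true htri ht hi hxi hb, coloring_fst_eq_of_true htri ht hi hxi hc,
        true_and]
      generalize (A.coloring t a).2 = p, (A.coloring t b).2 = q, (A.coloring t c).2 = r
      revert p q r
      decide
    · have hfalse : ∀ i, x ∈ A.nbr i → (A.coloring t i).2 = false := fun i hxi =>
        Bool.eq_false_iff.2 fun h => hall ⟨i, _, Prod.ext rfl h, hxi⟩
      simp only [Prod.ext_iff, hfalse a ha, hfalse b hb, hfalse c hc, and_true]
      have hmem : ∀ i, x ∈ A.nbr i → x ∈ A.nbr (A.coloring t i).1 := fun i =>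
        mem_nbr_of_mem_tops (coloring_mem_tops t i)
      exact htri.eq_of_mem_tops (coloring_mem_tops t a) (coloring_mem_tops t b)
        (coloring_mem_tops t c) (hmem a ha) (hmem b hb) (hmem c hc)

lemma exists_isGoodColoring (A : AttachmentSystem M V) (htri : A.NoFullTriangle)
    (hw : ∀ k, 1 ≤ k → ∀ h g, ¬ IsWheel M h (2 * k + 1) g)
    (hf : ∀ n, 2 ≤ n → ∀ c, ¬ IsFan M (2 * n + 1) c) :
    ∃ f : Γ → Γ × Bool, IsGoodColoring M A.nbr f := by
  choose t ht using fun u => A.exists_isBipartition (u := u) (fun k hk => hw k hk u) hf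
  exact ⟨_, isGoodColoring_coloring htri ht⟩

end AttachmentSystem

/-! ### Good colorings exclude the forbidden graphs -/

lemma exists_cycAdj_iff (k : ℕ) (P : ℕ → Prop) :
    ∃ i < 2 * k + 1, ∃ j < 2 * k + 1, CycAdj (2 * k + 1) i j ∧ (P i ↔ P j) := by
  by_contra! hcon
  have alternating : ∀ i < 2 * k + 1, (P i ↔ (Even i ↔ P 0)) := by
    intro i
    induction i with
    | zero => simp
    | succ i ih =>
      intro hi
      have := hcon i (by omega) (i + 1) hi (Or.inl rfl)
      rw [ih (by omega)] at this
      rw [Nat.even_add_one]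
      tauto
  have hlast := alternating (2 * k) (by omega)
  have hne := hcon (2 * k) (by omega) 0 (by omega) (Or.inr (Or.inr (Or.inr ⟨rfl, rfl⟩)))
  simp only [even_two, Even.mul_right, true_iff] at hlast
  exact hne.elim (fun h => h.2 (hlast.1 h.1)) fun h => h.1 (hlast.2 h.2)

namespace IsGoodColoring

variable {Γ : Type u} {M : TwoColoredGraph Γ} {V : Type v} {C : Type*} {f : Γ → C}
variable {a b c h : Γ} {x : V}

section

variable {nbr : Γ → Set V}

lemma not_triangle (hf : IsGoodColoring M nbr f) (hab : M.antip.Adj a b) (hbc : M.antip.Adj b c)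
    (hac : M.antip.Adj a c) (ha : x ∈ nbr a) (hb : x ∈ nbr b) : x ∉ nbr c := by
  intro hc
  rcases hf.two_colors ha hb hc with h | h | h
  · exact hf.ne_of_antip hab h
  · exact hf.ne_of_antip hbc h
  · exact hf.ne_of_antip hac h

lemma eq_iff_ne (hf : IsGoodColoring M nbr f) (hab : M.antip.Adj a b) (ha : x ∈ nbr a)
    (hb : x ∈ nbr b) (hh : x ∈ nbr h) : f a = f h ↔ f b ≠ f h := by
  refine ⟨fun hah hbh => hf.ne_of_antip hab (hah.trans hbh.symm), fun hbh => ?_⟩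
  rcases hf.two_colors ha hb hh with heq | heq | heq
  · exact absurd heq (hf.ne_of_antip hab)
  · exact absurd heq hbh
  · exact heq

end

variable {A : AttachmentSystem M V} {g p : ℕ → Γ} {k n : ℕ}

lemma eq_hub_iff (hf : IsGoodColoring M A.nbr f) (hab : M.antip.Adj a b) (ha : M.dom.Adj h a)
    (hb : M.dom.Adj h b ∨ M.antip.Adj h b) : f a = f h ↔ f b ≠ f h := by
  rcases (A.dom_iff _ _).1 ha with hlt | hlt
  · have hne : h ≠ b := hb.elim SimpleGraph.Adj.ne SimpleGraph.Adj.ne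
    obtain ⟨x, hxh, hxb⟩ := (A.attached_iff hne).2 hb.symm
    exact hf.eq_iff_ne hab (A.mono hlt hxh) hxb hxh
  · obtain ⟨x, hxa, hxb⟩ := (A.attached_iff hab.ne).2 (Or.inl hab)
    exact hf.eq_iff_ne hab hxa hxb (A.mono hlt hxa)

lemma eq_hub_iff' (hf : IsGoodColoring M A.nbr f) (hab : M.antip.Adj a b)
    (ha : M.dom.Adj h a ∨ M.antip.Adj h a) (hb : M.dom.Adj h b) : f a = f h ↔ f b ≠ f h := by
  rw [ne_eq, hf.eq_hub_iff hab.symm hb ha, not_not]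

lemma not_isWheel (hf : IsGoodColoring M A.nbr f) : ¬ IsWheel M h (2 * k + 1) g := by
  intro w
  obtain ⟨i, hi, j, hj, hij, hiff⟩ := exists_cycAdj_iff k fun i => f (g i) = f h
  have hadj := w.adj_of_cycAdj hi hj hij
  have halt : f (g i) = f h ↔ f (g j) ≠ f h := by
    rcases w.spoke i hi with hdi | hai
    · exact hf.eq_hub_iff hadj hdi (w.spoke j hj)
    · refine hf.eq_hub_iff' hadj (Or.inr hai) ((w.spoke j hj).resolve_right fun haj => ?_)
      exact hadj.ne (congrArg g (w.antip_unique i hi j hj hai haj))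
  tauto

lemma not_isFan (hf : IsGoodColoring M A.nbr f) (hn : 2 ≤ n) : ¬ IsFan M (2 * n + 1) p := by
  intro w
  obtain ⟨i, hi, j, hj, hij, hiff⟩ := exists_cycAdj_iff n fun i => f (p i) = f (p 0)
  have hadj := w.adj_of_cycAdj hi hj hij
  have hne := hf.ne_of_antip hadj
  have hspoke : ∀ t, 0 < t → t < 2 * n + 1 → M.dom.Adj (p 0) (p t) ∨ M.antip.Adj (p 0) (p t) := by
    intro t ht htn
    by_cases hend : 2 ≤ t ∧ t + 2 ≤ 2 * n + 1
    · exact Or.inl (w.spoke t hend.1 hend.2)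
    · refine Or.inr (w.adj_of_cycAdj (by omega) htn ?_)
      unfold CycAdj
      omega
  rcases i.eq_zero_or_pos with rfl | hipos
  · exact hne (hiff.1 rfl).symm
  rcases j.eq_zero_or_pos with rfl | hjpos
  · exact hne (hiff.2 rfl)
  have halt : f (p i) = f (p 0) ↔ f (p j) ≠ f (p 0) := by
    by_cases hend : 2 ≤ i ∧ i + 2 ≤ 2 * n + 1
    · exact hf.eq_hub_iff hadj (w.spoke i hend.1 hend.2) (hspoke j hjpos hj)
    · unfold CycAdj at hij
      exact hf.eq_hub_iff' hadj (hspoke i hipos hi) (w.spoke j (by omega) (by omega))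
  tauto

end IsGoodColoring

section Copies

variable {Γ : Type u} {M : TwoColoredGraph Γ} {k m n : ℕ}

lemma isCycleIn_ofNat {H : SimpleGraph Γ} [NeZero m] (hm : 3 ≤ m) {e : Fin m → Γ}
    (hinj : Function.Injective e)
    (hadj : ∀ a b, (SimpleGraph.cycleGraph m).Adj a b → H.Adj (e a) (e b)) :
    IsCycleIn H m (fun i => e (Fin.ofNat m i)) := by
  have hval : ∀ i < m, (Fin.ofNat m i).val = i := fun i hi => Nat.mod_eq_of_lt hi
  refine ⟨fun i hi j hj hij => ?_, fun i hi => ?_, fun i hi => ?_⟩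
  · rw [← hval i hi, ← hval j hj, hinj hij]
  all_goals
    apply hadj
    rw [cycleGraph_adj_iff_cycAdj (by omega), hval _ (by omega), hval _ (by omega)]
    unfold CycAdj
    omega

lemma exists_isWheel_of_hasCopy (hk : 1 ≤ k) {H : SimpleGraph (Option (Fin (2 * k + 1)))}
    (hrim : rim (2 * k + 1) ≤ H) (hspoke : ∀ x : Fin (2 * k + 1), x ≠ 0 → ¬ H.Adj none (some x))
    (hc : HasCopy (withHubs H {none}) M) : ∃ h g, IsWheel M h (2 * k + 1) g := by
  obtain ⟨e, hinj, hant, hdom⟩ := hc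
  have hcycle := isCycleIn_ofNat (by omega) (hinj.comp (Option.some_injective _)) fun a b hab =>
    hant _ _ (hrim (SimpleGraph.map_adj_apply.2 hab))
  refine ⟨e none, _, hcycle.isWheel (fun i hpos hi => ?_) ?_⟩
  · refine hdom _ _ ⟨nofun, Or.inl rfl, hspoke _ fun he => ?_⟩
    have := congrArg Fin.val he
    rw [Fin.val_ofNat, Nat.mod_eq_of_lt hi, Fin.val_zero] at this
    omega
  · by_cases h : H.Adj none (some (Fin.ofNat _ 0))
    · exact Or.inr (hant _ _ h)
    · exact Or.inl (hdom _ _ ⟨nofun, Or.inl rfl, h⟩)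

lemma exists_isFan_of_hasCopy (hn : 2 ≤ n) (hc : HasCopy (fan n) M) :
    ∃ c, IsFan M (2 * n + 1) c := by
  obtain ⟨e, hinj, hant, hdom⟩ := hc
  refine ⟨_, isCycleIn_ofNat (by omega) hinj hant, fun i hi hin => ?_⟩
  have hval : (Fin.ofNat (2 * n + 1) i).val = i := Nat.mod_eq_of_lt (by omega)
  refine hdom _ _ ⟨fun he => ?_, Or.inl rfl, fun hadj => ?_⟩
  · have := congrArg Fin.val he
    rw [hval, Fin.val_ofNat, Nat.zero_mod] at this
    omega
  · have hcyc := (cycleGraph_adj_iff_cycAdj (by omega) _ _).1 hadj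
    rw [hval, Fin.val_ofNat, Nat.zero_mod] at hcyc
    unfold CycAdj at hcyc
    omega

lemma IsGoodColoring.not_hasCopy {V : Type v} {C : Type*} {f : Γ → C} {A : AttachmentSystem M V}
    (hf : IsGoodColoring M A.nbr f) : ∀ S ∈ familyZero, ¬ HasCopy S.2 M := by
  rintro S (⟨k, hk, rfl | rfl⟩ | ⟨n, hn, rfl⟩) hc
  · obtain ⟨h, g, w⟩ := exists_isWheel_of_hasCopy hk le_rfl (fun _ _ => not_rim_adj_none) hc
    exact hf.not_isWheel w
  · obtain ⟨h, g, w⟩ := exists_isWheel_of_hasCopy hk le_sup_left (fun x hx => by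
      rw [SimpleGraph.sup_adj, SimpleGraph.edge_adj]
      simpa [not_rim_adj_none] using hx) hc
    exact hf.not_isWheel w
  · obtain ⟨c, w⟩ := exists_isFan_of_hasCopy hn hc
    exact hf.not_isFan hn w

lemma HasInducedCopy.hasCopy {U : Type*} {S : TwoColoredGraph U} (h : HasInducedCopy S M) :
    HasCopy S M := by
  obtain ⟨e, hinj, h1, h2⟩ := h
  exact ⟨e, hinj, fun i j => (h1 i j).1, fun i j => (h2 i j).1⟩

lemma HasCopy.of_withHubs {U : Type*} {H H' : SimpleGraph U} {s s' : Set U} (hH : H ≤ H')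
    (hs : s ⊆ s') (hd : ∀ i ∈ s, ∀ j, H'.Adj i j → H.Adj i j) (h : HasCopy (withHubs H' s') M) :
    HasCopy (withHubs H s) M := by
  obtain ⟨e, hinj, h1, h2⟩ := h
  refine ⟨e, hinj, fun i j hij => h1 i j (hH hij), ?_⟩
  rintro i j ⟨hne, hor, hnot⟩
  refine h2 i j ⟨hne, hor.imp (fun h => hs h) (fun h => hs h), fun h' => hnot ?_⟩
  rcases hor with h3 | h3
  · exact hd i h3 j h'
  · exact (hd j h3 i h'.symm).symm

lemma not_hasInducedCopy_of_not_hasCopy (h : ∀ S ∈ familyZero, ¬ HasCopy S.2 M) :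
    ∀ S ∈ family, ¬ HasInducedCopy S.2 M := by
  rintro S (hS | ⟨n, hn, rfl | rfl⟩) hc
  · exact h S hS hc.hasCopy
  · refine h _ (fan_mem_familyZero hn) (HasCopy.of_withHubs le_sup_left le_rfl ?_ hc.hasCopy)
    rintro i rfl j hj
    rw [SimpleGraph.sup_adj, SimpleGraph.edge_adj] at hj
    refine hj.resolve_right ?_
    have hone : (1 : Fin (2 * n + 1)).val = 1 :=
      (Fin.val_one' _).trans (Nat.mod_eq_of_lt (by omega))
    simp only [Fin.ext_iff, hone, Fin.val_last, Fin.val_zero]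
    omega
  · exact h _ (fan_mem_familyZero hn)
      (HasCopy.of_withHubs le_rfl (Set.singleton_subset_iff.2 (Or.inl rfl)) (fun _ _ _ h => h)
        hc.hasCopy)

end Copies

/-! ### The attachedness graph as an attachment system -/

section Dominance

variable {V : Type u} {G : SimpleGraph V} {Q : Set V}

/-- The vertices of `Q` that have `γ_c` as a neighboring subgraph. -/
def nbr (G : SimpleGraph V) (Q : Set V) (c : Comp G Q) : Set V :=
  {x | x ∈ Q ∧ IsNeighboring G Q c x}

lemma attached_iff_nbr {c d : Comp G Q} :
    Attached G Q c d ↔ (nbr G Q c ∩ nbr G Q d).Nonempty := by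
  constructor
  · rintro ⟨K, L, hK, hL, x, ⟨hxK, hxL⟩, hxQ⟩
    exact ⟨x, ⟨hxQ, K, hK, hxK⟩, hxQ, L, hL, hxL⟩
  · rintro ⟨x, ⟨hxQ, K, hK, hxK⟩, -, L, hL, hxL⟩
    exact ⟨K, L, hK, hL, x, ⟨hxK, hxL⟩, hxQ⟩

lemma dominated_iff_nbr {c d : Comp G Q} :
    Dominated G Q c d ↔ (nbr G Q c ∩ nbr G Q d).Nonempty ∧
      ∀ L, IsRelevant G Q d L → nbr G Q c ⊆ L ∨ nbr G Q c ∩ L = ∅ := by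
  rw [Dominated, attached_iff_nbr]
  refine and_congr_right fun _ => forall₂_congr fun L _ => or_congr ?_ ?_
  · constructor
    · rintro h x ⟨hxQ, K, hK, hxK⟩
      exact (h K hK ⟨hxK, hxQ⟩).1
    · rintro h K hK x ⟨hxK, hxQ⟩
      exact ⟨h ⟨hxQ, K, hK, hxK⟩, hxQ⟩
  · simp only [Set.eq_empty_iff_forall_notMem]
    constructor
    · rintro h x ⟨⟨hxQ, K, hK, hxK⟩, hxL⟩
      exact h K hK x ⟨⟨hxK, hxL⟩, hxQ⟩
    · rintro h K hK x ⟨⟨hxK, hxL⟩, hxQ⟩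
      exact h x ⟨⟨hxQ, K, hK, hxK⟩, hxL⟩

lemma Dominated.nbr_subset {c d : Comp G Q} (h : Dominated G Q c d) :
    nbr G Q c ⊆ nbr G Q d := by
  rw [dominated_iff_nbr] at h
  obtain ⟨⟨x, hxc, -, L, hL, hxL⟩, h⟩ := h
  rcases h L hL with hcase | hcase
  · exact fun y hy => ⟨hy.1, L, hL, hcase hy⟩
  · exact absurd (show x ∈ nbr G Q c ∩ L from ⟨hxc, hxL⟩) (by simp [hcase])

lemma Dominated.trans {c d e : Comp G Q} (h : Dominated G Q c d) (h' : Dominated G Q d e) :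
    Dominated G Q c e := by
  have hcd := h.nbr_subset
  have hde := h'.nbr_subset
  rw [dominated_iff_nbr] at *
  obtain ⟨⟨x, hxc, hxd⟩, -⟩ := h
  refine ⟨⟨x, hxc, hde hxd⟩, fun L hL => ?_⟩
  rcases h'.2 L hL with h1 | h1
  · exact Or.inl (hcd.trans h1)
  · exact Or.inr (Set.subset_empty_iff.1 (h1 ▸ Set.inter_subset_inter_left _ hcd))

lemma Attached.of_dominated_left {c d e : Comp G Q} (hce : Attached G Q c e)
    (h : Dominated G Q c d) : Attached G Q d e := by
  rw [attached_iff_nbr] at hce ⊢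
  exact hce.mono (Set.inter_subset_inter_left _ h.nbr_subset)

lemma attached_iff_antip_or_dom {c d : Comp G Q} (hne : c ≠ d) :
    Attached G Q c d ↔
      (attachednessGraph G Q).antip.Adj c d ∨ (attachednessGraph G Q).dom.Adj c d := by
  constructor
  · intro h
    by_cases hdom : Dominated G Q c d ∨ Dominated G Q d c
    · exact Or.inr ⟨hne, hdom⟩
    · exact Or.inl ⟨hne, h, not_or.1 hdom⟩
  · rintro (h | ⟨-, h | h⟩)
    exacts [h.2.1, h.1, h.1.symm]

/-- The dominance relation made antisymmetric: ties between components that dominate each other are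
broken by a well-order. -/
def DominatedBefore (G : SimpleGraph V) (Q : Set V) (c d : Comp G Q) : Prop :=
  Dominated G Q c d ∧ (¬ Dominated G Q d c ∨ WellOrderingRel c d)

namespace DominatedBefore

lemma irrefl (c : Comp G Q) : ¬ DominatedBefore G Q c c :=
  fun h => h.2.elim (fun h' => h' h.1) (_root_.irrefl c)

lemma ne {c d : Comp G Q} (h : DominatedBefore G Q c d) : c ≠ d := by
  rintro rfl
  exact irrefl c h

lemma trans {c d e : Comp G Q} (h : DominatedBefore G Q c d) (h' : DominatedBefore G Q d e) :
    DominatedBefore G Q c e := by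
  refine ⟨h.1.trans h'.1, ?_⟩
  by_cases hec : Dominated G Q e c
  · exact Or.inr (_root_.trans (h.2.resolve_left fun hdc => hdc (h'.1.trans hec))
      (h'.2.resolve_left fun hed => hed (hec.trans h.1)))
  · exact Or.inl hec

lemma or_iff {c d : Comp G Q} : DominatedBefore G Q c d ∨ DominatedBefore G Q d c ↔
    c ≠ d ∧ (Dominated G Q c d ∨ Dominated G Q d c) := by
  refine ⟨fun h => ⟨h.elim ne fun h => h.ne.symm, h.imp And.left And.left⟩, ?_⟩
  rintro ⟨hne, h⟩
  by_cases hcd : Dominated G Q c d <;> by_cases hdc : Dominated G Q d c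
  · rcases trichotomous_of WellOrderingRel c d with hlt | heq | hgt
    exacts [Or.inl ⟨hcd, Or.inr hlt⟩, absurd heq hne, Or.inr ⟨hdc, Or.inr hgt⟩]
  · exact Or.inl ⟨hcd, Or.inl hdc⟩
  · exact Or.inr ⟨hdc, Or.inl hcd⟩
  · exact absurd h (not_or.2 ⟨hcd, hdc⟩)

lemma antip_or {c d e : Comp G Q} (h : DominatedBefore G Q c d)
    (hce : (attachednessGraph G Q).antip.Adj c e) :
    (attachednessGraph G Q).antip.Adj e d ∨ DominatedBefore G Q e d := by
  have hed : e ≠ d := by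
    rintro rfl
    exact hce.2.2.1 h.1
  have hde : ¬ Dominated G Q d e := fun hde => hce.2.2.1 (h.1.trans hde)
  by_cases hdom : Dominated G Q e d
  · exact Or.inr ⟨hdom, Or.inl hde⟩
  · exact Or.inl ⟨hed, (hce.2.1.of_dominated_left h.1).symm, hdom, hde⟩

end DominatedBefore

/-- The attachedness graph as an attachment system, with the components ordered by
`DominatedBefore`. -/
def attachmentSystem (G : SimpleGraph V) (Q : Set V) :
    AttachmentSystem (attachednessGraph G Q) V where
  lt := DominatedBefore G Q
  irrefl := DominatedBefore.irrefl
  trans := DominatedBefore.trans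
  dom_iff _ _ := DominatedBefore.or_iff.symm
  antip_or_lt := DominatedBefore.antip_or
  nbr := nbr G Q
  mono h := h.1.nbr_subset
  attached_iff hne := attached_iff_nbr.symm.trans (attached_iff_antip_or_dom hne)

/-- The attachedness graph has a good coloring. -/
def HasGoodColoring (G : SimpleGraph V) (Q : Set V) : Prop :=
  ∃ (C : Type u) (f : Comp G Q → C), IsGoodColoring (attachednessGraph G Q) (nbr G Q) f

lemma HasGoodColoring.not_hasCopy (h : HasGoodColoring G Q) :
    ∀ S ∈ familyZero, ¬ HasCopy S.2 (attachednessGraph G Q) := by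
  obtain ⟨C, f, hf⟩ := h
  exact IsGoodColoring.not_hasCopy (A := attachmentSystem G Q) hf

lemma HasGoodColoring.not_hasFullAntipodalTriangle (h : HasGoodColoring G Q) :
    ¬ HasFullAntipodalTriangle G Q := by
  obtain ⟨C, f, hf⟩ := h
  rintro ⟨a, b, c, hab, hbc, hac, x, hxQ, ha, hb, hc⟩
  exact hf.not_triangle hab hbc hac ⟨hxQ, ha⟩ ⟨hxQ, hb⟩ ⟨hxQ, hc⟩

lemma HasGoodColoring.of_not_hasInducedCopy [Finite V] (htri : ¬ HasFullAntipodalTriangle G Q)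
    (h : ∀ S ∈ family, ¬ HasInducedCopy S.2 (attachednessGraph G Q)) : HasGoodColoring G Q := by
  have D := (attachmentSystem G Q).toDominanceOrder
  obtain ⟨f, hf⟩ := (attachmentSystem G Q).exists_isGoodColoring
    (fun a b c hab hbc hac x ha hb hc => htri ⟨a, b, c, hab, hbc, hac, x, ha.1, ha.2, hb.2, hc.2⟩)
    (not_isWheel D h) (not_isFan D h)
  exact ⟨_, f, hf⟩

end Dominance

/-! ### Relevant cliques -/

section RelevantCliques

variable {V : Type u} {G : SimpleGraph V} {Q : Set V}

/-- The vertex set of a component of `G - Q`. -/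
def compSet (G : SimpleGraph V) (Q : Set V) (c : Comp G Q) : Set V := Subtype.val '' c.supp

/-- `K` is a maximal clique of `G`. -/
abbrev IsMaxClique (G : SimpleGraph V) (K : Set V) : Prop := IsMaxCliqueIn G Set.univ K

lemma mem_compSet {c : Comp G Q} {x : V} :
    x ∈ compSet G Q c ↔ ∃ h : x ∉ Q, (G.induce Qᶜ).connectedComponentMk ⟨x, h⟩ = c := by
  constructor
  · rintro ⟨⟨y, hy⟩, hyc, rfl⟩
    exact ⟨hy, hyc⟩
  · rintro ⟨h, hc⟩
    exact ⟨⟨x, h⟩, hc, rfl⟩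

lemma notMem_of_mem_compSet {c : Comp G Q} {x : V} (h : x ∈ compSet G Q c) : x ∉ Q :=
  (mem_compSet.1 h).1

lemma mem_compSet_of_adj {c : Comp G Q} {x y : V} (h : x ∈ compSet G Q c) (hxy : G.Adj x y)
    (hy : y ∉ Q) : y ∈ compSet G Q c := by
  obtain ⟨hx, rfl⟩ := mem_compSet.1 h
  refine mem_compSet.2 ⟨hy, ?_⟩
  apply SimpleGraph.ConnectedComponent.sound
  exact SimpleGraph.Adj.reachable (show (G.induce Qᶜ).Adj ⟨y, hy⟩ ⟨x, hx⟩ from hxy.symm)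

lemma exists_mem_compSet {x : V} (h : x ∉ Q) : ∃ c : Comp G Q, x ∈ compSet G Q c :=
  ⟨_, mem_compSet.2 ⟨h, rfl⟩⟩

lemma compSet_eq_of_mem {c d : Comp G Q} {x : V} (hc : x ∈ compSet G Q c)
    (hd : x ∈ compSet G Q d) : c = d := by
  obtain ⟨h, rfl⟩ := mem_compSet.1 hc
  obtain ⟨h', rfl⟩ := mem_compSet.1 hd
  rfl

lemma compSet_nonempty (c : Comp G Q) : (compSet G Q c).Nonempty := by
  obtain ⟨x, hx⟩ := c.nonempty_supp
  exact ⟨x, x, hx, rfl⟩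

lemma compSet_subset_of_adj {S : Set V} (hS : ∀ x ∈ S, ∀ y, G.Adj x y → y ∉ Q → y ∈ S)
    {c : Comp G Q} {x : V} (hxc : x ∈ compSet G Q c) (hxS : x ∈ S) : compSet G Q c ⊆ S := by
  intro y hy
  obtain ⟨hxQ, hxc⟩ := mem_compSet.1 hxc
  obtain ⟨hyQ, hyc⟩ := mem_compSet.1 hy
  obtain ⟨p⟩ := SimpleGraph.ConnectedComponent.exact (hxc.trans hyc.symm)
  by_contra hyS
  obtain ⟨d, -, hfst, hsnd⟩ := p.exists_boundary_dart (Subtype.val ⁻¹' S) hxS hyS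
  exact hsnd (hS _ hfst _ d.adj d.snd.2)

lemma IsMaxClique.mem_of_forall {K : Set V} (h : IsMaxClique G K) {x : V}
    (hx : ∀ y ∈ K, y ≠ x → G.Adj x y) : x ∈ K := by
  have hclique : G.IsClique (insert x K) := by
    rw [SimpleGraph.isClique_insert]
    exact ⟨h.prop.1, fun y hy hne => hx y hy hne.symm⟩
  exact h.le_of_ge ⟨hclique, Set.subset_univ _⟩ (Set.subset_insert _ _) (Set.mem_insert _ _)

lemma IsMaxClique.eq_of_subset {K L : Set V} (h : IsMaxClique G K) (hL : G.IsClique L)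
    (hKL : K ⊆ L) : K = L :=
  Set.Subset.antisymm hKL (h.le_of_ge ⟨hL, Set.subset_univ _⟩ hKL)

lemma exists_isMaxClique_superset [Finite V] {K : Set V} (h : G.IsClique K) :
    ∃ L, K ⊆ L ∧ IsMaxClique G L := by
  obtain ⟨L, hKL, hL⟩ := Set.Finite.exists_le_maximal (Set.toFinite {L : Set V | G.IsClique L ∧
    L ⊆ Set.univ}) (a := K) ⟨h, Set.subset_univ _⟩
  exact ⟨L, hKL, hL⟩

lemma subset_piece_of_inter_compSet {c : Comp G Q} {K : Set V} (hK : G.IsClique K)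
    (hKc : (K ∩ compSet G Q c).Nonempty) : K ⊆ piece G Q c := by
  obtain ⟨x, hxK, hxc⟩ := hKc
  intro y hy
  by_cases hyQ : y ∈ Q
  · exact Or.inr hyQ
  · by_cases hxy : x = y
    · exact Or.inl (hxy ▸ hxc)
    · exact Or.inl (mem_compSet_of_adj hxc (hK hxK hy hxy) hyQ)

lemma isRelevant_iff (hQ : G.IsClique Q) {c : Comp G Q} {K : Set V} :
    IsRelevant G Q c K ↔
      IsMaxClique G K ∧ (K ∩ Q).Nonempty ∧ (K ∩ compSet G Q c).Nonempty := by
  constructor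
  · rintro ⟨hK, hKQ, hne⟩
    have hKc : (K ∩ compSet G Q c).Nonempty := by
      by_contra hcon
      apply hne
      have hsub : K ⊆ Q := by
        intro x hx
        rcases hK.prop.2 hx with h | h
        · exact absurd ⟨x, hx, h⟩ hcon
        · exact h
      exact Set.Subset.antisymm hsub (hK.le_of_ge ⟨hQ, Set.subset_union_right⟩ hsub)
    refine ⟨⟨⟨hK.prop.1, Set.subset_univ _⟩, ?_⟩, hKQ, hKc⟩
    rintro L ⟨hL, -⟩ hKL
    exact hK.le_of_ge
      ⟨hL, subset_piece_of_inter_compSet hL (hKc.mono (Set.inter_subset_inter_left _ hKL))⟩ hKL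
  · rintro ⟨hK, hKQ, hKc⟩
    refine ⟨⟨⟨hK.prop.1, subset_piece_of_inter_compSet hK.prop.1 hKc⟩, ?_⟩, hKQ, ?_⟩
    · rintro L ⟨hL, -⟩ hKL
      exact hK.le_of_ge ⟨hL, Set.subset_univ _⟩ hKL
    · rintro rfl
      obtain ⟨x, hxK, hxc⟩ := hKc
      exact notMem_of_mem_compSet hxc hxK

lemma mem_nbr_iff [Finite V] (hQ : G.IsClique Q) {c : Comp G Q} {x : V} :
    x ∈ nbr G Q c ↔ x ∈ Q ∧ ∃ y ∈ compSet G Q c, G.Adj x y := by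
  constructor
  · rintro ⟨hxQ, K, hK, hxK⟩
    obtain ⟨hK, -, y, hyK, hyc⟩ := (isRelevant_iff hQ).1 hK
    refine ⟨hxQ, y, hyc, hK.prop.1 hxK hyK ?_⟩
    rintro rfl
    exact notMem_of_mem_compSet hyc hxQ
  · rintro ⟨hxQ, y, hyc, hxy⟩
    obtain ⟨K, hKs, hK⟩ := exists_isMaxClique_superset (G := G) (K := {x, y}) (by
      rw [SimpleGraph.isClique_pair]; exact fun _ => hxy)
    exact ⟨hxQ, K, (isRelevant_iff hQ).2 ⟨hK, ⟨x, hKs (by simp), hxQ⟩, y, hKs (by simp), hyc⟩,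
      hKs (by simp)⟩

end RelevantCliques

/-! ### Segments of a tree -/

section Segments

variable {W : Type u} {T : SimpleGraph W}

/-- The vertices that lie on every walk from `a` to `b`. -/
def seg (T : SimpleGraph W) (a b : W) : Set W := {x | ∀ p : T.Walk a b, x ∈ p.support}

lemma left_mem_seg (a b : W) : a ∈ seg T a b := fun p => p.start_mem_support

lemma right_mem_seg (a b : W) : b ∈ seg T a b := fun p => p.end_mem_support

lemma seg_comm (a b : W) : seg T a b = seg T b a := by
  ext x
  constructor <;> intro h p <;> simpa using h p.reverse

lemma seg_subset_union (a b z : W) : seg T a b ⊆ seg T a z ∪ seg T z b := by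
  intro x hx
  by_contra hcon
  simp only [Set.mem_union, seg, Set.mem_ofPred_eq, not_or, not_forall] at hcon
  obtain ⟨⟨p, hp⟩, q, hq⟩ := hcon
  have := hx (p.append q)
  rw [SimpleGraph.Walk.mem_support_append_iff] at this
  exact this.elim hp hq

lemma seg_subset_seg_right {a b m : W} (h : m ∈ seg T a b) : seg T m b ⊆ seg T a b := by
  classical
  intro x hx p
  exact SimpleGraph.Walk.support_dropUntil_subset_support p (h p) (hx (p.dropUntil m (h p)))

lemma seg_subset_seg_left {a b m : W} (h : m ∈ seg T a b) : seg T a m ⊆ seg T a b := by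
  rw [seg_comm a m, seg_comm a b] at *
  exact seg_subset_seg_right h

lemma seg_subset_seg {a b x y : W} (hx : x ∈ seg T a b) (hy : y ∈ seg T a b) :
    seg T x y ⊆ seg T a b := by
  refine (seg_subset_union x y b).trans (Set.union_subset (seg_subset_seg_right hx) ?_)
  rw [seg_comm b y]
  exact seg_subset_seg_right hy

lemma seg_self (a : W) : seg T a a = {a} := by
  refine Set.Subset.antisymm (fun x hx => ?_) (by simpa using left_mem_seg a a)
  simpa using hx SimpleGraph.Walk.nil

lemma seg_eq_support (hT : T.IsTree) {a b : W} {p : T.Walk a b} (hp : p.IsPath) :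
    seg T a b = {x | x ∈ p.support} := by
  classical
  refine Set.Subset.antisymm (fun x hx => hx p) (fun x hx q => ?_)
  have : q.bypass = p := (hT.existsUnique_path a b).unique q.bypass_isPath hp
  exact q.support_bypass_subset_support (this ▸ hx)

lemma exists_isPath (hT : T.IsTree) (a b : W) : ∃ p : T.Walk a b, p.IsPath :=
  (hT.existsUnique_path a b).exists

lemma isPathSet_iff (hT : T.IsTree) {S : Set W} : IsPathSet T S ↔ ∃ a b, S = seg T a b := by
  constructor
  · rintro ⟨a, b, p, hp, rfl⟩
    exact ⟨a, b, (seg_eq_support hT hp).symm⟩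
  · rintro ⟨a, b, rfl⟩
    obtain ⟨p, hp⟩ := exists_isPath hT a b
    exact ⟨a, b, p, hp, seg_eq_support hT hp⟩

lemma seg_antisymm (hT : T.IsTree) {a x y : W} (hx : x ∈ seg T a y) (hy : y ∈ seg T a x) :
    x = y := by
  classical
  by_contra hne
  obtain ⟨p, hp⟩ := exists_isPath hT a y
  exact SimpleGraph.Walk.endpoint_notMem_support_takeUntil hp (hx p) (Ne.symm hne)
    (hy (p.takeUntil x (hx p)))

lemma mem_seg_or_mem_seg (hT : T.IsTree) {a b x y : W} (hx : x ∈ seg T a b) (hy : y ∈ seg T a b) :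
    x ∈ seg T a y ∨ y ∈ seg T a x := by
  classical
  obtain ⟨p, hp⟩ := exists_isPath hT a b
  obtain ⟨p₁, p₂, rfl⟩ := SimpleGraph.Walk.mem_support_iff_exists_append.1 (hx p)
  by_cases h : y ∈ p₁.support
  · right
    rw [seg_eq_support hT hp.of_append_left]
    exact h
  · left
    have hy₂ := ((SimpleGraph.Walk.mem_support_append_iff p₁ p₂).1 (hy _)).resolve_left h
    obtain ⟨r₁, r₂, rfl⟩ := SimpleGraph.Walk.mem_support_iff_exists_append.1 hy₂
    rw [SimpleGraph.Walk.append_assoc] at hp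
    rw [seg_eq_support hT hp.of_append_left]
    exact (SimpleGraph.Walk.mem_support_append_iff _ _).2 (Or.inl p₁.end_mem_support)

lemma mem_seg_of_mem_of_mem (hT : T.IsTree) {a b x y : W} (hy : y ∈ seg T a b)
    (hx : x ∈ seg T a y) : y ∈ seg T x b := by
  rcases seg_subset_union a b x hy with h | h
  · rw [seg_antisymm hT hx h]
    exact left_mem_seg _ _
  · exact h

lemma mem_seg_of_between (hT : T.IsTree) {a b q x y : W} (hq : q ∈ seg T a b)
    (hx : x ∈ seg T a q) (hy : y ∈ seg T q b) : q ∈ seg T x y := by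
  have hqx : q ∈ seg T b x := seg_comm x b ▸ mem_seg_of_mem_of_mem hT hq hx
  rw [seg_comm]
  exact mem_seg_of_mem_of_mem hT hqx (seg_comm q b ▸ hy)

lemma mem_seg_or_mem_seg_or_mem_seg (hT : T.IsTree) {a b q x y : W} (hq : q ∈ seg T a b)
    (hx : x ∈ seg T a b) (hy : y ∈ seg T a b) :
    x ∈ seg T q y ∨ y ∈ seg T q x ∨ q ∈ seg T x y := by
  rcases seg_subset_union a b q hx with hx | hx <;> rcases seg_subset_union a b q hy with hy | hy
  · rw [seg_comm] at hx hy
    exact (mem_seg_or_mem_seg hT hx hy).imp_right Or.inl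
  · exact Or.inr (Or.inr (mem_seg_of_between hT hq hx hy))
  · rw [seg_comm x y]
    exact Or.inr (Or.inr (mem_seg_of_between hT hq hy hx))
  · exact (mem_seg_or_mem_seg hT hx hy).imp_right Or.inl

lemma notMem_seg_of_mem_seg (hT : T.IsTree) {a q x y : W} (hx : x ∈ seg T a q) (hy : y ∈ seg T a q)
    (hxq : x ≠ q) (hyq : y ≠ q) : q ∉ seg T x y := by
  intro h
  rcases mem_seg_or_mem_seg hT hx hy with h1 | h1
  · exact hyq (seg_antisymm hT hy (seg_subset_seg h1 (right_mem_seg a y) h))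
  · exact hxq (seg_antisymm hT hx (seg_subset_seg (right_mem_seg a x) h1 h))

/-- A set of vertices of a tree containing the segments between its members. -/
def SegConvex (T : SimpleGraph W) (U : Set W) : Prop := ∀ a ∈ U, ∀ b ∈ U, seg T a b ⊆ U

lemma segConvex_seg (a b : W) : SegConvex T (seg T a b) := fun _ hx _ hy => seg_subset_seg hx hy

lemma mem_seg_of_adj (hT : T.IsTree) {r s u : W} (hrs : T.Adj r s) (hr : r ∉ seg T s u) :
    s ∈ seg T r u := by
  obtain ⟨p, hp⟩ := exists_isPath hT s u
  rw [seg_eq_support hT hp] at hr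
  rw [seg_eq_support hT (hp.cons hr (h := hrs))]
  simp

lemma exists_gate (hT : T.IsTree) {U : Set W} (hU : SegConvex T U) (hne : U.Nonempty) (r : W) :
    ∃ m ∈ U, ∀ u ∈ U, m ∈ seg T r u := by
  obtain ⟨u₀, hu₀⟩ := hne
  obtain ⟨p, -⟩ := exists_isPath hT r u₀
  induction p with
  | nil => exact ⟨_, hu₀, fun u _ => left_mem_seg _ _⟩
  | @cons r s u₀ hrs p ih =>
    obtain ⟨m, hm, hgate⟩ := ih hu₀
    by_cases hr : r ∈ U
    · exact ⟨r, hr, fun u _ => left_mem_seg _ _⟩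
    · refine ⟨m, hm, fun u hu => ?_⟩
      rcases seg_subset_union s u r (hgate u hu) with h | h
      · have hmem := h hrs.symm.toWalk
        have hm_eq : m = s ∨ m = r := by simpa using hmem
        rcases hm_eq with rfl | rfl
        · exact mem_seg_of_adj hT hrs fun hr_mem => hr (hU _ hm _ hu hr_mem)
        · exact absurd hm hr
      · exact h

lemma exists_forall_mem_of_pairwise_inter_nonempty [Finite W] (hT : T.IsTree) {V : Type*}
    {K : Set V} (hK : K.Finite) {φ : V → Set W} (hconv : ∀ v ∈ K, SegConvex T (φ v))
    (hne : ∀ v ∈ K, (φ v).Nonempty) (hpair : ∀ v ∈ K, ∀ w ∈ K, v ≠ w → (φ v ∩ φ w).Nonempty) :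
    ∃ q, ∀ v ∈ K, q ∈ φ v := by
  obtain ⟨r⟩ := hT.connected.nonempty
  rcases K.eq_empty_or_nonempty with rfl | hKne
  · exact ⟨r, by simp⟩
  have : Nonempty W := ⟨r⟩
  choose! m hm hgate using fun v hv => exists_gate hT (hconv v hv) (hne v hv) r
  -- the gate farthest from the root belongs to all the sets
  obtain ⟨v, hv, hmax⟩ := Set.exists_max_image K (fun v => (seg T r (m v)).ncard) hK hKne
  refine ⟨m v, fun w hw => ?_⟩
  by_cases hvw : v = w
  · exact hvw ▸ hm v hv
  obtain ⟨z, hzv, hzw⟩ := hpair v hv w hw hvw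
  have hmw : m w ∈ seg T r (m v) := by
    rcases mem_seg_or_mem_seg hT (hgate w hw z hzw) (hgate v hv z hzv) with h | h
    · exact h
    · rw [Set.eq_of_subset_of_ncard_le (seg_subset_seg_left h) (hmax w hw) (Set.toFinite _)]
      exact right_mem_seg _ _
  exact hconv w hw _ (hm w hw) _ hzw (mem_seg_of_mem_of_mem hT (hgate v hv z hzv) hmw)

lemma seg_union_seg_eq (hT : T.IsTree) {r a b : W} (h : seg T r a ∩ seg T r b ⊆ {r}) :
    seg T r a ∪ seg T r b = seg T a b := by
  obtain ⟨m, hm, hgate⟩ := exists_gate hT (segConvex_seg (T := T) a b) ⟨a, left_mem_seg _ _⟩ r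
  have hmr : m = r := h ⟨hgate a (left_mem_seg _ _), hgate b (right_mem_seg _ _)⟩
  subst hmr
  refine Set.Subset.antisymm (Set.union_subset (seg_subset_seg hm (left_mem_seg _ _))
    (seg_subset_seg hm (right_mem_seg _ _))) ?_
  rw [seg_comm m a]
  exact seg_subset_union a b m

lemma notMem_seg_or_notMem_seg (hT : T.IsTree) {a b q x y z : W} (hx : x ∈ seg T a b)
    (hy : y ∈ seg T a b) (hz : z ∈ seg T a b) (hxq : x ≠ q) (hyq : y ≠ q) (hzq : z ≠ q) :
    q ∉ seg T x y ∨ q ∉ seg T y z ∨ q ∉ seg T x z := by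
  have key : ∀ {w}, w ∈ seg T a b → w ∈ seg T a q ∨ w ∈ seg T b q := by
    intro w hw
    rw [seg_comm b q]
    exact seg_subset_union a b q hw
  rcases key hx with h1 | h1 <;> rcases key hy with h2 | h2 <;> rcases key hz with h3 | h3
  · exact Or.inl (notMem_seg_of_mem_seg hT h1 h2 hxq hyq)
  · exact Or.inl (notMem_seg_of_mem_seg hT h1 h2 hxq hyq)
  · exact Or.inr (Or.inr (notMem_seg_of_mem_seg hT h1 h3 hxq hzq))
  · exact Or.inr (Or.inl (notMem_seg_of_mem_seg hT h2 h3 hyq hzq))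
  · exact Or.inr (Or.inl (notMem_seg_of_mem_seg hT h2 h3 hyq hzq))
  · exact Or.inr (Or.inr (notMem_seg_of_mem_seg hT h1 h3 hxq hzq))
  · exact Or.inl (notMem_seg_of_mem_seg hT h1 h2 hxq hyq)
  · exact Or.inl (notMem_seg_of_mem_seg hT h1 h2 hxq hyq)

/-- The branch at `q` that contains `x`; it is empty when `x = q`. -/
def branch (T : SimpleGraph W) (q x : W) : Set W := {y | q ∉ seg T y x}

lemma branch_subset_branch {q x y : W} (h : q ∉ seg T x y) : branch T q x ⊆ branch T q y :=
  fun z hz hz' => (seg_subset_union z y x hz').elim hz h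

lemma branch_eq_branch_iff {q x y : W} (hx : x ≠ q) :
    branch T q x = branch T q y ↔ q ∉ seg T x y := by
  constructor
  · intro h
    have hmem : x ∈ branch T q x := by
      rw [branch, Set.mem_ofPred_eq, seg_self]
      exact hx.symm
    rwa [h] at hmem
  · intro h
    exact (branch_subset_branch h).antisymm (branch_subset_branch (seg_comm x y ▸ h))

lemma seg_map {W' : Type*} {T' : SimpleGraph W'} (hT : T.IsTree) (hT' : T'.IsTree)
    {f : T →g T'} (hf : Function.Injective f) (x y : W) :
    seg T' (f x) (f y) = f '' seg T x y := by
  obtain ⟨p, hp⟩ := exists_isPath hT x y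
  rw [seg_eq_support hT hp,
    seg_eq_support hT' ((SimpleGraph.Walk.isPath_map_iff_of_injective hf).2 hp)]
  ext z
  simp only [SimpleGraph.Walk.support_map, List.mem_map, Set.mem_ofPred_eq, Set.mem_image]

end Segments

/-! ### Joining two trees by an edge -/

section Join

variable {W₁ W₂ : Type u} {T₁ : SimpleGraph W₁} {T₂ : SimpleGraph W₂} {a : W₁} {b : W₂}

/-- Two graphs joined by an edge. -/
def join (T₁ : SimpleGraph W₁) (T₂ : SimpleGraph W₂) (a : W₁) (b : W₂) : SimpleGraph (W₁ ⊕ W₂) :=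
  (T₁.sum T₂) ⊔ SimpleGraph.edge (Sum.inl a) (Sum.inr b)

lemma isTree_join [Finite W₁] [Finite W₂] (h₁ : T₁.IsTree) (h₂ : T₂.IsTree) :
    (join T₁ T₂ a b).IsTree := by
  classical
  rw [SimpleGraph.isTree_iff_connected_and_card] at *
  refine ⟨h₁.1.sum_sup_edge h₂.1, ?_⟩
  have h : (join T₁ T₂ a b).edgeSet = insert s(Sum.inl a, Sum.inr b) (T₁.sum T₂).edgeSet := by
    rw [join, SimpleGraph.edgeSet_sup, SimpleGraph.edgeSet_edge_of_ne Sum.inl_ne_inr,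
      Set.union_comm]
    rfl
  have hnot : s(Sum.inl a, Sum.inr b) ∉ (T₁.sum T₂).edgeSet := by
    rw [SimpleGraph.mem_edgeSet]
    exact SimpleGraph.not_adj_sum_inl_inr _ _
  have hc : Nat.card (T₁.sum T₂).edgeSet = Nat.card T₁.edgeSet + Nat.card T₂.edgeSet := by
    rw [Nat.card_congr SimpleGraph.edgeSetSumEquiv, Nat.card_sum]
  have hcard := Set.ncard_insert_of_notMem hnot (Set.toFinite _)
  rw [← h, ← Nat.card_coe_set_eq, ← Nat.card_coe_set_eq, hc] at hcard
  rw [hcard, Nat.card_sum]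
  omega

/-- The left inclusion into a join. -/
def joinInl (T₁ : SimpleGraph W₁) (T₂ : SimpleGraph W₂) (a : W₁) (b : W₂) :
    T₁ →g join T₁ T₂ a b where
  toFun := Sum.inl
  map_rel' h := Or.inl (SimpleGraph.sum_adj_inl.2 h)

/-- The right inclusion into a join. -/
def joinInr (T₁ : SimpleGraph W₁) (T₂ : SimpleGraph W₂) (a : W₁) (b : W₂) :
    T₂ →g join T₁ T₂ a b where
  toFun := Sum.inr
  map_rel' h := Or.inl (SimpleGraph.sum_adj_inr.2 h)

lemma seg_join_inl [Finite W₁] [Finite W₂] (h₁ : T₁.IsTree) (h₂ : T₂.IsTree) (x y : W₁) :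
    seg (join T₁ T₂ a b) (Sum.inl x) (Sum.inl y) = Sum.inl '' seg T₁ x y :=
  seg_map h₁ (isTree_join h₁ h₂) (f := joinInl T₁ T₂ a b) Sum.inl_injective x y

lemma seg_join_inr [Finite W₁] [Finite W₂] (h₁ : T₁.IsTree) (h₂ : T₂.IsTree) (x y : W₂) :
    seg (join T₁ T₂ a b) (Sum.inr x) (Sum.inr y) = Sum.inr '' seg T₂ x y :=
  seg_map h₂ (isTree_join h₁ h₂) (f := joinInr T₁ T₂ a b) Sum.inr_injective x y

lemma seg_join_inl_inr [Finite W₁] [Finite W₂] (h₁ : T₁.IsTree) (h₂ : T₂.IsTree) (x : W₁)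
    (y : W₂) : seg (join T₁ T₂ a b) (Sum.inl x) (Sum.inr y) =
      Sum.inl '' seg T₁ x a ∪ Sum.inr '' seg T₂ b y := by
  obtain ⟨p, hp⟩ := exists_isPath h₁ x a
  obtain ⟨q, hq⟩ := exists_isPath h₂ b y
  have hab : (join T₁ T₂ a b).Adj (joinInl T₁ T₂ a b a) (joinInr T₁ T₂ a b b) :=
    Or.inr ((SimpleGraph.edge_adj ..).2 ⟨Or.inl ⟨rfl, rfl⟩, Sum.inl_ne_inr⟩)
  let w := (p.map (joinInl T₁ T₂ a b)).append
    (SimpleGraph.Walk.cons hab (q.map (joinInr T₁ T₂ a b)))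
  have hw : w.support = p.support.map Sum.inl ++ q.support.map Sum.inr := by
    simp only [w, SimpleGraph.Walk.support_append, SimpleGraph.Walk.support_map,
      SimpleGraph.Walk.support_cons, List.tail_cons]
    rfl
  have hwp : w.IsPath := by
    rw [SimpleGraph.Walk.isPath_def, hw, List.nodup_append]
    refine ⟨(List.nodup_map_iff Sum.inl_injective).2 hp.support_nodup,
      (List.nodup_map_iff Sum.inr_injective).2 hq.support_nodup, ?_⟩
    intro z hz z' hz'
    obtain ⟨t, -, rfl⟩ := List.mem_map.1 hz
    obtain ⟨t', -, rfl⟩ := List.mem_map.1 hz'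
    simp
  rw [seg_eq_support h₁ hp, seg_eq_support h₂ hq]
  refine (seg_eq_support (isTree_join h₁ h₂) hwp).trans ?_
  ext z
  rw [Set.mem_ofPred_eq, hw, List.mem_append, List.mem_map, List.mem_map]
  rfl

end Join

/-! ### Representations by paths of a tree -/

section PathRepresentations

variable {V W : Type u} {G : SimpleGraph V} {Q : Set V} {T : SimpleGraph W} {φ : V → Set W}

/-- A representation of the subgraph of `G` induced by `S` by (not necessarily distinct) paths of a
tree. -/
structure IsPathRepOn (G : SimpleGraph V) (S : Set V) (T : SimpleGraph W) (φ : V → Set W) :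
    Prop where
  isTree : T.IsTree
  exists_seg : ∀ v ∈ S, ∃ a b, φ v = seg T a b
  adj_iff : ∀ v ∈ S, ∀ w ∈ S, v ≠ w → (G.Adj v w ↔ (φ v ∩ φ w).Nonempty)

/-- A representation of `G` by (not necessarily distinct) paths of a tree. -/
abbrev IsPathRep (G : SimpleGraph V) (T : SimpleGraph W) (φ : V → Set W) : Prop :=
  IsPathRepOn G Set.univ T φ

lemma IsPathRepOn.convex {S : Set V} (h : IsPathRepOn G S T φ) {v : V} (hv : v ∈ S) :
    SegConvex T (φ v) := by
  obtain ⟨a, b, hab⟩ := h.exists_seg v hv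
  rw [hab]
  exact segConvex_seg a b

lemma IsPathRepOn.nonempty {S : Set V} (h : IsPathRepOn G S T φ) {v : V} (hv : v ∈ S) :
    (φ v).Nonempty := by
  obtain ⟨a, b, hab⟩ := h.exists_seg v hv
  rw [hab]
  exact ⟨a, left_mem_seg a b⟩

lemma IsPathRepOn.adj_of_mem {S : Set V} (h : IsPathRepOn G S T φ) {v w : V} (hvS : v ∈ S)
    (hwS : w ∈ S) (hne : v ≠ w) {x : W} (hv : x ∈ φ v) (hw : x ∈ φ w) : G.Adj v w :=
  (h.adj_iff v hvS w hwS hne).2 ⟨x, hv, hw⟩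

lemma IsPathRepOn.exists_node [Finite V] [Finite W] {S : Set V} (h : IsPathRepOn G S T φ)
    {K : Set V} (hK : IsMaxClique G K) (hKS : K ⊆ S) : ∃ q, ∀ v ∈ S, (q ∈ φ v ↔ v ∈ K) := by
  obtain ⟨q, hq⟩ := exists_forall_mem_of_pairwise_inter_nonempty h.isTree (Set.toFinite K)
    (fun v hv => h.convex (hKS hv)) (fun v hv => h.nonempty (hKS hv))
    (fun v hv w hw hne => (h.adj_iff v (hKS hv) w (hKS hw) hne).1 (hK.prop.1 hv hw hne))
  refine ⟨q, fun v hvS => ⟨fun hv => ?_, hq v⟩⟩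
  exact IsMaxClique.mem_of_forall hK fun w hw hne =>
    h.adj_of_mem hvS (hKS hw) hne.symm hv (hq w hw)

/-- The nodes used by the vertices of a component of `G - Q`. -/
def compNodes (G : SimpleGraph V) (Q : Set V) (φ : V → Set W) (c : Comp G Q) : Set W :=
  {x | ∃ v ∈ compSet G Q c, x ∈ φ v}

lemma IsPathRepOn.seg_subset_compNodes {S : Set V} (h : IsPathRepOn G S T φ) {c : Comp G Q}
    (hc : compSet G Q c ⊆ S) {v w : ↥(Qᶜ : Set V)} (p : (G.induce Qᶜ).Walk v w)
    (hv : v.1 ∈ compSet G Q c) {a b : W} (ha : a ∈ φ v) (hb : b ∈ φ w) :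
    seg T a b ⊆ compNodes G Q φ c := by
  induction p generalizing a with
  | nil => exact fun x hx => ⟨_, hv, h.convex (hc hv) a ha b hb hx⟩
  | @cons v v' w hadj _ ih =>
    have hadj' : G.Adj v v' := hadj
    have hv' := mem_compSet_of_adj hv hadj' v'.2
    obtain ⟨z, hzv, hzv'⟩ := (h.adj_iff v (hc hv) v' (hc hv') hadj'.ne).1 hadj'
    exact (seg_subset_union a b z).trans (Set.union_subset
      (fun x hx => ⟨v, hv, h.convex (hc hv) a ha z hzv hx⟩) (ih hv' hzv' hb))

lemma IsPathRepOn.convex_compNodes {S : Set V} (h : IsPathRepOn G S T φ) {c : Comp G Q}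
    (hc : compSet G Q c ⊆ S) : SegConvex T (compNodes G Q φ c) := by
  rintro a ⟨v, hv, hav⟩ b ⟨w, hw, hbw⟩
  obtain ⟨_, hvc⟩ := mem_compSet.1 hv
  obtain ⟨_, hwc⟩ := mem_compSet.1 hw
  obtain ⟨p⟩ := SimpleGraph.ConnectedComponent.exact (hvc.trans hwc.symm)
  exact h.seg_subset_compNodes hc p hv hav hbw

lemma notMem_compNodes {q : W} {c : Comp G Q} (hq : ∀ v ∈ compSet G Q c, q ∈ φ v → v ∈ Q) :
    q ∉ compNodes G Q φ c := by
  rintro ⟨v, hv, hqv⟩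
  exact notMem_of_mem_compSet hv (hq v hv hqv)

lemma IsPathRepOn.eq_of_mem_compNodes {S : Set V} (h : IsPathRepOn G S T φ) {c d : Comp G Q}
    (hcS : compSet G Q c ⊆ S) (hdS : compSet G Q d ⊆ S) {x : W}
    (hc : x ∈ compNodes G Q φ c) (hd : x ∈ compNodes G Q φ d) : c = d := by
  obtain ⟨v, hv, hxv⟩ := hc
  obtain ⟨w, hw, hxw⟩ := hd
  by_cases hvw : v = w
  · subst hvw
    exact compSet_eq_of_mem hv hw
  · exact compSet_eq_of_mem (mem_compSet_of_adj hv
      (h.adj_of_mem (hcS hv) (hdS hw) hvw hxv hxw) (notMem_of_mem_compSet hw)) hw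

end PathRepresentations

/-! ### The coloring defined by a path representation -/

section GateSystems

variable {V W : Type u} {G : SimpleGraph V} {Q : Set V} {T : SimpleGraph W} {φ : V → Set W}
variable {q : W} {m : Comp G Q → W} {c d : Comp G Q} {x : V}

/-- A path representation of `G` with a node `q` of the clique `Q` and, for every component `c` of
`G - Q`, the node `m c` in which the nodes used by `c` are entered from `q`. -/
structure IsGateSystem (G : SimpleGraph V) (Q : Set V) (T : SimpleGraph W) (φ : V → Set W) (q : W)
    (m : Comp G Q → W) : Prop extends IsPathRepOn G Set.univ T φ where
  mem_iff : ∀ v, q ∈ φ v ↔ v ∈ Q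
  gate_mem : ∀ c, m c ∈ compNodes G Q φ c
  gate_mem_seg : ∀ c, ∀ u ∈ compNodes G Q φ c, m c ∈ seg T q u

lemma IsPathRepOn.exists_isGateSystem [Finite V] [Finite W] (h : IsPathRep G T φ)
    (hQ : IsMaxClique G Q) : ∃ q m, IsGateSystem G Q T φ q m := by
  obtain ⟨q, hq⟩ := h.exists_node hQ (Set.subset_univ _)
  have hgate (c : Comp G Q) : ∃ m ∈ compNodes G Q φ c, ∀ u ∈ compNodes G Q φ c, m ∈ seg T q u := by
    obtain ⟨v, hv⟩ := compSet_nonempty c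
    obtain ⟨x, hx⟩ := h.nonempty (Set.mem_univ v)
    exact exists_gate h.isTree (h.convex_compNodes (Set.subset_univ _)) ⟨x, v, hv, hx⟩ q
  choose m hm hmseg using hgate
  exact ⟨q, m, h, fun v => hq v trivial, hm, hmseg⟩

namespace IsGateSystem

lemma isClique (h : IsGateSystem G Q T φ q m) : G.IsClique Q := fun v hv w hw hne =>
  h.adj_of_mem trivial trivial hne ((h.mem_iff v).2 hv) ((h.mem_iff w).2 hw)

lemma notMem_compNodes (h : IsGateSystem G Q T φ q m) : q ∉ compNodes G Q φ c :=
  PathGraphs.notMem_compNodes fun v _ => (h.mem_iff v).1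

lemma gate_ne (h : IsGateSystem G Q T φ q m) (c : Comp G Q) : m c ≠ q :=
  fun he => h.notMem_compNodes (he ▸ h.gate_mem c)

lemma gate_mem_of_mem_nbr [Finite V] (h : IsGateSystem G Q T φ q m) (hx : x ∈ nbr G Q c) :
    m c ∈ φ x := by
  obtain ⟨hxQ, y, hy, hxy⟩ := (mem_nbr_iff h.isClique).1 hx
  obtain ⟨z, hzx, hzy⟩ := (h.adj_iff x trivial y trivial hxy.ne).1 hxy
  exact h.convex (Set.mem_univ x) q ((h.mem_iff x).2 hxQ) z hzx (h.gate_mem_seg c z ⟨y, hy, hzy⟩)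

lemma mem_seg_or_mem_seg_or_mem_seg (h : IsGateSystem G Q T φ q m) (hxQ : x ∈ Q) {y z : W}
    (hy : y ∈ φ x) (hz : z ∈ φ x) : y ∈ seg T q z ∨ z ∈ seg T q y ∨ q ∈ seg T y z := by
  obtain ⟨a, b, hab⟩ := h.exists_seg x trivial
  have hq := (h.mem_iff x).2 hxQ
  rw [hab] at hq hy hz
  exact PathGraphs.mem_seg_or_mem_seg_or_mem_seg h.isTree hq hy hz

lemma dominated_of_gate_mem_seg [Finite V] [Finite W] (h : IsGateSystem G Q T φ q m) (hne : c ≠ d)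
    (hxc : x ∈ nbr G Q c) (hxd : x ∈ nbr G Q d) (hbranch : q ∉ seg T (m c) (m d))
    (hle : m c ∈ seg T q (m d)) : Dominated G Q d c := by
  have hconv : SegConvex T (compNodes G Q φ c) := h.convex_compNodes (Set.subset_univ _)
  rw [dominated_iff_nbr]
  refine ⟨⟨x, hxd, hxc⟩, fun L hL => ?_⟩
  by_contra! ⟨hnsub, y, hy, hyL⟩
  obtain ⟨hLmax, -, v, hvL, hvc⟩ := (isRelevant_iff h.isClique).1 hL
  obtain ⟨l, hl⟩ := h.exists_node hLmax (Set.subset_univ _)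
  have hlc : l ∈ compNodes G Q φ c := ⟨v, hvc, (hl v trivial).2 hvL⟩
  rcases h.mem_seg_or_mem_seg_or_mem_seg hy.1 ((hl y trivial).2 hyL) (h.gate_mem_of_mem_nbr hy)
    with hlseg | hdseg | hqseg
  · exact hnsub fun z hz => (hl z trivial).1 (h.convex (Set.mem_univ z) q ((h.mem_iff z).2 hz.1) _
      (h.gate_mem_of_mem_nbr hz) hlseg)
  · have hdc : m d ∈ compNodes G Q φ c :=
      hconv _ (h.gate_mem c) _ hlc (mem_seg_of_mem_of_mem h.isTree hdseg hle)
    exact hne (h.eq_of_mem_compNodes (Set.subset_univ _) (Set.subset_univ _) hdc (h.gate_mem d))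
  · rcases seg_subset_union l (m d) (m c) hqseg with hqc | hqd
    · exact h.notMem_compNodes (hconv _ hlc _ (h.gate_mem c) hqc)
    · exact hbranch hqd

lemma isGoodColoring [Finite V] [Finite W] (h : IsGateSystem G Q T φ q m) :
    IsGoodColoring (attachednessGraph G Q) (nbr G Q) (fun c => branch T q (m c)) where
  ne_of_antip := by
    rintro c d ⟨hne, hatt, hcd, hdc⟩ hbranch
    obtain ⟨x, hxc, hxd⟩ := attached_iff_nbr.1 hatt
    have hq := (branch_eq_branch_iff (h.gate_ne c)).1 hbranch
    rcases h.mem_seg_or_mem_seg_or_mem_seg hxc.1 (h.gate_mem_of_mem_nbr hxc)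
      (h.gate_mem_of_mem_nbr hxd) with hle | hle | hqseg
    · exact hdc (h.dominated_of_gate_mem_seg hne hxc hxd hq hle)
    · exact hcd (h.dominated_of_gate_mem_seg hne.symm hxd hxc (seg_comm (m c) (m d) ▸ hq) hle)
    · exact hq hqseg
  two_colors := by
    intro x a b c ha hb hc
    obtain ⟨s, t, hst⟩ := h.exists_seg x trivial
    simp only [branch_eq_branch_iff (h.gate_ne _)]
    exact notMem_seg_or_notMem_seg h.isTree (hst ▸ h.gate_mem_of_mem_nbr ha)
      (hst ▸ h.gate_mem_of_mem_nbr hb) (hst ▸ h.gate_mem_of_mem_nbr hc)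
      (h.gate_ne a) (h.gate_ne b) (h.gate_ne c)

end IsGateSystem

lemma IsPathRepOn.hasGoodColoring [Finite V] [Finite W] (h : IsPathRep G T φ)
    (hQ : IsMaxClique G Q) : HasGoodColoring G Q := by
  obtain ⟨_, _, hm⟩ := h.exists_isGateSystem hQ
  exact ⟨_, _, hm.isGoodColoring⟩

end GateSystems

/-! ### Chordal graphs -/

/-- `s 0, …, s n` is an induced path of `G`; the values of `s` beyond `n` are irrelevant. -/
structure IsInducedPath {X : Type*} (G : SimpleGraph X) (n : ℕ) (s : ℕ → X) : Prop where
  injOn : Set.InjOn s (Set.Iic n)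
  adj_iff : ∀ i ≤ n, ∀ j ≤ n, (G.Adj (s i) (s j) ↔ j = i + 1 ∨ i = j + 1)

namespace IsInducedPath

variable {X : Type*} {G : SimpleGraph X} {n : ℕ} {s : ℕ → X}

lemma drop (hs : IsInducedPath G n s) {t : ℕ} (ht : t ≤ n) :
    IsInducedPath G (n - t) fun i => s (t + i) where
  injOn i hi j hj hij := by
    rw [Set.mem_Iic] at hi hj
    have := hs.injOn (show t + i ≤ n by lia) (show t + j ≤ n by lia) hij
    lia
  adj_iff i hi j hj := by
    rw [hs.adj_iff _ (by lia) _ (by lia)]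
    lia

lemma map {Y : Type*} {H : SimpleGraph Y} (hs : IsInducedPath G n s) (f : G ↪g H) :
    IsInducedPath H n fun i => f (s i) where
  injOn := f.injective.comp_injOn hs.injOn
  adj_iff i hi j hj := f.map_adj_iff.trans (hs.adj_iff i hi j hj)

lemma reachable (hs : IsInducedPath G n s) {i : ℕ} (hi : i ≤ n) : G.Reachable (s 0) (s i) := by
  induction i with
  | zero => rfl
  | succ i ih =>
    exact (ih (by lia)).trans ((hs.adj_iff i (by lia) (i + 1) hi).2 (Or.inl rfl)).reachable

lemma of_dist_eq (hdist : ∀ i ≤ n, G.dist (s 0) (s i) = i)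
    (hadj : ∀ i < n, G.Adj (s i) (s (i + 1))) : IsInducedPath G n s where
  injOn i hi j hj hij := by rw [← hdist i hi, ← hdist j hj, hij]
  adj_iff i hi j hj := by
    refine ⟨fun h => ?_, ?_⟩
    · have hd := h.diff_dist_adj (u := s 0)
      rw [hdist i hi, hdist j hj] at hd
      have hne : i ≠ j := by
        rintro rfl
        exact G.irrefl h
      lia
    · rintro (rfl | rfl)
      exacts [hadj i (by lia), (hadj j (by lia)).symm]

end IsInducedPath

lemma exists_isInducedPath {X : Type*} {G : SimpleGraph X} {v z : X} {Z : Set X} (hz : z ∈ Z)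
    (hvz : G.Reachable v z) :
    ∃ n s, IsInducedPath G n s ∧ s 0 = v ∧ s n ∈ Z ∧ ∀ i < n, s i ∉ Z := by
  obtain ⟨w, ⟨hwZ, hvw⟩, hmin⟩ :=
    exists_minimalFor_of_wellFoundedLT (fun w => w ∈ Z ∧ G.Reachable v w) (G.dist v) ⟨z, hz, hvz⟩
  obtain ⟨p, hp⟩ := hvw.exists_walk_length_eq_dist
  have hdist : ∀ i ≤ p.length, G.dist v (p.getVert i) = i := fun i hi => by
    rw [← SimpleGraph.length_eq_dist_of_subwalk hp (p.isSubwalk_take i), p.take_length,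
      min_eq_left hi]
  refine ⟨p.length, p.getVert, .of_dist_eq (by simpa using hdist) fun i => p.adj_getVert_succ,
    p.getVert_zero, by simpa using hwZ, fun i hi hiZ => ?_⟩
  have hle := hmin (j := p.getVert i) ⟨hiZ, (p.take i).reachable⟩
  rw [← hp, hdist i hi.le] at hle
  lia

namespace IsChordal

variable {V : Type u} {G : SimpleGraph V} {Q : Set V}

/-- Otherwise `s 0, …, s n, b, a` is an induced cycle. -/
lemma not_isInducedPath (hG : IsChordal G) {n : ℕ} (hn : 1 ≤ n) {s : ℕ → V} {a b : V}
    (hab : G.Adj a b) (ha : ∀ i ≤ n, s i ≠ a) (hb : ∀ i ≤ n, s i ≠ b)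
    (ha_adj : ∀ i ≤ n, (G.Adj a (s i) ↔ i = 0)) (hb_adj : ∀ i ≤ n, (G.Adj b (s i) ↔ i = n)) :
    ¬ IsInducedPath G n s := by
  intro hs
  let e : Fin (n + 3) → V := fun i => if i.val ≤ n then s i else if i.val = n + 1 then b else a
  have he : ∀ i j : Fin (n + 3), G.Adj (e i) (e j) ↔ CycAdj (n + 3) i j := by
    intro i j
    have hi := i.2
    have hj := j.2
    simp only [e]
    unfold CycAdj
    split_ifs with h1 h2 h3 h4 h5 h6 h7 h8
    · rw [hs.adj_iff _ h1 _ h2]; lia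
    · rw [G.adj_comm, hb_adj _ h1]; lia
    · rw [G.adj_comm, ha_adj _ h1]; lia
    · rw [hb_adj _ h5]; lia
    · simp only [SimpleGraph.irrefl, false_iff]; lia
    · exact iff_of_true hab.symm (by lia)
    · rw [ha_adj _ h7]; lia
    · exact iff_of_true hab (by lia)
    · simp only [SimpleGraph.irrefl, false_iff]; lia
  have hinj : Function.Injective e := by
    intro i j hij
    have hi := i.2
    have hj := j.2
    simp only [e] at hij
    apply Fin.ext
    split_ifs at hij with h1 h2 h3 h4 h5 h6 h7 h8
    exacts [hs.injOn h1 h2 hij, absurd hij (hb _ h1), absurd hij (ha _ h1),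
      absurd hij.symm (hb _ h5), by lia, absurd hij.symm hab.ne, absurd hij.symm (ha _ h7),
      absurd hij hab.ne, by lia]
  refine (hG (n + 3) (by lia)).false ⟨⟨e, hinj⟩, ?_⟩
  intro i j
  rw [cycleGraph_adj_iff_cycAdj (by lia)]
  exact he i j

lemma adj_of_isInducedPath (hG : IsChordal G) {n : ℕ} {s : ℕ → V} (hs : IsInducedPath G n s)
    {a b : V} (hab : G.Adj a b) (ha : ∀ i ≤ n, s i ≠ a) (hb : ∀ i ≤ n, s i ≠ b)
    (hb_adj : ∀ i ≤ n, (G.Adj b (s i) ↔ i = n)) (ha_adj : ∃ i ≤ n, G.Adj a (s i)) :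
    G.Adj a (s n) := by
  by_contra hn
  obtain ⟨t, ⟨htn, hat⟩, hmax⟩ := Set.exists_max_image {i | i ≤ n ∧ G.Adj a (s i)} id
    ((Set.finite_Iic n).subset fun i hi => hi.1) ha_adj
  have hlt : t < n := lt_of_le_of_ne htn (by rintro rfl; exact hn hat)
  refine hG.not_isInducedPath (n := n - t) (by lia) hab (fun i hi => ha _ (by lia))
    (fun i hi => hb _ (by lia)) (fun i hi => ⟨fun h => ?_, ?_⟩) (fun i hi => ?_) (hs.drop htn)
  · have := hmax (t + i) ⟨by lia, h⟩
    simp only [id] at this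
    lia
  · rintro rfl
    exact hat
  · rw [hb_adj _ (by lia)]
    lia

lemma exists_adj_of_adj (hG : IsChordal G) (hQ : G.IsClique Q) {c : Comp G Q} {v b y : V}
    (hv : v ∈ compSet G Q c) (hb : b ∈ Q) (hy : y ∈ compSet G Q c) (hby : G.Adj b y) :
    ∃ w ∈ compSet G Q c, G.Adj b w ∧ ∀ a ∈ Q, G.Adj a v → G.Adj a w := by
  obtain ⟨hvQ, hvc⟩ := mem_compSet.1 hv
  obtain ⟨hyQ, hyc⟩ := mem_compSet.1 hy
  obtain ⟨n, s, hs, hs0, hsn, hlt⟩ := exists_isInducedPath (v := ⟨v, hvQ⟩) (z := ⟨y, hyQ⟩)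
    (Z := {z : ↥Qᶜ | G.Adj b z}) hby (SimpleGraph.ConnectedComponent.exact (hvc.trans hyc.symm))
  have hsQ : ∀ x ∈ Q, ∀ i ≤ n, (s i).1 ≠ x := fun x hx i _ he => (s i).2 (he ▸ hx)
  refine ⟨s n, mem_compSet.2 ⟨(s n).2, ?_⟩, hsn, fun a ha hav => ?_⟩
  · rw [← hvc, ← hs0]
    exact (SimpleGraph.ConnectedComponent.sound (hs.reachable le_rfl)).symm
  by_cases hab : a = b
  · exact hab ▸ hsn
  refine hG.adj_of_isInducedPath (hs.map (SimpleGraph.Embedding.induce Qᶜ)) (hQ ha hb hab)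
    (hsQ a ha) (hsQ b hb) (fun i hi => ⟨fun h => ?_, ?_⟩) ⟨0, n.zero_le, ?_⟩
  · exact hi.eq_of_not_lt fun hin => hlt i hin h
  · rintro rfl
    exact hsn
  · rw [hs0]
    exact hav

lemma exists_mem_compSet_adj_of_adj [Finite V] (hG : IsChordal G) (hQ : G.IsClique Q)
    (c : Comp G Q) :
    ∃ v ∈ compSet G Q c, ∀ x ∈ Q, ∀ y ∈ compSet G Q c, G.Adj x y → G.Adj x v := by
  obtain ⟨v, hv, hmax⟩ := Set.exists_max_image (compSet G Q c)
    (fun v => {x | x ∈ Q ∧ G.Adj x v}.ncard) (Set.toFinite _) (compSet_nonempty c)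
  refine ⟨v, hv, fun b hb y hy hby => by_contra fun hbv => ?_⟩
  obtain ⟨w, hw, hbw, hvw⟩ := hG.exists_adj_of_adj hQ hv hb hy hby
  refine (hmax w hw).not_gt (Set.ncard_lt_ncard ?_ (Set.toFinite _))
  refine ⟨fun x hx => ⟨hx.1, hvw x hx.1 hx.2⟩, fun hsub => hbv ?_⟩
  exact (hsub (show b ∈ {x | x ∈ Q ∧ G.Adj x w} from ⟨hb, hbw⟩)).2

end IsChordal

section TwoCliques

variable {V : Type u} {G : SimpleGraph V} {K L : Set V}

lemma subsingleton_comp_of_not_isCliqueSeparator (hK : IsMaxClique G K)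
    (h : ¬ IsCliqueSeparator G K) : Subsingleton (Comp G K) :=
  not_nontrivial_iff_subsingleton.1 fun hnt => h ⟨hK, hnt⟩

lemma exists_adj_of_subsingleton_comp [Subsingleton (Comp G L)] {S : Set V} {x y : V}
    (hxL : x ∉ L) (hx : x ∈ S) (hyL : y ∉ L) (hy : y ∉ S) : ∃ a ∈ S \ L, ∃ b ∉ S, G.Adj a b := by
  obtain ⟨p⟩ : (G.induce Lᶜ).Reachable ⟨x, hxL⟩ ⟨y, hyL⟩ :=
    SimpleGraph.ConnectedComponent.exact (Subsingleton.elim _ _)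
  obtain ⟨d, -, hfst, hsnd⟩ := p.exists_boundary_dart (Subtype.val ⁻¹' S) hx hy
  exact ⟨_, ⟨hfst, d.fst.2⟩, _, hsnd, d.adj⟩

lemma IsChordal.exists_two_cliques [Finite V] (hG : IsChordal G)
    (hno : ∀ Q, ¬ IsCliqueSeparator G Q) :
    ∃ K L : Set V, G.IsClique K ∧ G.IsClique L ∧ K ∪ L = Set.univ ∧
      ∀ x ∈ K, x ∉ L → ∀ y ∉ K, ¬ G.Adj x y := by
  obtain ⟨K, -, hK⟩ := exists_isMaxClique_superset (G := G) (K := ∅) (by simp)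
  have hKc : G.IsClique K := hK.prop.1
  by_cases hU : K = Set.univ
  · exact ⟨K, K, hKc, hKc, by rw [Set.union_self, hU], fun x hx hx' => absurd hx hx'⟩
  have := subsingleton_comp_of_not_isCliqueSeparator hK (hno K)
  obtain ⟨z, hz⟩ := (Set.ne_univ_iff_exists_notMem K).1 hU
  obtain ⟨v, hv, hprin⟩ :=
    hG.exists_mem_compSet_adj_of_adj hKc ((G.induce Kᶜ).connectedComponentMk ⟨z, hz⟩)
  obtain ⟨L, hL, hLmax⟩ := exists_isMaxClique_superset (G := G)
    (K := insert v {x | x ∈ K ∧ G.Adj x v}) <| by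
      rw [SimpleGraph.isClique_insert]
      exact ⟨hKc.subset fun x hx => hx.1, fun x hx _ => hx.2.symm⟩
  have hout : ∀ x ∈ K, x ∉ L → ∀ y ∉ K, ¬ G.Adj x y := fun x hx hxL y hy hxy =>
    hxL (hL (Or.inr ⟨hx, hprin x hx y (mem_compSet.2 ⟨hy, Subsingleton.elim _ _⟩) hxy⟩))
  refine ⟨K, L, hKc, hLmax.prop.1, Set.eq_univ_iff_forall.2 fun y => ?_, hout⟩
  by_contra! hy
  obtain ⟨hyK, hyL⟩ := not_or.1 hy
  obtain ⟨x, hxK, hxL⟩ : ∃ x ∈ K, x ∉ L := Set.not_subset.1 fun hKL =>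
    notMem_of_mem_compSet hv (hK.eq_of_subset hLmax.prop.1 hKL ▸ hL (Or.inl rfl))
  have := subsingleton_comp_of_not_isCliqueSeparator hLmax (hno L)
  obtain ⟨a, ha, b, hb, hab⟩ := exists_adj_of_subsingleton_comp (G := G) hxL hxK hyL hyK
  exact hout a ha.1 ha.2 b hb hab

/-- The graph has a representation by paths of a finite tree. -/
def HasPathRep (G : SimpleGraph V) : Prop :=
  ∃ (W : Type u) (_ : Finite W) (T : SimpleGraph W) (φ : V → Set W), IsPathRep G T φ

lemma hasPathRep_of_two_cliques (hK : G.IsClique K) (hL : G.IsClique L) (hKL : K ∪ L = Set.univ)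
    (hno : ∀ x ∈ K, x ∉ L → ∀ y ∉ K, ¬ G.Adj x y) : HasPathRep G := by
  classical
  have hT : (⊥ : SimpleGraph PUnit.{u + 1}).IsTree := SimpleGraph.IsTree.of_subsingleton
  let T := join (⊥ : SimpleGraph PUnit.{u + 1}) (⊥ : SimpleGraph PUnit.{u + 1}) ⟨⟩ ⟨⟩
  let l : PUnit.{u + 1} ⊕ PUnit.{u + 1} := Sum.inl ⟨⟩
  let r : PUnit.{u + 1} ⊕ PUnit.{u + 1} := Sum.inr ⟨⟩
  let φ : V → Set (PUnit.{u + 1} ⊕ PUnit.{u + 1}) := fun x =>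
    seg T (if x ∈ K then l else r) (if x ∈ L then r else l)
  have hmem : ∀ x, x ∈ K ∨ x ∈ L := Set.eq_univ_iff_forall.1 hKL
  have hl : ∀ x, l ∈ φ x ↔ x ∈ K := by
    intro x
    by_cases hx : x ∈ K
    · simp only [φ, hx, if_true, left_mem_seg]
    · simp only [φ, hx, (hmem x).resolve_left hx, if_true, if_false, seg_self, iff_false]
      exact Sum.inl_ne_inr
  have hr : ∀ x, r ∈ φ x ↔ x ∈ L := by
    intro x
    by_cases hx : x ∈ L
    · simp only [φ, hx, if_true, right_mem_seg]
    · simp only [φ, hx, (hmem x).resolve_right hx, if_true, if_false, seg_self, iff_false]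
      exact Sum.inr_ne_inl
  refine ⟨_, inferInstance, T, φ, isTree_join hT hT, fun x _ => ⟨_, _, rfl⟩, ?_⟩
  rintro x - y - hxy
  constructor
  · intro hadj
    by_cases hxK : x ∈ K <;> by_cases hyK : y ∈ K
    · exact ⟨l, (hl x).2 hxK, (hl y).2 hyK⟩
    · exact ⟨r, (hr x).2 (by_contra fun hxL => hno x hxK hxL y hyK hadj),
        (hr y).2 ((hmem y).resolve_left hyK)⟩
    · exact ⟨r, (hr x).2 ((hmem x).resolve_left hxK),
        (hr y).2 (by_contra fun hyL => hno y hyK hyL x hxK hadj.symm)⟩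
    · exact ⟨r, (hr x).2 ((hmem x).resolve_left hxK), (hr y).2 ((hmem y).resolve_left hyK)⟩
  · rintro ⟨w | w, hx, hy⟩
    · exact hK ((hl x).1 hx) ((hl y).1 hy) hxy
    · exact hL ((hr x).1 hx) ((hr y).1 hy) hxy

end TwoCliques

/-! ### Attachedness graphs along graph embeddings -/

section ComponentMap

variable {V V' : Type u} {G : SimpleGraph V} {G' : SimpleGraph V'} {Q : Set V}

/-- The map on components of complements of `Q` induced by a graph embedding. -/
def compMap (e : G ↪g G') (Q : Set V) : Comp G Q → Comp G' (e '' Q) :=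
  SimpleGraph.ConnectedComponent.map
    { toFun := fun x => ⟨e x.1, fun ⟨_, hy, hyx⟩ => x.2 (e.injective hyx ▸ hy)⟩
      map_rel' := fun {_ _} h => e.map_adj_iff.2 h }

lemma mem_compSet_compMap (e : G ↪g G') {c : Comp G Q} {x : V} (hx : x ∈ compSet G Q c) :
    e x ∈ compSet G' (e '' Q) (compMap e Q c) := by
  obtain ⟨h, rfl⟩ := mem_compSet.1 hx
  exact mem_compSet.2 ⟨fun ⟨_, hy, hyx⟩ => h (e.injective hyx ▸ hy), rfl⟩

lemma compMap_injective (e : G ↪g G')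
    (h : ∀ (c : Comp G Q) (x : V), e x ∈ compSet G' (e '' Q) (compMap e Q c) → x ∈ compSet G Q c) :
    Function.Injective (compMap e Q) := by
  intro c d hcd
  obtain ⟨x, hx⟩ := compSet_nonempty c
  exact compSet_eq_of_mem hx (h d x (hcd ▸ mem_compSet_compMap e hx))

end ComponentMap

section RelevantImages

variable {V V' : Type u} {G : SimpleGraph V} {G' : SimpleGraph V'} {Q : Set V} (e : G ↪g G')
  (F : Comp G Q → Comp G' (e '' Q))

lemma mem_nbr_of_isRelevant_image
    (hF : ∀ c K, IsRelevant G Q c K → IsRelevant G' (e '' Q) (F c) (e '' K))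
    {c : Comp G Q} {x : V} (hx : x ∈ nbr G Q c) : e x ∈ nbr G' (e '' Q) (F c) := by
  obtain ⟨hxQ, K, hK, hxK⟩ := hx
  exact ⟨⟨x, hxQ, rfl⟩, _, hF c K hK, x, hxK, rfl⟩

lemma Dominated.of_isRelevant_image
    (hF : ∀ c K, IsRelevant G Q c K → IsRelevant G' (e '' Q) (F c) (e '' K))
    {c d : Comp G Q} (hatt : Attached G Q c d) (h : Dominated G' (e '' Q) (F c) (F d)) :
    Dominated G Q c d := by
  rw [attached_iff_nbr] at hatt
  rw [dominated_iff_nbr] at h ⊢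
  refine ⟨hatt, fun L hL => ?_⟩
  rcases h.2 _ (hF d L hL) with h1 | h1
  · left
    intro x hx
    obtain ⟨y, hy, hyx⟩ := h1 (mem_nbr_of_isRelevant_image e F hF hx)
    exact e.injective hyx ▸ hy
  · right
    rw [Set.eq_empty_iff_forall_notMem] at h1 ⊢
    rintro x ⟨hx, hxL⟩
    exact h1 _ ⟨mem_nbr_of_isRelevant_image e F hF hx, x, hxL, rfl⟩

lemma antip_adj_of_isRelevant_image (hinj : Function.Injective F)
    (hF : ∀ c K, IsRelevant G Q c K → IsRelevant G' (e '' Q) (F c) (e '' K))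
    {c d : Comp G Q} (h : (attachednessGraph G Q).antip.Adj c d) :
    (attachednessGraph G' (e '' Q)).antip.Adj (F c) (F d) := by
  obtain ⟨hne, hatt, h1, h2⟩ := h
  refine ⟨hinj.ne hne, ?_, fun h => h1 (h.of_isRelevant_image e F hF hatt),
    fun h => h2 (h.of_isRelevant_image e F hF hatt.symm)⟩
  rw [attached_iff_nbr] at hatt ⊢
  obtain ⟨x, hxc, hxd⟩ := hatt
  exact ⟨e x, mem_nbr_of_isRelevant_image e F hF hxc, mem_nbr_of_isRelevant_image e F hF hxd⟩

lemma HasGoodColoring.of_isRelevant_image (hinj : Function.Injective F)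
    (hF : ∀ c K, IsRelevant G Q c K → IsRelevant G' (e '' Q) (F c) (e '' K))
    (h : HasGoodColoring G' (e '' Q)) : HasGoodColoring G Q := by
  obtain ⟨C, f, hf⟩ := h
  exact ⟨C, f ∘ F, fun hcd => hf.ne_of_antip (antip_adj_of_isRelevant_image e F hinj hF hcd),
    fun hc hd hd' => hf.two_colors (mem_nbr_of_isRelevant_image e F hF hc)
      (mem_nbr_of_isRelevant_image e F hF hd) (mem_nbr_of_isRelevant_image e F hF hd')⟩

end RelevantImages

/-! ### Heredity -/

section Heredity

variable {V : Type u} {G : SimpleGraph V} {Q : Set V}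

lemma IsChordal.induce (h : IsChordal G) (S : Set V) : IsChordal (G.induce S) := by
  intro n hn
  exact ⟨fun e => (h n hn).false (e.trans (SimpleGraph.Embedding.induce S))⟩

lemma isMaxClique_image_of_induce (hQ : IsMaxClique G Q) (c : Comp G Q)
    {K : Set (piece G Q c)} (hK : IsMaxClique (G.induce (piece G Q c)) K) :
    IsMaxClique G (Subtype.val '' K) := by
  have hKc : G.IsClique (Subtype.val '' K) := by
    rintro _ ⟨x, hx, rfl⟩ _ ⟨y, hy, rfl⟩ hne
    exact hK.prop.1 hx hy (fun h => hne (congrArg _ h))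
  refine ⟨⟨hKc, Set.subset_univ _⟩, ?_⟩
  rintro L ⟨hL, -⟩ hKL z hz
  have hin : ∀ z ∈ L, z ∈ piece G Q c → z ∈ Subtype.val '' K := by
    intro z hz hzS
    refine ⟨⟨z, hzS⟩, hK.mem_of_forall ?_, rfl⟩
    intro y hy hne
    exact hL hz (hKL ⟨y, hy, rfl⟩) (fun h => hne (Subtype.ext h.symm))
  by_cases hzS : z ∈ piece G Q c
  · exact hin z hz hzS
  exfalso
  have hKQ : Subtype.val '' K ⊆ Q := by
    rintro _ ⟨y, hy, rfl⟩
    by_contra hyQ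
    have hyc : y.1 ∈ compSet G Q c := y.2.resolve_right hyQ
    have hyz : y.1 ≠ z := fun h => hzS (h ▸ y.2)
    refine hzS (Or.inl (mem_compSet_of_adj hyc (hL (hKL ⟨y, hy, rfl⟩) hz hyz) ?_))
    exact fun h => hzS (Or.inr h)
  have hQK : Q ⊆ Subtype.val '' K := by
    intro q hq
    refine ⟨⟨q, Or.inr hq⟩, hK.mem_of_forall ?_, rfl⟩
    intro y hy hne
    exact hQ.prop.1 hq (hKQ ⟨y, hy, rfl⟩) (fun h => hne (Subtype.ext h.symm))
  exact hzS (Or.inr (hQ.le_of_ge ⟨hL, Set.subset_univ _⟩ (hQK.trans hKL) hz))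

/-- A walk can leave a member of `Γ_Q` only through the clique `Q`, so it can be shortened to a walk
inside this member. -/
lemma mem_compSet_of_mem_compSet_compMap_induce (hQ : G.IsClique Q) (c : Comp G Q)
    {Q' : Set (piece G Q c)} (d : Comp (G.induce (piece G Q c)) Q') (x : piece G Q c)
    (hx : x.1 ∈ compSet G (Subtype.val '' Q') (compMap (SimpleGraph.Embedding.induce _) Q' d)) :
    x ∈ compSet (G.induce (piece G Q c)) Q' d := by
  let D := compSet (G.induce (piece G Q c)) Q' d
  have hout {y z : V} (hy : y ∈ piece G Q c) (hz : z ∉ piece G Q c) (hyz : G.Adj y z) : y ∈ Q :=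
    hy.resolve_left fun hyc => hz (Or.inl (mem_compSet_of_adj hyc hyz fun h => hz (Or.inr h)))
  have hD {y z : piece G Q c} (hy : y ∈ D) (hyQ : y.1 ∈ Q) (hz : z ∉ Q') (hzQ : z.1 ∈ Q) :
      z ∈ D := by
    by_cases hyz : y = z
    · exact hyz ▸ hy
    · exact mem_compSet_of_adj hy (hQ hyQ hzQ fun h => hyz (Subtype.ext h)) hz
  let S : Set V := {y | (∀ hy : y ∈ piece G Q c, ⟨y, hy⟩ ∈ D) ∧
    (y ∉ piece G Q c → ∀ z : piece G Q c, z ∉ Q' → z.1 ∈ Q → z ∈ D)}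
  have hS : ∀ y ∈ S, ∀ z, G.Adj y z → z ∉ Subtype.val '' Q' → z ∈ S := by
    rintro y ⟨hyin, hyout⟩ z hyz hz
    by_cases hy : y ∈ piece G Q c
    · exact ⟨fun hz' => mem_compSet_of_adj (hyin hy) hyz fun h => hz ⟨_, h, rfl⟩,
        fun hz' w hw => hD (hyin hy) (hout hy hz' hyz) hw⟩
    · exact ⟨fun hz' => hyout hy _ (fun h => hz ⟨_, h, rfl⟩) (hout hz' hy hyz.symm),
        fun _ => hyout hy⟩
  obtain ⟨y, hy⟩ := compSet_nonempty d
  exact (compSet_subset_of_adj hS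
    (mem_compSet_compMap (SimpleGraph.Embedding.induce (piece G Q c)) hy)
    ⟨fun _ => hy, fun h => absurd y.2 h⟩ hx).1 x.2

lemma HasGoodColoring.induce_piece (hQ : IsMaxClique G Q) (c : Comp G Q)
    {Q' : Set (piece G Q c)} (hQ' : IsMaxClique (G.induce (piece G Q c)) Q')
    (h : HasGoodColoring G (Subtype.val '' Q')) :
    HasGoodColoring (G.induce (piece G Q c)) Q' := by
  let e : G.induce (piece G Q c) ↪g G := SimpleGraph.Embedding.induce (piece G Q c)
  refine HasGoodColoring.of_isRelevant_image e (compMap e Q')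
    (compMap_injective e (mem_compSet_of_mem_compSet_compMap_induce hQ.prop.1 c)) ?_ h
  intro d K hK
  obtain ⟨hK, ⟨x, hxK, hxQ⟩, y, hyK, hyd⟩ := (isRelevant_iff hQ'.prop.1).1 hK
  exact (isRelevant_iff (isMaxClique_image_of_induce hQ c hQ').prop.1).2
    ⟨isMaxClique_image_of_induce hQ c hK, ⟨x, ⟨x, hxK, rfl⟩, x, hxQ, rfl⟩,
      y, ⟨y, hyK, rfl⟩, mem_compSet_compMap e hyd⟩

lemma HasPathRep.exists_isPathRepOn {S : Set V} (h : HasPathRep (G.induce S)) :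
    ∃ (W : Type u) (_ : Finite W) (T : SimpleGraph W) (φ : V → Set W), IsPathRepOn G S T φ := by
  obtain ⟨W, hW, T, φ, hφ⟩ := h
  have key : ∀ (v : V) (hv : v ∈ S), {w | ∃ h : v ∈ S, w ∈ φ ⟨v, h⟩} = φ ⟨v, hv⟩ := by
    intro v hv
    ext w
    exact ⟨fun ⟨_, h⟩ => h, fun h => ⟨hv, h⟩⟩
  refine ⟨W, hW, T, fun v => {w | ∃ h : v ∈ S, w ∈ φ ⟨v, h⟩}, hφ.isTree, ?_, ?_⟩
  · intro v hv
    rw [key v hv]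
    exact hφ.exists_seg _ trivial
  · intro v hv w hw hne
    rw [key v hv, key w hw]
    exact hφ.adj_iff ⟨v, hv⟩ trivial ⟨w, hw⟩ trivial (fun h => hne (congrArg Subtype.val h))

end Heredity

/-! ### Rooted representations of the members of `Γ_Q` -/

section RootedRepresentations

variable {V W : Type u} {G : SimpleGraph V} {Q L : Set V} {c : Comp G Q} {T : SimpleGraph W}
  {φ : V → Set W} {q a w : W} {x y v : V}

/-- A representation of `γ_c` with root `r`: the vertices of the component are represented by the
paths `ψ v`, a vertex `x` of `Q` is represented by the path from `r` to `e x`, and `e x` depends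
only on the relevant cliques containing `x`. -/
structure IsRootedRep (G : SimpleGraph V) (Q : Set V) (c : Comp G Q) (T : SimpleGraph W) (r : W)
    (ψ : V → Set W) (e : V → W) : Prop where
  isTree : T.IsTree
  exists_seg : ∀ v ∈ compSet G Q c, ∃ a b, ψ v = seg T a b
  adj_iff : ∀ v ∈ compSet G Q c, ∀ w ∈ compSet G Q c, v ≠ w →
    (G.Adj v w ↔ (ψ v ∩ ψ w).Nonempty)
  arm : ∀ x ∈ nbr G Q c, ∀ v ∈ compSet G Q c, (G.Adj x v ↔ (seg T r (e x) ∩ ψ v).Nonempty)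
  end_eq : ∀ x ∈ nbr G Q c, ∀ y ∈ nbr G Q c, (∀ L, IsRelevant G Q c L → (x ∈ L ↔ y ∈ L)) →
    e x = e y

/-- The nodes of `φ x` that represent relevant cliques of `γ_c`. -/
def relevantNodes (G : SimpleGraph V) (Q : Set V) (c : Comp G Q) (φ : V → Set W) (x : V) : Set W :=
  {w | w ∈ φ x ∧ ∃ L, IsRelevant G Q c L ∧ ∀ v ∈ piece G Q c, (w ∈ φ v ↔ v ∈ L)}

lemma relevantNodes_subset_compNodes (hQ : G.IsClique Q) :
    relevantNodes G Q c φ x ⊆ compNodes G Q φ c := by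
  rintro w ⟨-, L, hL, hw⟩
  obtain ⟨-, -, v, hvL, hvc⟩ := (isRelevant_iff hQ).1 hL
  exact ⟨v, hvc, (hw v (Or.inl hvc)).2 hvL⟩

lemma relevantNodes_subset_relevantNodes (hx : x ∈ Q) (hy : y ∈ Q)
    (hxy : ∀ L, IsRelevant G Q c L → (x ∈ L ↔ y ∈ L)) :
    relevantNodes G Q c φ x ⊆ relevantNodes G Q c φ y := by
  rintro w ⟨hwx, L, hL, hw⟩
  exact ⟨(hw y (Or.inr hy)).2 ((hxy L hL).1 ((hw x (Or.inr hx)).1 hwx)), L, hL, hw⟩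

lemma relevantNodes_eq (hx : x ∈ Q) (hy : y ∈ Q)
    (hxy : ∀ L, IsRelevant G Q c L → (x ∈ L ↔ y ∈ L)) :
    relevantNodes G Q c φ x = relevantNodes G Q c φ y :=
  (relevantNodes_subset_relevantNodes hx hy hxy).antisymm
    (relevantNodes_subset_relevantNodes hy hx fun L hL => (hxy L hL).symm)

namespace IsPathRepOn

lemma exists_mem_relevantNodes [Finite V] [Finite W] (h : IsPathRepOn G (piece G Q c) T φ)
    (hQ : G.IsClique Q) (hx : x ∈ Q) (hL : IsRelevant G Q c L) (hxL : x ∈ L) :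
    ∃ w ∈ relevantNodes G Q c φ x, ∀ v ∈ piece G Q c, (w ∈ φ v ↔ v ∈ L) := by
  obtain ⟨w, hw⟩ := h.exists_node ((isRelevant_iff hQ).1 hL).1 hL.1.prop.2
  exact ⟨w, ⟨(hw x (Or.inr hx)).2 hxL, L, hL, hw⟩, hw⟩

/-- Seen from `q`, the relevant nodes of `x` lie on one side of the path `φ x`, since the nodes used
by the component form a subtree avoiding `q`. -/
lemma exists_relevantNodes_subset_seg [Finite V] [Finite W] (h : IsPathRepOn G (piece G Q c) T φ)
    (hQ : G.IsClique Q) (hq : ∀ v ∈ piece G Q c, (q ∈ φ v ↔ v ∈ Q)) (hx : x ∈ nbr G Q c) :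
    ∃ w ∈ relevantNodes G Q c φ x, relevantNodes G Q c φ x ⊆ seg T q w := by
  obtain ⟨hxQ, L, hL, hxL⟩ := hx
  obtain ⟨w₀, hw₀, -⟩ := h.exists_mem_relevantNodes hQ hxQ hL hxL
  obtain ⟨w, hw, hmax⟩ := Set.exists_max_image (relevantNodes G Q c φ x)
    (fun w => (seg T q w).ncard) (Set.toFinite _) ⟨w₀, hw₀⟩
  have hqc : q ∉ compNodes G Q φ c := notMem_compNodes fun v hv => (hq v (Or.inl hv)).1
  obtain ⟨s, t, hst⟩ := h.exists_seg x (Or.inr hxQ)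
  refine ⟨w, hw, fun z hz => ?_⟩
  have hqx := (hq x (Or.inr hxQ)).2 hxQ
  rcases mem_seg_or_mem_seg_or_mem_seg h.isTree (hst ▸ hqx) (hst ▸ hz.1) (hst ▸ hw.1)
    with hzw | hwz | hqzw
  · exact hzw
  · have hsub : seg T q w ⊆ seg T q z := seg_subset_seg (left_mem_seg _ _) hwz
    rw [Set.eq_of_subset_of_ncard_le hsub (hmax z hz)]
    exact right_mem_seg _ _
  · exact absurd (h.convex_compNodes Set.subset_union_left _ (relevantNodes_subset_compNodes hQ hz)
      _ (relevantNodes_subset_compNodes hQ hw) hqzw) hqc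

lemma adj_iff_seg_inter_nonempty [Finite V] [Finite W] (h : IsPathRepOn G (piece G Q c) T φ)
    (hQ : G.IsClique Q) (hq : ∀ v ∈ piece G Q c, (q ∈ φ v ↔ v ∈ Q)) (hx : x ∈ Q)
    (ha : a ∈ relevantNodes G Q c φ x) (hsub : relevantNodes G Q c φ x ⊆ seg T q a)
    (hv : v ∈ compSet G Q c) : G.Adj x v ↔ (seg T q a ∩ φ v).Nonempty := by
  constructor
  · intro hadj
    obtain ⟨L, hLs, hL⟩ := exists_isMaxClique_superset (G := G) (K := {x, v}) (by
      rw [SimpleGraph.isClique_pair]; exact fun _ => hadj)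
    have hxL : x ∈ L := hLs (Set.mem_insert _ _)
    have hvL : v ∈ L := hLs (Set.mem_insert_of_mem _ rfl)
    have hLr : IsRelevant G Q c L := (isRelevant_iff hQ).2 ⟨hL, ⟨x, hxL, hx⟩, v, hvL, hv⟩
    obtain ⟨w, hwN, hw⟩ := h.exists_mem_relevantNodes hQ hx hLr hxL
    exact ⟨w, hsub hwN, (hw v (Or.inl hv)).2 hvL⟩
  · rintro ⟨w, hw, hwv⟩
    have hxv : x ≠ v := fun h => notMem_of_mem_compSet hv (h ▸ hx)
    exact h.adj_of_mem (Or.inr hx) (Or.inl hv) hxv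
      (h.convex (Or.inr hx) q ((hq x (Or.inr hx)).2 hx) a ha.1 hw) hwv

lemma exists_isRootedRep [Finite V] [Finite W] (h : IsPathRepOn G (piece G Q c) T φ)
    (hQ : IsMaxClique G Q) : ∃ r e, IsRootedRep G Q c T r φ e := by
  obtain ⟨q, hq⟩ := h.exists_node hQ Set.subset_union_right
  have : Nonempty W := ⟨q⟩
  let farthest (A : Set W) : W := Classical.epsilon fun w => w ∈ A ∧ A ⊆ seg T q w
  have hfarthest {x : V} (hx : x ∈ nbr G Q c) :=
    Classical.epsilon_spec (h.exists_relevantNodes_subset_seg hQ.prop.1 hq hx)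
  exact ⟨q, fun x => farthest (relevantNodes G Q c φ x), h.isTree,
    fun v hv => h.exists_seg v (Or.inl hv),
    fun v hv w hw => h.adj_iff v (Or.inl hv) w (Or.inl hw),
    fun x hx v hv => h.adj_iff_seg_inter_nonempty hQ.prop.1 hq hx.1 (hfarthest hx).1
      (hfarthest hx).2 hv,
    fun x hx y hy hxy => congrArg farthest (relevantNodes_eq hx.1 hy.1 hxy)⟩

end IsPathRepOn

end RootedRepresentations

/-! ### Gluing rooted representations -/

section Gluing

variable {V W W' C : Type u} {G : SimpleGraph V} {Q : Set V} {f : Comp G Q → C}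
  {T' : SimpleGraph W'} {T : SimpleGraph W}

/-- A representation of the subgraph of `G` induced by `Q` and the components in `S`. A vertex `x`
of `Q` is represented by the union of the paths from the root `r` to `e x k`, one for every color
`k`; paths of distinct colors meet only in `r`, and `e x k` depends only on the relevant cliques of
color `k` containing `x`. -/
structure IsGlued (G : SimpleGraph V) (Q : Set V) (f : Comp G Q → C) (S : Set (Comp G Q))
    (T : SimpleGraph W) (r : W) (ψ : V → Set W) (e : V → C → W) : Prop where
  isTree : T.IsTree
  exists_seg : ∀ c ∈ S, ∀ v ∈ compSet G Q c, ∃ a b, ψ v = seg T a b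
  adj_iff : ∀ c ∈ S, ∀ d ∈ S, ∀ v ∈ compSet G Q c, ∀ w ∈ compSet G Q d, v ≠ w →
    (G.Adj v w ↔ (ψ v ∩ ψ w).Nonempty)
  arm : ∀ x ∈ Q, ∀ c ∈ S, ∀ v ∈ compSet G Q c,
    (G.Adj x v ↔ ∃ k, (seg T r (e x k) ∩ ψ v).Nonempty)
  root : ∀ x ∈ Q, ∀ k, (∀ c ∈ S, f c = k → x ∉ nbr G Q c) → e x k = r
  end_eq : ∀ x ∈ Q, ∀ y ∈ Q, ∀ k,
    (∀ c ∈ S, f c = k → ∀ L, IsRelevant G Q c L → (x ∈ L ↔ y ∈ L)) → e x k = e y k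
  inter_subset : ∀ x ∈ Q, ∀ y ∈ Q, ∀ k l, k ≠ l → seg T r (e x k) ∩ seg T r (e y l) ⊆ {r}

lemma isGlued_empty : IsGlued G Q f ∅ (⊥ : SimpleGraph PUnit.{u + 1}) PUnit.unit (fun _ => ∅)
    (fun _ _ => PUnit.unit) where
  isTree := SimpleGraph.IsTree.of_subsingleton
  exists_seg _ h := h.elim
  adj_iff _ h := h.elim
  arm _ _ _ h := h.elim
  root _ _ _ _ := rfl
  end_eq _ _ _ _ _ _ := rfl
  inter_subset _ _ _ _ _ _ _ _ _ := rfl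

section Insert

variable {S : Set (Comp G Q)} {c d : Comp G Q} {r a : W} {r' : W'} {ψ : V → Set W}
  {ψ' : V → Set W'} {e : V → C → W} {e' : V → W'} {x y v w : V} {k : C}

/-- If `γ_c` is dominated by all members of its color that it is attached to, then its vertices in
`Q` cannot be told apart by these members, so their paths of this color have the same end. -/
lemma IsGlued.exists_end_eq (h : IsGlued G Q f S T r ψ e)
    (hdom : ∀ d ∈ S, f d = f c → Attached G Q c d → Dominated G Q c d) :
    ∃ a, ∀ x ∈ nbr G Q c, e x (f c) = a := by
  rcases (nbr G Q c).eq_empty_or_nonempty with hc | ⟨x₀, hx₀⟩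
  · exact ⟨r, fun x hx => absurd hx (hc ▸ Set.notMem_empty x)⟩
  refine ⟨e x₀ (f c), fun x hx => h.end_eq x hx.1 x₀ hx₀.1 _ fun d hd hfd L hL => ?_⟩
  by_cases hatt : Attached G Q c d
  · rcases (dominated_iff_nbr.1 (hdom d hd hfd hatt)).2 L hL with hsub | hdisj
    · exact ⟨fun _ => hsub hx₀, fun _ => hsub hx⟩
    · rw [Set.eq_empty_iff_forall_notMem] at hdisj
      exact iff_of_false (fun hxL => hdisj x ⟨hx, hxL⟩) fun hxL => hdisj x₀ ⟨hx₀, hxL⟩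
  · rw [attached_iff_nbr] at hatt
    exact iff_of_false (fun hxL => hatt ⟨x, hx, hx.1, L, hL, hxL⟩)
      fun hxL => hatt ⟨x₀, hx₀, hx₀.1, L, hL, hxL⟩

open Classical in
/-- The path representing `v` after gluing the representation `ψ'` of `γ_c` to `ψ`. -/
noncomputable def gluedPath (c : Comp G Q) (ψ : V → Set W) (ψ' : V → Set W') (v : V) :
    Set (W ⊕ W') :=
  if v ∈ compSet G Q c then Sum.inr '' ψ' v else Sum.inl '' ψ v

open Classical in
/-- The ends of the paths representing the vertices of `Q` after gluing a representation of `γ_c`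
with ends `e'`: the path of color `f c` of a vertex of `γ_c` is prolonged into the new tree. -/
noncomputable def gluedEnd (f : Comp G Q → C) (c : Comp G Q) (e : V → C → W) (e' : V → W')
    (x : V) (k : C) : W ⊕ W' :=
  if x ∈ nbr G Q c ∧ k = f c then Sum.inr (e' x) else Sum.inl (e x k)

lemma gluedPath_of_mem (hv : v ∈ compSet G Q c) : gluedPath c ψ ψ' v = Sum.inr '' ψ' v := if_pos hv

lemma gluedPath_of_ne (hdc : d ≠ c) (hv : v ∈ compSet G Q d) :
    gluedPath c ψ ψ' v = Sum.inl '' ψ v :=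
  if_neg fun hvc => hdc (compSet_eq_of_mem hv hvc)

lemma gluedEnd_of_mem (hx : x ∈ nbr G Q c) : gluedEnd f c e e' x (f c) = Sum.inr (e' x) :=
  if_pos ⟨hx, rfl⟩

lemma gluedEnd_of_not (hx : ¬ (x ∈ nbr G Q c ∧ k = f c)) :
    gluedEnd f c e e' x k = Sum.inl (e x k) := if_neg hx

section Join

variable [Finite W] [Finite W'] (hT : T.IsTree) (hT' : T'.IsTree)

include hT hT'

lemma inl_mem_seg_gluedEnd_iff (ha : ∀ x ∈ nbr G Q c, e x (f c) = a) {z : W} :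
    Sum.inl z ∈ seg (join T T' a r') (Sum.inl r) (gluedEnd f c e e' x k) ↔
      z ∈ seg T r (e x k) := by
  by_cases hx : x ∈ nbr G Q c ∧ k = f c
  · obtain ⟨hx, rfl⟩ := hx
    simp [gluedEnd_of_mem hx, seg_join_inl_inr hT hT', ha x hx]
  · simp [gluedEnd_of_not hx, seg_join_inl hT hT']

lemma inr_mem_seg_gluedEnd_iff {z : W'} :
    Sum.inr z ∈ seg (join T T' a r') (Sum.inl r) (gluedEnd f c e e' x k) ↔
      (x ∈ nbr G Q c ∧ k = f c) ∧ z ∈ seg T' r' (e' x) := by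
  by_cases hx : x ∈ nbr G Q c ∧ k = f c
  · obtain ⟨hx, rfl⟩ := hx
    simp [gluedEnd_of_mem hx, seg_join_inl_inr hT hT', hx]
  · simp [gluedEnd_of_not hx, seg_join_inl hT hT', hx]

end Join

lemma not_adj_and_gluedPath_inter_eq_empty (hdc : d ≠ c) (hv : v ∈ compSet G Q c)
    (hw : w ∈ compSet G Q d) :
    ¬ G.Adj v w ∧ gluedPath c ψ ψ' v ∩ gluedPath c ψ ψ' w = ∅ := by
  constructor
  · intro hvw
    exact hdc (compSet_eq_of_mem hw (mem_compSet_of_adj hv hvw (notMem_of_mem_compSet hw)))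
  · rw [gluedPath_of_mem hv, gluedPath_of_ne hdc hw]
    exact (Set.disjoint_image_inl_image_inr.symm).inter_eq

lemma IsGlued.gluedPath_adj_iff (h : IsGlued G Q f S T r ψ e) (hc : c ∉ S)
    (h' : IsRootedRep G Q c T' r' ψ' e') {d₁ d₂ : Comp G Q} (hd₁ : d₁ ∈ insert c S)
    (hd₂ : d₂ ∈ insert c S) (hv : v ∈ compSet G Q d₁) (hw : w ∈ compSet G Q d₂) (hne : v ≠ w) :
    G.Adj v w ↔ (gluedPath c ψ ψ' v ∩ gluedPath c ψ ψ' w).Nonempty := by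
  have hcross {d : Comp G Q} (hd : d ∈ S) {v w : V} (hv : v ∈ compSet G Q c)
      (hw : w ∈ compSet G Q d) :
      G.Adj v w ↔ (gluedPath c ψ ψ' v ∩ gluedPath c ψ ψ' w).Nonempty := by
    have := not_adj_and_gluedPath_inter_eq_empty (ψ := ψ) (ψ' := ψ')
      (ne_of_mem_of_not_mem hd hc) hv hw
    exact iff_of_false this.1 (Set.not_nonempty_iff_eq_empty.2 this.2)
  obtain rfl | hd₁ := hd₁ <;> obtain rfl | hd₂ := hd₂
  · rw [h'.adj_iff v hv w hw hne, gluedPath_of_mem hv, gluedPath_of_mem hw,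
      ← Set.image_inter Sum.inr_injective, Set.image_nonempty]
  · exact hcross hd₂ hv hw
  · rw [SimpleGraph.adj_comm, Set.inter_comm]
    exact hcross hd₁ hw hv
  · rw [h.adj_iff d₁ hd₁ d₂ hd₂ v hv w hw hne, gluedPath_of_ne (ne_of_mem_of_not_mem hd₁ hc) hv,
      gluedPath_of_ne (ne_of_mem_of_not_mem hd₂ hc) hw, ← Set.image_inter Sum.inl_injective,
      Set.image_nonempty]

lemma IsGlued.gluedEnd_arm [Finite V] [Finite W] [Finite W'] (h : IsGlued G Q f S T r ψ e)
    (hQ : G.IsClique Q) (hc : c ∉ S) (h' : IsRootedRep G Q c T' r' ψ' e')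
    (ha : ∀ x ∈ nbr G Q c, e x (f c) = a) (hx : x ∈ Q) (hd : d ∈ insert c S)
    (hv : v ∈ compSet G Q d) :
    G.Adj x v ↔ ∃ k, (seg (join T T' a r') (Sum.inl r) (gluedEnd f c e e' x k) ∩
      gluedPath c ψ ψ' v).Nonempty := by
  obtain rfl | hd := hd
  · rw [gluedPath_of_mem hv]
    constructor
    · intro hadj
      have hxd : x ∈ nbr G Q d := (mem_nbr_iff hQ).2 ⟨hx, v, hv, hadj⟩
      obtain ⟨z, hz, hzv⟩ := (h'.arm x hxd v hv).1 hadj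
      exact ⟨f d, Sum.inr z,
        (inr_mem_seg_gluedEnd_iff h.isTree h'.isTree).2 ⟨⟨hxd, rfl⟩, hz⟩, z, hzv, rfl⟩
    · rintro ⟨k, _, hz, z, hzv, rfl⟩
      obtain ⟨⟨hxd, -⟩, hz⟩ := (inr_mem_seg_gluedEnd_iff h.isTree h'.isTree).1 hz
      exact (h'.arm x hxd v hv).2 ⟨z, hz, hzv⟩
  · rw [gluedPath_of_ne (ne_of_mem_of_not_mem hd hc) hv, h.arm x hx d hd v hv]
    refine exists_congr fun k => ?_
    constructor
    · rintro ⟨z, hz, hzv⟩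
      exact ⟨Sum.inl z, (inl_mem_seg_gluedEnd_iff h.isTree h'.isTree ha).2 hz, z, hzv, rfl⟩
    · rintro ⟨_, hz, z, hzv, rfl⟩
      exact ⟨z, (inl_mem_seg_gluedEnd_iff h.isTree h'.isTree ha).1 hz, hzv⟩

lemma IsGlued.gluedEnd_eq (h : IsGlued G Q f S T r ψ e) (h' : IsRootedRep G Q c T' r' ψ' e')
    (hx : x ∈ Q) (hy : y ∈ Q)
    (hxy : ∀ d ∈ insert c S, f d = k → ∀ L, IsRelevant G Q d L → (x ∈ L ↔ y ∈ L)) :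
    gluedEnd f c e e' x k = gluedEnd f c e e' y k := by
  have hold := h.end_eq x hx y hy k fun d hd => hxy d (Or.inr hd)
  by_cases hkc : k = f c
  · subst hkc
    have hL := hxy c (Or.inl rfl) rfl
    have hmem : x ∈ nbr G Q c ↔ y ∈ nbr G Q c :=
      ⟨fun ⟨_, L, hLr, hxL⟩ => ⟨hy, L, hLr, (hL L hLr).1 hxL⟩,
        fun ⟨_, L, hLr, hyL⟩ => ⟨hx, L, hLr, (hL L hLr).2 hyL⟩⟩
    by_cases hxc : x ∈ nbr G Q c
    · rw [gluedEnd_of_mem hxc, gluedEnd_of_mem (hmem.1 hxc), h'.end_eq x hxc y (hmem.1 hxc) hL]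
    · rw [gluedEnd_of_not fun h => hxc h.1, gluedEnd_of_not fun h => hxc (hmem.2 h.1), hold]
  · rw [gluedEnd_of_not fun h => hkc h.2, gluedEnd_of_not fun h => hkc h.2, hold]

lemma IsGlued.insert [Finite V] [Finite W] [Finite W'] (hQ : G.IsClique Q)
    (h : IsGlued G Q f S T r ψ e) (hc : c ∉ S) (h' : IsRootedRep G Q c T' r' ψ' e')
    (ha : ∀ x ∈ nbr G Q c, e x (f c) = a) :
    IsGlued G Q f (insert c S) (join T T' a r') (Sum.inl r) (gluedPath c ψ ψ')
      (gluedEnd f c e e') where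
  isTree := isTree_join h.isTree h'.isTree
  exists_seg := by
    rintro d (rfl | hd) v hv
    · obtain ⟨s, t, hst⟩ := h'.exists_seg v hv
      exact ⟨_, _, by rw [gluedPath_of_mem hv, hst, seg_join_inr h.isTree h'.isTree s t]⟩
    · obtain ⟨s, t, hst⟩ := h.exists_seg d hd v hv
      exact ⟨_, _, by rw [gluedPath_of_ne (ne_of_mem_of_not_mem hd hc) hv, hst,
        seg_join_inl h.isTree h'.isTree s t]⟩
  adj_iff _ hd₁ _ hd₂ _ hv _ hw := h.gluedPath_adj_iff hc h' hd₁ hd₂ hv hw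
  arm _ hx _ hd _ hv := h.gluedEnd_arm hQ hc h' ha hx hd hv
  root x hx k hk := by
    rw [gluedEnd_of_not, h.root x hx k fun d hd => hk d (Or.inr hd)]
    rintro ⟨hxc, rfl⟩
    exact hk c (Or.inl rfl) rfl hxc
  end_eq _ hx _ hy _ hxy := h.gluedEnd_eq h' hx hy hxy
  inter_subset := by
    have hT := h.isTree
    have hT' := h'.isTree
    rintro x hx y hy k l hkl (z | z) ⟨hz, hz'⟩
    · exact congrArg Sum.inl (h.inter_subset x hx y hy k l hkl
        ⟨(inl_mem_seg_gluedEnd_iff hT hT' ha).1 hz, (inl_mem_seg_gluedEnd_iff hT hT' ha).1 hz'⟩)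
    · exact absurd (((inr_mem_seg_gluedEnd_iff hT hT').1 hz).1.2.trans
        ((inr_mem_seg_gluedEnd_iff hT hT').1 hz').1.2.symm) hkl

end Insert

lemma exists_forall_dominated_of_dominated [Finite V] {S : Set (Comp G Q)} (hS : S.Nonempty) :
    ∃ c ∈ S, ∀ d ∈ S, Dominated G Q d c → Dominated G Q c d := by
  let A := attachmentSystem G Q
  have : IsTrans (Comp G Q) A.lt := ⟨fun _ _ _ => A.trans⟩
  have : Std.Irrefl A.lt := ⟨A.irrefl⟩
  obtain ⟨c, hc, hmin⟩ := (Finite.wellFounded_of_trans_of_irrefl A.lt).has_min S hS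
  refine ⟨c, hc, fun d hd hdc => ?_⟩
  by_contra hcd
  exact hmin d hd ⟨hdc, Or.inl hcd⟩

/-- The members of `Γ_Q` are glued by decreasing dominance, so that each of them is dominated by the
members of its color that are already there and that it is attached to. -/
lemma IsGoodColoring.exists_isGlued [Finite V] (hQ : G.IsClique Q)
    (hf : IsGoodColoring (attachednessGraph G Q) (nbr G Q) f)
    (hrep : ∀ c : Comp G Q, ∃ (W : Type u) (_ : Finite W) (T : SimpleGraph W) (r : W)
      (ψ : V → Set W) (e : V → W), IsRootedRep G Q c T r ψ e) (S : Finset (Comp G Q)) :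
    ∃ (W : Type u) (_ : Finite W) (T : SimpleGraph W) (r : W) (ψ : V → Set W) (e : V → C → W),
      IsGlued G Q f S T r ψ e := by
  classical
  induction S using Finset.strongInduction with
  | H S ih =>
    rcases S.eq_empty_or_nonempty with rfl | hS
    · rw [Finset.coe_empty]
      exact ⟨_, inferInstance, _, _, _, _, isGlued_empty⟩
    obtain ⟨c, hc, hmin⟩ := exists_forall_dominated_of_dominated (Finset.coe_nonempty.2 hS)
    obtain ⟨W, hW, T, r, ψ, e, h⟩ := ih (S.erase c) (Finset.erase_ssubset hc)
    obtain ⟨W', hW', T', r', ψ', e', h'⟩ := hrep c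
    obtain ⟨a, ha⟩ := h.exists_end_eq (c := c) (by
      intro d hd hfd hatt
      by_contra hcd
      exact hf.ne_of_antip (a := d) (b := c) ⟨Finset.ne_of_mem_erase hd, hatt.symm,
        fun hdc => hcd (hmin d (Finset.mem_of_mem_erase hd) hdc), hcd⟩ hfd)
    have hglue := h.insert hQ (by simp) h' ha
    rw [← Finset.coe_insert, Finset.insert_erase hc] at hglue
    exact ⟨_, inferInstance, _, _, _, _, hglue⟩

/-- The union of the paths from `r` to the nodes `e k`, with `r` added for the case that there are
no colors. -/
def segUnion (T : SimpleGraph W) (r : W) (e : C → W) : Set W := {z | z = r ∨ ∃ k, z ∈ seg T r (e k)}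

lemma segUnion_eq_seg {r a b : W} {e : C → W} (hT : T.IsTree) (ha : a = r ∨ ∃ k, a = e k)
    (hb : b = r ∨ ∃ k, b = e k) (hab : ∀ k, e k = r ∨ e k = a ∨ e k = b)
    (hdisj : seg T r a ∩ seg T r b ⊆ {r}) : segUnion T r e = seg T a b := by
  rw [← seg_union_seg_eq hT hdisj]
  have hsub {a : W} (ha : a = r ∨ ∃ k, a = e k) : seg T r a ⊆ segUnion T r e := by
    intro z hz
    obtain rfl | ⟨k, rfl⟩ := ha
    · exact Or.inl ((seg_self (T := T) a).subset hz)
    · exact Or.inr ⟨k, hz⟩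
  refine Set.Subset.antisymm ?_ (Set.union_subset (hsub ha) (hsub hb))
  rintro z (rfl | ⟨k, hz⟩)
  · exact Or.inl (left_mem_seg _ _)
  · rcases hab k with hk | hk | hk <;> rw [hk] at hz
    · rw [seg_self] at hz
      exact Or.inl (hz ▸ left_mem_seg _ _)
    · exact Or.inl hz
    · exact Or.inr hz

lemma IsGlued.exists_segUnion_eq_seg (hf : IsGoodColoring (attachednessGraph G Q) (nbr G Q) f)
    {r : W} {ψ : V → Set W} {e : V → C → W} (h : IsGlued G Q f Set.univ T r ψ e) {x : V}
    (hx : x ∈ Q) : ∃ a b, segUnion T r (e x) = seg T a b := by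
  by_cases hnbr : ∃ c, x ∈ nbr G Q c
  · obtain ⟨c, hc⟩ := hnbr
    by_cases hother : ∃ d, x ∈ nbr G Q d ∧ f c ≠ f d
    · obtain ⟨d, hd, hcd⟩ := hother
      refine ⟨e x (f c), e x (f d), segUnion_eq_seg h.isTree (Or.inr ⟨_, rfl⟩) (Or.inr ⟨_, rfl⟩)
        (fun k => ?_) (h.inter_subset x hx x hx _ _ hcd)⟩
      by_cases hk : ∃ d', x ∈ nbr G Q d' ∧ f d' = k
      · obtain ⟨d', hd', rfl⟩ := hk
        rcases hf.two_colors hc hd hd' with h' | h' | h'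
        · exact absurd h' hcd
        · exact Or.inr (Or.inr (congrArg (e x) h'.symm))
        · exact Or.inr (Or.inl (congrArg (e x) h'.symm))
      · exact Or.inl (h.root x hx k fun d' _ hd' hxd' => hk ⟨d', hxd', hd'⟩)
    · refine ⟨e x (f c), r,
        segUnion_eq_seg h.isTree (Or.inr ⟨_, rfl⟩) (Or.inl rfl) (fun k => ?_) ?_⟩
      · by_cases hkc : f c = k
        · exact Or.inr (Or.inl (by rw [hkc]))
        · exact Or.inl (h.root x hx k fun d _ hd hxd => hother ⟨d, hxd, hd ▸ hkc⟩)
      · exact Set.inter_subset_right.trans (seg_self r).subset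
  · refine ⟨r, r, segUnion_eq_seg h.isTree (Or.inl rfl) (Or.inl rfl) (fun k => Or.inl ?_) ?_⟩
    · exact h.root x hx k fun c _ _ hxc => hnbr ⟨c, hxc⟩
    · exact Set.inter_subset_right.trans (seg_self r).subset

lemma IsGlued.hasPathRep [Finite W] (hQ : G.IsClique Q)
    (hf : IsGoodColoring (attachednessGraph G Q) (nbr G Q) f)
    {r : W} {ψ : V → Set W} {e : V → C → W} (h : IsGlued G Q f Set.univ T r ψ e) :
    HasPathRep G := by
  classical
  let φ : V → Set W := fun x => if x ∈ Q then segUnion T r (e x) else ψ x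
  have hφQ {x : V} (hx : x ∈ Q) : φ x = segUnion T r (e x) := if_pos hx
  have hφ {x : V} (hx : x ∉ Q) : φ x = ψ x := if_neg hx
  have harm {x v : V} (hx : x ∈ Q) (hv : v ∉ Q) : G.Adj x v ↔ (φ x ∩ φ v).Nonempty := by
    obtain ⟨c, hc⟩ := exists_mem_compSet (G := G) hv
    rw [h.arm x hx c trivial v hc, hφQ hx, hφ hv]
    constructor
    · rintro ⟨k, z, hz, hzv⟩
      exact ⟨z, Or.inr ⟨k, hz⟩, hzv⟩
    · rintro ⟨z, rfl | ⟨k, hz⟩, hzv⟩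
      · exact ⟨f c, z, left_mem_seg _ _, hzv⟩
      · exact ⟨k, z, hz, hzv⟩
  refine ⟨W, inferInstance, T, φ, h.isTree, fun v _ => ?_, fun v _ w _ hne => ?_⟩
  · by_cases hv : v ∈ Q
    · rw [hφQ hv]
      exact h.exists_segUnion_eq_seg hf hv
    · rw [hφ hv]
      obtain ⟨c, hc⟩ := exists_mem_compSet (G := G) hv
      exact h.exists_seg c trivial v hc
  · by_cases hv : v ∈ Q <;> by_cases hw : w ∈ Q
    · rw [hφQ hv, hφQ hw]
      exact iff_of_true (hQ hv hw hne) ⟨r, Or.inl rfl, Or.inl rfl⟩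
    · exact harm hv hw
    · rw [SimpleGraph.adj_comm, Set.inter_comm]
      exact harm hw hv
    · obtain ⟨c, hc⟩ := exists_mem_compSet (G := G) hv
      obtain ⟨d, hd⟩ := exists_mem_compSet (G := G) hw
      rw [hφ hv, hφ hw]
      exact h.adj_iff c trivial d trivial v hc w hd hne

lemma HasGoodColoring.hasPathRep [Finite V] (hQ : IsMaxClique G Q) (h : HasGoodColoring G Q)
    (hrep : ∀ c : Comp G Q, HasPathRep (G.induce (piece G Q c))) : HasPathRep G := by
  classical
  obtain ⟨C, f, hf⟩ := h
  have := Fintype.ofFinite (Comp G Q)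
  have hrooted (c : Comp G Q) : ∃ (W : Type u) (_ : Finite W) (T : SimpleGraph W) (r : W)
      (ψ : V → Set W) (e : V → W), IsRootedRep G Q c T r ψ e := by
    obtain ⟨W, hW, T, φ, hφ⟩ := (hrep c).exists_isPathRepOn
    obtain ⟨r, e, he⟩ := hφ.exists_isRootedRep hQ
    exact ⟨W, hW, T, r, φ, e, he⟩
  obtain ⟨W, hW, T, r, ψ, e, h⟩ := hf.exists_isGlued hQ.prop.1 hrooted Finset.univ
  rw [Finset.coe_univ] at h
  exact h.hasPathRep hQ.prop.1 hf

end Gluing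

/-! ### Path representations from good colorings -/

section ChordalInduction

variable {V : Type u} {G : SimpleGraph V} {Q : Set V}

lemma hasGoodColoring_of_not_isCliqueSeparator (hQ : IsMaxClique G Q)
    (h : ¬ IsCliqueSeparator G Q) : HasGoodColoring G Q := by
  have := subsingleton_comp_of_not_isCliqueSeparator hQ h
  exact ⟨PUnit, fun _ => PUnit.unit, fun hab => absurd (Subsingleton.elim _ _) hab.1,
    fun _ _ _ => Or.inl rfl⟩

lemma IsCliqueSeparator.card_piece_lt [Finite V] (hQ : IsCliqueSeparator G Q) (c : Comp G Q) :
    Nat.card (piece G Q c) < Nat.card V := by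
  have := hQ.2
  obtain ⟨d, hd⟩ := exists_ne c
  obtain ⟨y, hy⟩ := compSet_nonempty d
  refine Finite.card_subtype_lt (x := y) ?_
  rintro (hyc | hyQ)
  · exact hd (compSet_eq_of_mem hy hyc)
  · exact notMem_of_mem_compSet hy hyQ

lemma IsChordal.hasPathRep [Finite V] (hG : IsChordal G)
    (h : ∀ Q, IsCliqueSeparator G Q → HasGoodColoring G Q) : HasPathRep G := by
  induction hn : Nat.card V using Nat.strong_induction_on generalizing V with
  | _ n ih =>
    by_cases hsep : ∃ Q, IsCliqueSeparator G Q
    · obtain ⟨Q, hQ⟩ := hsep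
      refine HasGoodColoring.hasPathRep hQ.1 (h Q hQ) fun c => ?_
      refine ih _ (hn ▸ hQ.card_piece_lt c) (hG.induce _) (fun Q' hQ' => ?_) rfl
      have hmax := isMaxClique_image_of_induce hQ.1 c hQ'.1
      refine HasGoodColoring.induce_piece hQ.1 c hQ'.1 ?_
      by_cases hs : IsCliqueSeparator G (Subtype.val '' Q')
      · exact h _ hs
      · exact hasGoodColoring_of_not_isCliqueSeparator hmax hs
    · push Not at hsep
      obtain ⟨K, L, hK, hL, hKL, hno⟩ := hG.exists_two_cliques hsep
      exact hasPathRep_of_two_cliques hK hL hKL hno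

end ChordalInduction

/-! ### Representations with private nodes -/

section PrivateNodes

variable {V W : Type u} {G : SimpleGraph V} {T : SimpleGraph W} {φ : V → Set W} {u v : V}

/-- The paths of a representation after the path of `v` is prolonged by a new node. -/
def prolong (φ : V → Set W) (v u : V) : Set (W ⊕ PUnit.{u + 1}) :=
  {z | Sum.elim (· ∈ φ u) (fun _ => u = v) z}

lemma inl_mem_prolong {w : W} : Sum.inl w ∈ prolong φ v u ↔ w ∈ φ u := Iff.rfl

lemma inr_mem_prolong {w : PUnit} : Sum.inr w ∈ prolong φ v u ↔ u = v := Iff.rfl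

lemma IsPathRepOn.prolong [Finite W] {a b : W} (h : IsPathRep G T φ) (hab : φ v = seg T a b) :
    IsPathRep G (join T ⊥ b PUnit.unit) (prolong φ v) where
  isTree := isTree_join h.isTree SimpleGraph.IsTree.of_subsingleton
  exists_seg u _ := by
    by_cases huv : u = v
    · subst huv
      refine ⟨Sum.inl a, Sum.inr PUnit.unit, ?_⟩
      rw [seg_join_inl_inr h.isTree SimpleGraph.IsTree.of_subsingleton, seg_self, ← hab]
      ext (z | z) <;> simp [inl_mem_prolong, inr_mem_prolong]
    · obtain ⟨s, t, hst⟩ := h.exists_seg u trivial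
      refine ⟨Sum.inl s, Sum.inl t, ?_⟩
      rw [seg_join_inl h.isTree SimpleGraph.IsTree.of_subsingleton, ← hst]
      ext (z | z) <;> simp [inl_mem_prolong, inr_mem_prolong, huv]
  adj_iff u _ w _ hne := by
    rw [h.adj_iff u trivial w trivial hne]
    constructor
    · rintro ⟨z, hz⟩
      exact ⟨Sum.inl z, hz⟩
    · rintro ⟨z | z, hz, hz'⟩
      · exact ⟨z, hz, hz'⟩
      · exact absurd (Eq.trans hz hz'.symm) hne


lemma HasPathRep.exists_private (h : HasPathRep G) (S : Finset V) :
    ∃ (W : Type u) (_ : Finite W) (T : SimpleGraph W) (φ : V → Set W) (p : V → W),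
      IsPathRep G T φ ∧ ∀ v ∈ S, p v ∈ φ v ∧ ∀ u, u ≠ v → p v ∉ φ u := by
  classical
  induction S using Finset.induction_on with
  | empty =>
    obtain ⟨W, hW, T, φ, hφ⟩ := h
    have := hφ.isTree.connected.nonempty
    exact ⟨W, hW, T, φ, fun _ => Classical.arbitrary W, hφ, by simp⟩
  | insert v S hv ih =>
    obtain ⟨W, hW, T, φ, p, hφ, hp⟩ := ih
    obtain ⟨a, b, hab⟩ := hφ.exists_seg v trivial
    refine ⟨W ⊕ PUnit.{u + 1}, inferInstance, _, _,
      fun u => if u = v then Sum.inr PUnit.unit else Sum.inl (p u), hφ.prolong hab, fun u hu => ?_⟩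
    by_cases huv : u = v
    · subst huv
      simpa only [if_true, inr_mem_prolong, true_and] using fun _ => id
    · simpa only [if_neg huv, inl_mem_prolong] using
        hp u ((Finset.mem_insert.1 hu).resolve_left huv)

lemma HasPathRep.isPathGraph [Finite V] (h : HasPathRep G) : IsPathGraph G := by
  have := Fintype.ofFinite V
  obtain ⟨W, hW, T, φ, p, hφ, hp⟩ := h.exists_private Finset.univ
  refine ⟨W, hW, T, φ, hφ.isTree, fun v => (isPathSet_iff hφ.isTree).2 (hφ.exists_seg v trivial),
    ?_, fun v w => hφ.adj_iff v trivial w trivial⟩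
  intro v w hvw
  by_contra hne
  exact (hp w (Finset.mem_univ _)).2 v hne (hvw ▸ (hp w (Finset.mem_univ _)).1)

lemma IsPathGraph.hasPathRep (h : IsPathGraph G) : HasPathRep G := by
  obtain ⟨W, hW, T, φ, hT, hφ, -, hadj⟩ := h
  exact ⟨W, hW, T, φ, hT, fun v _ => (isPathSet_iff hT).1 (hφ v), fun v _ w _ => hadj v w⟩

lemma HasPathRep.add_pendants [Finite V] (h : HasPathRep G) : HasPathRep (plus G) := by
  have := Fintype.ofFinite V
  obtain ⟨W, hW, T, φ, p, hφ, hp⟩ := h.exists_private Finset.univ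
  have hp' : ∀ u v, p v ∈ φ u ↔ u = v := fun u v =>
    ⟨fun h => by_contra fun hne => (hp v (Finset.mem_univ _)).2 u hne h,
      fun h => h ▸ (hp v (Finset.mem_univ _)).1⟩
  refine ⟨W, hW, T, Sum.elim φ fun v => {p v}, hφ.isTree, ?_, ?_⟩
  · rintro (v | v) _
    · exact hφ.exists_seg v trivial
    · exact ⟨p v, p v, (seg_self _).symm⟩
  · rintro (v | v) _ (w | w) _ hne
    · exact hφ.adj_iff v trivial w trivial fun h => hne (congrArg _ h)
    · change v = w ↔ _
      simp [hp']
    · change v = w ↔ _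
      simp [hp', eq_comm]
    · change False ↔ _
      simp only [Sum.elim_inr, false_iff]
      rintro ⟨_, rfl, hz⟩
      have : p v ∈ φ w := by
        rw [show p v = p w from hz, hp']
      exact hne (congrArg _ ((hp' w v).1 this).symm)

end PrivateNodes

/-! ### The attachedness graphs of `G⁺` -/

section Plus

variable {V : Type u} {G : SimpleGraph V} {Q : Set V} {v : V}

lemma dominated_of_subsingleton_nbr {c d : Comp G Q} (hc : (nbr G Q c).Subsingleton)
    (h : Attached G Q c d) : Dominated G Q c d := by
  refine dominated_iff_nbr.2 ⟨attached_iff_nbr.1 h, fun L _ => ?_⟩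
  rcases (nbr G Q c ∩ L).eq_empty_or_nonempty with hL | ⟨x, hx, hxL⟩
  · exact Or.inr hL
  · exact Or.inl fun y hy => hc hx hy ▸ hxL

lemma hasGoodColoring_of_subsingleton (hQ : Q.Subsingleton) : HasGoodColoring G Q := by
  have hdom (c d : Comp G Q) (h : Attached G Q c d) : Dominated G Q c d :=
    dominated_of_subsingleton_nbr (hQ.anti fun _ hx => hx.1) h
  exact ⟨PUnit, fun _ => PUnit.unit, fun h => absurd (hdom _ _ h.2.1) h.2.2.1,
    fun _ _ _ => Or.inl rfl⟩

/-- The inclusion of `G` into `G⁺`. -/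
def plusInl (G : SimpleGraph V) : G ↪g plus G where
  toFun := Sum.inl
  inj' := Sum.inl_injective
  map_rel_iff' := Iff.rfl

lemma isClique_plusInl {K : Set V} (hK : G.IsClique K) :
    (plus G).IsClique (plusInl G '' K) := by
  rintro _ ⟨x, hx, rfl⟩ _ ⟨y, hy, rfl⟩ hne
  exact hK hx hy fun h => hne (congrArg _ h)

lemma isMaxClique_plusInl {K : Set V} (hK : IsMaxClique G K) (h : K.Nontrivial) :
    IsMaxClique (plus G) (plusInl G '' K) := by
  refine ⟨⟨isClique_plusInl hK.prop.1, Set.subset_univ _⟩, ?_⟩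
  rintro L ⟨hL, -⟩ hKL (z | z) hz
  · refine ⟨z, hK.mem_of_forall fun y hy hne => ?_, rfl⟩
    exact hL hz (hKL ⟨y, hy, rfl⟩) fun h => hne (Sum.inl_injective h).symm
  · exfalso
    obtain ⟨x, hx, y, hy, hxy⟩ := h
    have hzx : z = x := hL hz (hKL ⟨x, hx, rfl⟩) Sum.inr_ne_inl
    have hzy : z = y := hL hz (hKL ⟨y, hy, rfl⟩) Sum.inr_ne_inl
    exact hxy (hzx.symm.trans hzy)

lemma HasPathRep.hasGoodColoring_plus [Finite V] (h : HasPathRep G) (hQ : IsMaxClique G Q) :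
    HasGoodColoring (plus G) (plusInl G '' Q) := by
  rcases Q.subsingleton_or_nontrivial with hs | hs
  · exact hasGoodColoring_of_subsingleton (hs.image _)
  · obtain ⟨W, hW, T, φ, hφ⟩ := h.add_pendants
    exact hφ.hasGoodColoring (isMaxClique_plusInl hQ hs)

lemma mem_compSet_compMap_plusInl_iff {c : Comp G Q} {z : V ⊕ V} :
    z ∈ compSet (plus G) (plusInl G '' Q) (compMap (plusInl G) Q c) ↔
      Sum.elim id id z ∈ compSet G Q c := by
  constructor
  · obtain ⟨x, hx⟩ := compSet_nonempty c
    refine fun hz => compSet_subset_of_adj (S := {z | Sum.elim id id z ∈ compSet G Q c}) ?_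
      (mem_compSet_compMap (plusInl G) hx) hx hz
    rintro (x | x) hx (y | y) hxy hy
    · exact mem_compSet_of_adj hx hxy fun hyQ => hy ⟨y, hyQ, rfl⟩
    · exact (show x = y from hxy) ▸ hx
    · exact (show x = y from hxy) ▸ hx
    · exact hxy.elim
  · intro hz
    rcases z with x | x
    · exact mem_compSet_compMap (plusInl G) hz
    · exact mem_compSet_of_adj (x := Sum.inl x) (mem_compSet_compMap (plusInl G) hz) rfl
        fun ⟨_, _, h⟩ => Sum.inl_ne_inr h

lemma compMap_plusInl_injective : Function.Injective (compMap (plusInl G) Q) :=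
  compMap_injective _ fun _ _ hx => mem_compSet_compMap_plusInl_iff.1 hx

lemma isRelevant_compMap_plusInl_iff (hQ : G.IsClique Q) {c : Comp G Q} {K' : Set (V ⊕ V)} :
    IsRelevant (plus G) (plusInl G '' Q) (compMap (plusInl G) Q c) K' ↔
      ∃ K, IsRelevant G Q c K ∧ K' = plusInl G '' K := by
  rw [isRelevant_iff (isClique_plusInl hQ)]
  constructor
  · rintro ⟨hK', ⟨_, hx, x, hxQ, rfl⟩, z, hzK, hzc⟩
    have hxz : (plus G).Adj (Sum.inl x) z := hK'.prop.1 hx hzK fun h =>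
      notMem_of_mem_compSet hzc ⟨x, hxQ, h⟩
    have hzc' := mem_compSet_compMap_plusInl_iff.1 hzc
    rcases z with y | y
    · change y ∈ compSet G Q c at hzc'
      have hinr : ∀ w, Sum.inr w ∉ K' := by
        intro w hw
        have hwx : w = x := hK'.prop.1 hw hx Sum.inr_ne_inl
        have hwy : w = y := hK'.prop.1 hw hzK Sum.inr_ne_inl
        exact notMem_of_mem_compSet hzc' (hwy ▸ hwx ▸ hxQ)
      have hK : K' = plusInl G '' (Sum.inl ⁻¹' K') := by
        ext (w | w)
        · exact ⟨fun h => ⟨w, h, rfl⟩, fun ⟨_, hv, hvw⟩ => hvw ▸ hv⟩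
        · exact ⟨fun h => absurd h (hinr w), fun ⟨_, _, hvw⟩ => absurd hvw Sum.inl_ne_inr⟩
      refine ⟨Sum.inl ⁻¹' K', (isRelevant_iff hQ).2 ⟨⟨⟨?_, Set.subset_univ _⟩, ?_⟩,
        ⟨x, hx, hxQ⟩, y, hzK, hzc'⟩, hK⟩
      · exact fun v hv w hw hne => hK'.prop.1 hv hw fun h => hne (Sum.inl_injective h)
      · rintro L ⟨hL, -⟩ hKL v hv
        refine hK'.le_of_ge ⟨isClique_plusInl hL, Set.subset_univ _⟩ ?_ ⟨v, hv, rfl⟩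
        rw [hK]
        exact Set.image_mono hKL
    · have hxy : x = y := hxz
      exact absurd (hxy ▸ hxQ) (notMem_of_mem_compSet hzc')
  · rintro ⟨K, hK, rfl⟩
    obtain ⟨hK, ⟨x, hxK, hxQ⟩, y, hyK, hyc⟩ := (isRelevant_iff hQ).1 hK
    refine ⟨isMaxClique_plusInl hK ⟨x, hxK, y, hyK, ?_⟩, ⟨_, ⟨x, hxK, rfl⟩, x, hxQ, rfl⟩,
      _, ⟨y, hyK, rfl⟩, mem_compSet_compMap _ hyc⟩
    rintro rfl
    exact notMem_of_mem_compSet hyc hxQ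

lemma nbr_compMap_plusInl (hQ : G.IsClique Q) (c : Comp G Q) :
    nbr (plus G) (plusInl G '' Q) (compMap (plusInl G) Q c) = plusInl G '' nbr G Q c := by
  ext z
  constructor
  · rintro ⟨⟨x, hxQ, rfl⟩, K', hK', hx⟩
    obtain ⟨K, hK, rfl⟩ := (isRelevant_compMap_plusInl_iff hQ).1 hK'
    obtain ⟨y, hy, hyx⟩ := hx
    exact ⟨x, ⟨hxQ, K, hK, (plusInl G).injective hyx ▸ hy⟩, rfl⟩
  · rintro ⟨x, ⟨hxQ, K, hK, hxK⟩, rfl⟩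
    exact ⟨⟨x, hxQ, rfl⟩, _, (isRelevant_compMap_plusInl_iff hQ).2 ⟨K, hK, rfl⟩, x, hxK, rfl⟩

lemma attached_compMap_plusInl_iff (hQ : G.IsClique Q) {c d : Comp G Q} :
    Attached (plus G) (plusInl G '' Q) (compMap (plusInl G) Q c) (compMap (plusInl G) Q d) ↔
      Attached G Q c d := by
  rw [attached_iff_nbr, attached_iff_nbr, nbr_compMap_plusInl hQ, nbr_compMap_plusInl hQ,
    ← Set.image_inter (plusInl G).injective, Set.image_nonempty]

lemma dominated_compMap_plusInl_iff (hQ : G.IsClique Q) {c d : Comp G Q} :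
    Dominated (plus G) (plusInl G '' Q) (compMap (plusInl G) Q c) (compMap (plusInl G) Q d) ↔
      Dominated G Q c d := by
  rw [dominated_iff_nbr, dominated_iff_nbr, nbr_compMap_plusInl hQ, nbr_compMap_plusInl hQ,
    ← Set.image_inter (plusInl G).injective, Set.image_nonempty]
  refine and_congr_right fun _ => ?_
  have key : ∀ L : Set V, (plusInl G '' nbr G Q c ⊆ plusInl G '' L ∨
      plusInl G '' nbr G Q c ∩ plusInl G '' L = ∅) ↔ (nbr G Q c ⊆ L ∨ nbr G Q c ∩ L = ∅) := by
    intro L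
    rw [Set.image_subset_image_iff (plusInl G).injective, ← Set.image_inter (plusInl G).injective,
      Set.image_eq_empty]
  constructor
  · intro h L hL
    exact (key L).1 (h _ ((isRelevant_compMap_plusInl_iff hQ).2 ⟨L, hL, rfl⟩))
  · intro h L' hL'
    obtain ⟨L, hL, rfl⟩ := (isRelevant_compMap_plusInl_iff hQ).1 hL'
    exact (key L).2 (h L hL)

lemma antip_adj_compMap_plusInl_iff (hQ : G.IsClique Q) {c d : Comp G Q} :
    (attachednessGraph (plus G) (plusInl G '' Q)).antip.Adj (compMap (plusInl G) Q c)
      (compMap (plusInl G) Q d) ↔ (attachednessGraph G Q).antip.Adj c d := by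
  change (_ ≠ _ ∧ Antipodal _ _ _ _) ↔ (_ ≠ _ ∧ Antipodal _ _ _ _)
  rw [Antipodal, Antipodal, attached_compMap_plusInl_iff hQ, dominated_compMap_plusInl_iff hQ,
    dominated_compMap_plusInl_iff hQ, compMap_plusInl_injective.ne_iff]

lemma dom_adj_compMap_plusInl_iff (hQ : G.IsClique Q) {c d : Comp G Q} :
    (attachednessGraph (plus G) (plusInl G '' Q)).dom.Adj (compMap (plusInl G) Q c)
      (compMap (plusInl G) Q d) ↔ (attachednessGraph G Q).dom.Adj c d := by
  change (_ ≠ _ ∧ (Dominated _ _ _ _ ∨ Dominated _ _ _ _)) ↔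
    (_ ≠ _ ∧ (Dominated _ _ _ _ ∨ Dominated _ _ _ _))
  rw [dominated_compMap_plusInl_iff hQ, dominated_compMap_plusInl_iff hQ,
    compMap_plusInl_injective.ne_iff]

lemma HasInducedCopy.attachednessGraph_plus (hQ : G.IsClique Q) {U : Type*} {S : TwoColoredGraph U}
    (h : HasInducedCopy S (attachednessGraph G Q)) :
    HasInducedCopy S (attachednessGraph (plus G) (plusInl G '' Q)) := by
  obtain ⟨f, hf, h1, h2⟩ := h
  refine ⟨compMap (plusInl G) Q ∘ f, compMap_plusInl_injective.comp hf, fun i j => ?_,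
    fun i j => ?_⟩
  · rw [h1, ← antip_adj_compMap_plusInl_iff hQ]
    rfl
  · rw [h2, ← dom_adj_compMap_plusInl_iff hQ]
    rfl

lemma compSet_plus_eq_of_inr_mem (hv : v ∈ Q) {c : Comp (plus G) (plusInl G '' Q)}
    (hc : Sum.inr v ∈ compSet (plus G) (plusInl G '' Q) c) :
    compSet (plus G) (plusInl G '' Q) c = {Sum.inr v} := by
  refine Set.Subset.antisymm (compSet_subset_of_adj ?_ hc rfl) (Set.singleton_subset_iff.2 hc)
  rintro _ rfl (y | y) hvy hy
  · exact absurd ⟨v, hv, congrArg Sum.inl hvy⟩ hy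
  · exact hvy.elim

lemma nbr_plus_eq_of_inr_mem [Finite V] (hQ : G.IsClique Q) (hv : v ∈ Q)
    {c : Comp (plus G) (plusInl G '' Q)} (hc : Sum.inr v ∈ compSet (plus G) (plusInl G '' Q) c) :
    nbr (plus G) (plusInl G '' Q) c = {Sum.inl v} := by
  ext z
  rw [mem_nbr_iff (isClique_plusInl hQ), compSet_plus_eq_of_inr_mem hv hc]
  constructor
  · rintro ⟨⟨x, -, rfl⟩, _, rfl, hxv⟩
    exact congrArg Sum.inl hxv
  · rintro rfl
    exact ⟨⟨v, hv, rfl⟩, _, rfl, rfl⟩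

lemma hasInducedCopy_wheelZero_one {Γ : Type u} {M : TwoColoredGraph Γ} {h : Γ} {g : Fin 3 → Γ}
    (hg : ∀ i j, i ≠ j → M.antip.Adj (g i) (g j)) (hh : ∀ i, M.dom.Adj h (g i)) :
    HasInducedCopy (wheelZero 1) M := by
  have hrim (i j : Fin 3) : (rim 3).Adj (some i) (some j) ↔ i ≠ j := by
    rw [rim, SimpleGraph.cycleGraph_three_eq_top]
    exact SimpleGraph.map_adj_apply
  have hantip (i j : Fin 3) : M.antip.Adj (g i) (g j) ↔ i ≠ j :=
    ⟨fun ha hij => ha.ne (congrArg g hij), hg i j⟩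
  refine hasInducedCopy_withHubs (fun o : Option (Fin 3) => o.elim h g) ?_ ?_ ?_
  · rintro (_ | i) (_ | j) hij
    · rfl
    · exact absurd hij (hh j).ne
    · exact absurd hij.symm (hh i).ne
    · by_contra hne
      exact (hg i j fun h => hne (congrArg some h)).ne hij
  · rintro (_ | i) (_ | j)
    · exact iff_of_false not_rim_adj_none M.antip.irrefl
    · exact iff_of_false not_rim_adj_none fun ha => M.disj _ _ ha (hh j)
    · exact iff_of_false (fun ha => not_rim_adj_none ha.symm) fun ha => M.disj _ _ ha (hh i).symm
    · exact (hrim i j).trans (hantip i j).symm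
  · rintro (_ | i) (_ | j) hij hna
    · exact absurd rfl hij
    · exact iff_of_true (Or.inl rfl) (hh j)
    · exact iff_of_true (Or.inr rfl) (hh i).symm
    · exact absurd ((hrim i j).2 fun h => hij (congrArg some h)) hna

/-- The new member of `Γ_Q` given by the pendant vertex at the common vertex of the triangle is
dominated by the three members of the triangle. -/
lemma HasFullAntipodalTriangle.hasInducedCopy_plus [Finite V] (hQ : G.IsClique Q)
    (h : HasFullAntipodalTriangle G Q) :
    HasInducedCopy (wheelZero 1) (attachednessGraph (plus G) (plusInl G '' Q)) := by
  obtain ⟨c₁, c₂, c₃, h₁₂, h₂₃, h₁₃, v, hv, h₁, h₂, h₃⟩ := h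
  obtain ⟨c₀, hc₀⟩ := exists_mem_compSet (G := plus G) (Q := plusInl G '' Q) (x := Sum.inr v)
    fun ⟨_, _, h⟩ => Sum.inl_ne_inr h
  have hnbr := nbr_plus_eq_of_inr_mem hQ hv hc₀
  have hdom {c : Comp G Q} (hc : IsNeighboring G Q c v) :
      (attachednessGraph (plus G) (plusInl G '' Q)).dom.Adj c₀ (compMap (plusInl G) Q c) := by
    refine ⟨?_, Or.inl (dominated_of_subsingleton_nbr ?_ (attached_iff_nbr.2 ⟨Sum.inl v, ?_, ?_⟩))⟩
    · rintro rfl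
      exact notMem_of_mem_compSet (mem_compSet_compMap_plusInl_iff.1 hc₀) hv
    · exact hnbr ▸ Set.subsingleton_singleton
    · exact hnbr ▸ rfl
    · exact nbr_compMap_plusInl hQ c ▸ ⟨v, ⟨hv, hc⟩, rfl⟩
  have hantip {c d : Comp G Q} := (antip_adj_compMap_plusInl_iff hQ (c := c) (d := d)).2
  refine hasInducedCopy_wheelZero_one (h := c₀)
    (g := ![compMap _ Q c₁, compMap _ Q c₂, compMap _ Q c₃]) (fun i j hij => ?_) fun i => ?_
  · fin_cases i <;> fin_cases j <;> first | exact absurd rfl hij | skip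
    exacts [hantip h₁₂, hantip h₁₃, (hantip h₁₂).symm, hantip h₂₃, (hantip h₁₃).symm,
      (hantip h₂₃).symm]
  · fin_cases i
    exacts [hdom h₁, hdom h₂, hdom h₃]

end Plus

end PathGraphs

theorem theorem4p4 {V : Type*} [Finite V] (G : SimpleGraph V) (hG : PathGraphs.IsChordal G) :
    List.TFAE [
      PathGraphs.IsPathGraph G,
      ∀ Q : Set V, PathGraphs.IsCliqueSeparator G Q →
        ¬ PathGraphs.HasFullAntipodalTriangle G Q ∧
        ∀ S ∈ PathGraphs.familyZero,
          ¬ PathGraphs.HasCopy S.2 (PathGraphs.attachednessGraph G Q),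
      ∀ Q : Set V, PathGraphs.IsCliqueSeparator G Q →
        ∀ S ∈ PathGraphs.familyZero,
          ¬ PathGraphs.HasCopy S.2
            (PathGraphs.attachednessGraph (PathGraphs.plus G) (Sum.inl '' Q)),
      ∀ Q : Set V, PathGraphs.IsCliqueSeparator G Q →
        ¬ PathGraphs.HasFullAntipodalTriangle G Q ∧
        ∀ S ∈ PathGraphs.family,
          ¬ PathGraphs.HasInducedCopy S.2 (PathGraphs.attachednessGraph G Q),
      ∀ Q : Set V, PathGraphs.IsCliqueSeparator G Q →
        ∀ S ∈ PathGraphs.family,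
          ¬ PathGraphs.HasInducedCopy S.2
            (PathGraphs.attachednessGraph (PathGraphs.plus G) (Sum.inl '' Q))] := by
  tfae_have 1 → 2 := fun h Q hQ => by
    obtain ⟨_, _, _, _, hφ⟩ := h.hasPathRep
    have hc := hφ.hasGoodColoring hQ.1
    exact ⟨hc.not_hasFullAntipodalTriangle, hc.not_hasCopy⟩
  tfae_have 2 → 4 := fun h Q hQ =>
    ⟨(h Q hQ).1, PathGraphs.not_hasInducedCopy_of_not_hasCopy (h Q hQ).2⟩
  tfae_have 4 → 1 := fun h => PathGraphs.HasPathRep.isPathGraph (hG.hasPathRep fun Q hQ =>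
    PathGraphs.HasGoodColoring.of_not_hasInducedCopy (h Q hQ).1 (h Q hQ).2)
  tfae_have 1 → 3 := fun h Q hQ => (h.hasPathRep.hasGoodColoring_plus hQ.1).not_hasCopy
  tfae_have 3 → 5 := fun h Q hQ => PathGraphs.not_hasInducedCopy_of_not_hasCopy (h Q hQ)
  tfae_have 5 → 4 := fun h Q hQ =>
    ⟨fun ht => h Q hQ _ (Or.inl (PathGraphs.wheelZero_mem_familyZero le_rfl))
      (ht.hasInducedCopy_plus hQ.1.prop.1),
      fun S hS hc => h Q hQ S hS (hc.attachednessGraph_plus hQ.1.prop.1)⟩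
  tfae_finish
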